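/- Let $\mathfrak{ham}_2^0$ be the Lie algebra of formal Hamiltonian vector fields on $\mathbb R^2$ vanishing at the origin, i.e. of formal power series in $q,p$ over $\mathbb R$ without terms of degree $<2$ (the completion of $\bigoplus_{\ell\ge 2}S^\ell$, with $S^\ell$ the homogeneous polynomials of degree $\ell$ in $q,p$), with bracket the Poisson bracket and the topology of coefficientwise convergence. The group $Sp(2,\mathbb R)$ acts by $a\cdot f=f\circ a^{-1}$, and $\mathfrak{sp}(2,\mathbb R)$ is identified with $S^2$. For integers $m,w\ge 0$ let $C^m_w=C^m(\mathfrak{ham}_2^0,Sp(2,\mathbb R))_w$ be the space of continuous alternating $\mathbb R$-multilinear forms $\sigma$ in $m$ variables on $\mathfrak{ham}_2^0$ with $i_X\sigma=0$ for all $X\in\mathfrak{sp}(2,\mathbb R)$ and $a^*\sigma=\sigma$ for all $a\in Sp(2,\mathbb R)$, which are of weight $w$, i.e. vanish on all tuples of homogeneous elements of degrees $\ell_1,\dots,\ell_m$ with $\sum_i(\ell_i-2)\ne w$. Let $H^m_w$ be the cohomology of $C^\bullet_w$ under the Chevalley–Eilenberg coboundary operator, and put $$\chi(w)=1+\sum_{m\ge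 1}(-1)^m\dim C^m_w .$$ (The summand $1$ is the $0$-dimensional cochain space $\mathbb R$.) Then: 1. Every $C^m_w$ is finite-dimensional, and $C^m_w=0$ for $m>w$. 2. For all $m,w\ge 0$, $$\dim C^m_w=\sum_{(k_3,k_4,\dots)}\big[\Lambda^{k_3}S^{3*}\otimes\Lambda^{k_4}S^{4*}\otimes\cdots:\mathbf 1\big],$$ where the sum is over all sequences of non-negative integers with $\sum_j k_j=m$ and $\sum_j(j-2)k_j=w$, and $[V:\mathbf 1]=\dim\mathrm{Hom}_{Sp(2,\mathbb R)}(\mathbf 1,V)$ is the multiplicity of the trivial representation of $Sp(2,\mathbb R)$ in $V$. 3. There are algorithms computing all these numbers: the contribution $[\Lambda^{k_3}S^{3*}\otimes\cdots\otimes\Lambda^{k_s}S^{s*}:\mathbf 1]$ is a computable function of the finite sequence $(k_3,\dots,k_s)$, $\dim C^m_w$ is a computable function of $(m,w)$, and $\chi(w)$ is a computable function of $w$. 4. For even $w$ with $2\le w\le 30$, the dimensions of $C^1_w,C^2_w,\dots$ (all not listed being $0$) and $\chi(w)$ are as follows. $$\begin{array}{r|l|r} w&\dim C^1_w,\ \dim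 C^2_w,\ \dots&\chi(w)\\\hline 2&0,1&2\\ 4&0,0,1,1&1\\ 6&0,1,1,0,0&1\\ 8&0,0,4,5,1,0&1\\ 10&0,1,3,9,12,4,0&0\\ 12&0,0,8,23,22,13,5,0&2\\ 14&0,1,6,31,71,58,15,2,1&0\\ 16&0,0,12,61,126,147,95,24,0&0\\ 18&0,1,10,80,262,380,268,100,21,1&2\\ 20&0,0,17,124,423,791,801,414,96,9,1&1\\ 22&0,1,14,163,738,1586,1874,1276,479,82,3&1\\ 24&0,0,23,229,1091,2897,4281,3534,1628,408,49,1&-2\\ 26&0,1,19,285,1722,5102,8613,8735,5222,1703,266,19,1&3\\ 28&0,0,29,385,2428,8465,16905,19930,14133,5981,1408,144,2&1\\ 30&0,1,25,468,3541,13661,30687,42291,35986,18457,5431,855,63,0&1 \end{array}$$ 5. For every $w\ge 0$ with $\chi(w)\ne 1$ there is some $m\ge 1$ with $H^m_w\ne 0$. -/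

import Mathlib

open scoped MvPowerSeries.WithPiTopology TensorProduct

noncomputable section

namespace FormalHam

/-! ### Formal Hamiltonian vector fields on the `2n`-plane

The variables `q¹, …, qⁿ` are indexed by `Sum.inl` and `p₁, …, pₙ` by `Sum.inr`. -/

/-- The formal Hamiltonian vector fields vanishing at the origin, represented by their
Hamiltonian potentials: formal power series in `q, p` without terms of degree `0` and `1`,
that is, the completion of `⨁_{ℓ ≥ 2} S^ℓ`. It carries the topology of coefficientwise
convergence. -/
def ham0 (n : ℕ) : Submodule ℝ (MvPowerSeries (Fin n ⊕ Fin n) ℝ) where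
  carrier := {f | ∀ d : (Fin n ⊕ Fin n) →₀ ℕ, d.degree < 2 → MvPowerSeries.coeff d f = 0}
  add_mem' hf hg d hd := by rw [map_add, hf d hd, hg d hd, add_zero]
  zero_mem' d _ := by simp
  smul_mem' c f hf d hd := by rw [map_smul, hf d hd, smul_zero]

/-- The Poisson bracket `{f, g} = ∑ᵢ (∂f/∂qⁱ ∂g/∂pᵢ - ∂f/∂pᵢ ∂g/∂qⁱ)`. -/
def poisson {n : ℕ} (f g : MvPowerSeries (Fin n ⊕ Fin n) ℝ) :
    MvPowerSeries (Fin n ⊕ Fin n) ℝ :=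
  ∑ i : Fin n,
    (MvPowerSeries.pderiv ℝ (Sum.inl i) f * MvPowerSeries.pderiv ℝ (Sum.inr i) g -
      MvPowerSeries.pderiv ℝ (Sum.inr i) f * MvPowerSeries.pderiv ℝ (Sum.inl i) g)

theorem two_le_order_of_mem {n : ℕ} {f : MvPowerSeries (Fin n ⊕ Fin n) ℝ} (hf : f ∈ ham0 n) :
    (2 : ℕ∞) ≤ f.order :=
  MvPowerSeries.nat_le_order (n := 2) fun d hd => hf d hd

theorem mem_of_two_le_order {n : ℕ} {f : MvPowerSeries (Fin n ⊕ Fin n) ℝ}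
    (hf : (2 : ℕ∞) ≤ f.order) : f ∈ ham0 n := fun d hd =>
  MvPowerSeries.coeff_of_lt_order (lt_of_lt_of_le (by exact_mod_cast hd) hf)

theorem one_le_order_pderiv {n : ℕ} {f : MvPowerSeries (Fin n ⊕ Fin n) ℝ} (hf : f ∈ ham0 n)
    (i : Fin n ⊕ Fin n) : (1 : ℕ∞) ≤ (MvPowerSeries.pderiv ℝ i f).order := by
  refine MvPowerSeries.nat_le_order (n := 1) fun d hd => ?_
  rw [MvPowerSeries.coeff_pderiv, hf _ (by simp; omega), zero_mul]

theorem pderiv_mul_mem {n : ℕ} {f g : MvPowerSeries (Fin n ⊕ Fin n) ℝ} (hf : f ∈ ham0 n)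
    (hg : g ∈ ham0 n) (i j : Fin n ⊕ Fin n) :
    MvPowerSeries.pderiv ℝ i f * MvPowerSeries.pderiv ℝ j g ∈ ham0 n := by
  refine mem_of_two_le_order (le_trans ?_ MvPowerSeries.le_order_mul)
  rw [← one_add_one_eq_two]
  exact add_le_add (one_le_order_pderiv hf i) (one_le_order_pderiv hg j)

theorem poisson_mem {n : ℕ} {f g : MvPowerSeries (Fin n ⊕ Fin n) ℝ} (hf : f ∈ ham0 n)
    (hg : g ∈ ham0 n) : poisson f g ∈ ham0 n :=
  Submodule.sum_mem _ fun _ _ =>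
    Submodule.sub_mem _ (pderiv_mul_mem hf hg _ _) (pderiv_mul_mem hf hg _ _)

/-- The Lie bracket of formal Hamiltonian vector fields is the Poisson bracket of potentials. -/
instance (n : ℕ) : Bracket (ham0 n) (ham0 n) where
  bracket f g := ⟨poisson f.1 g.1, poisson_mem f.2 g.2⟩

/-! ### The action of the symplectic group -/

/-- `Sp(2n, ℝ)`. -/
abbrev Sp (n : ℕ) : Type := Matrix.symplecticGroup (Fin n) ℝ

/-- The linear substitution `x ↦ A x`, as a family of linear forms. -/
def linForm {n : ℕ} (A : Matrix (Fin n ⊕ Fin n) (Fin n ⊕ Fin n) ℝ) (i : Fin n ⊕ Fin n) :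
    MvPolynomial (Fin n ⊕ Fin n) ℝ :=
  ∑ j, MvPolynomial.C (A i j) * MvPolynomial.X j

theorem isHomogeneous_linForm {n : ℕ} (A : Matrix (Fin n ⊕ Fin n) (Fin n ⊕ Fin n) ℝ)
    (i : Fin n ⊕ Fin n) : (linForm A i).IsHomogeneous 1 :=
  MvPolynomial.IsHomogeneous.sum _ _ _ fun j _ => (MvPolynomial.isHomogeneous_X ℝ j).C_mul _

theorem one_le_order_linForm {n : ℕ} (A : Matrix (Fin n ⊕ Fin n) (Fin n ⊕ Fin n) ℝ)
    (i : Fin n ⊕ Fin n) :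
    (1 : ℕ∞) ≤ (linForm A i : MvPowerSeries (Fin n ⊕ Fin n) ℝ).order := by
  refine MvPowerSeries.nat_le_order (n := 1) fun d hd => ?_
  rw [MvPolynomial.coeff_coe]
  exact (isHomogeneous_linForm A i).coeff_eq_zero (by omega)

theorem hasSubst_linForm {n : ℕ} (A : Matrix (Fin n ⊕ Fin n) (Fin n ⊕ Fin n) ℝ) :
    MvPowerSeries.HasSubst
      (fun i => (linForm A i : MvPowerSeries (Fin n ⊕ Fin n) ℝ)) :=
  MvPowerSeries.hasSubst_of_constantCoeff_zero fun i =>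
    MvPowerSeries.one_le_order_iff_constCoeff_eq_zero.1 (one_le_order_linForm A i)

/-- The action `a · f = f ∘ a⁻¹` of `Sp(2n, ℝ)` on formal Hamiltonian vector fields. -/
def act {n : ℕ} (a : Sp n) (f : ham0 n) : ham0 n :=
  ⟨MvPowerSeries.subst
      (fun i => (linForm (a⁻¹ : Sp n).1 i : MvPowerSeries (Fin n ⊕ Fin n) ℝ)) f.1, by
    refine mem_of_two_le_order
      (le_trans ?_ (MvPowerSeries.le_order_subst (hasSubst_linForm _) f.1))
    have h1 : (1 : ℕ∞) ≤ ⨅ i,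
        (linForm (a⁻¹ : Sp n).1 i : MvPowerSeries (Fin n ⊕ Fin n) ℝ).order :=
      le_iInf fun i => one_le_order_linForm _ i
    calc (2 : ℕ∞) = 1 * 2 := by simp
      _ ≤ _ := mul_le_mul' h1 (two_le_order_of_mem f.2)⟩

/-! ### Gel'fand-Kalinin-Fuks cochains -/

/-- The `m`-cochains of `ham0 n`: continuous alternating `ℝ`-multilinear forms. -/
abbrev Cochain (n m : ℕ) : Type := (ham0 n) [⋀^Fin m]→L[ℝ] ℝ

instance (n m : ℕ) (S : Submodule ℝ (Cochain n m)) : AddCommGroup S :=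
  @Submodule.addCommGroup ℝ (Cochain n m) _ ContinuousAlternatingMap.instAddCommGroup
    ContinuousAlternatingMap.instModule S

/-- The cochains of weight `w`, i.e. the elements of the sum of the
`Λ^{k_2} S^{2*} ⊗ Λ^{k_3} S^{3*} ⊗ ⋯` with `∑ k_j = m` and `∑ (j - 2) k_j = w`: those forms
that vanish on all `m`-tuples of homogeneous potentials of degrees `ℓ_1, …, ℓ_m` with
`∑ (ℓ_i - 2) ≠ w`. -/
def weightCochain (n m w : ℕ) : Submodule ℝ (Cochain n m) where
  carrier := {σ | ∀ (f : Fin m → ham0 n) (l : Fin m → ℕ),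
    (∀ i, (f i).1.IsHomogeneous (l i)) → ∑ i, ((l i : ℤ) - 2) ≠ (w : ℤ) → σ f = 0}
  add_mem' ha hb f l hf hl := by
    rw [ContinuousAlternatingMap.add_apply, ha f l hf hl, hb f l hf hl, add_zero]
  zero_mem' _ _ _ _ := rfl
  smul_mem' c σ h f l hf hl := by
    rw [ContinuousAlternatingMap.smul_apply, h f l hf hl, smul_zero]

/-- `C^m(ham0 n, Sp(2n, ℝ))_w`: the cochains `σ` of weight `w` with `i_X σ = 0` for all `X` in
`𝔰𝔭(2n, ℝ)` and `a^* σ = σ` for all `a` in `Sp(2n, ℝ)`. Here `𝔰𝔭(2n, ℝ)` is the Lie subalgebra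
of linear Hamiltonian vector fields, i.e. of the homogeneous quadratic potentials. -/
def relCochain (n m w : ℕ) : Submodule ℝ (Cochain n m) :=
  weightCochain n m w ⊓
  { carrier := {σ | (∀ f : Fin m → ham0 n, (∃ i, (f i).1.IsHomogeneous 2) → σ f = 0) ∧
      ∀ (a : Sp n) (f : Fin m → ham0 n), σ (fun i => act a (f i)) = σ f}
    add_mem' := fun {σ τ} ha hb => by
      refine ⟨fun f hf => ?_, fun a f => ?_⟩
      · rw [ContinuousAlternatingMap.add_apply, ha.1 f hf, hb.1 f hf, add_zero]
      · rw [ContinuousAlternatingMap.add_apply, ContinuousAlternatingMap.add_apply,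
          ha.2 a f, hb.2 a f]
    zero_mem' := ⟨fun _ _ => rfl, fun _ _ => rfl⟩
    smul_mem' := fun c σ h => by
      refine ⟨fun f hf => ?_, fun a f => ?_⟩
      · rw [ContinuousAlternatingMap.smul_apply, h.1 f hf, smul_zero]
      · rw [ContinuousAlternatingMap.smul_apply, ContinuousAlternatingMap.smul_apply, h.2 a f] }

/-- The coboundary operator
`(dσ)(X_0, …, X_m) = ∑_{i<j} (-1)^{i+j} σ([X_i, X_j], X_0, …, X̂_i, …, X̂_j, …, X_m)`.
The pair `i < j` of the formula is the pair `i.castSucc, j.succ` with `i ≤ j` of the code. -/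
def d (n : ℕ) : (m : ℕ) → Cochain n m →ₗ[ℝ] ((Fin (m + 1) → ham0 n) → ℝ)
  | 0 => 0
  | m + 1 =>
    { toFun := fun σ X => ∑ i : Fin (m + 1), ∑ j : Fin (m + 1),
        if i ≤ j then
          (-1 : ℝ) ^ ((i : ℕ) + ((j : ℕ) + 1)) *
            σ (Fin.cons (⁅X i.castSucc, X j.succ⁆ : ham0 n)
              (fun k : Fin m => X (j.succ.succAbove (i.succAbove k))))
        else 0
      map_add' := fun σ τ => by
        funext X
        simp only [Pi.add_apply, ← Finset.sum_add_distrib, ContinuousAlternatingMap.add_apply]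
        refine Finset.sum_congr rfl fun i _ => Finset.sum_congr rfl fun j _ => ?_
        split_ifs <;> ring
      map_smul' := fun c σ => by
        funext X
        simp only [Pi.smul_apply, smul_eq_mul, Finset.mul_sum, RingHom.id_apply,
          ContinuousAlternatingMap.smul_apply]
        refine Finset.sum_congr rfl fun i _ => Finset.sum_congr rfl fun j _ => ?_
        split_ifs <;> ring }

/-- Cocycles of the relative complex in weight `w`. -/
def cocycles (n m w : ℕ) : Submodule ℝ (relCochain n m w) :=
  LinearMap.ker ((d n m).comp (relCochain n m w).subtype)

/-- Coboundaries of the relative complex in weight `w`: the elements of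
`C^m(ham0 n, Sp(2n, ℝ))_w` of the form `dσ` with `σ` in `C^{m-1}(ham0 n, Sp(2n, ℝ))_w`. -/
def coboundaries (n : ℕ) : (m w : ℕ) → Submodule ℝ (relCochain n m w)
  | 0, _ => ⊥
  | m + 1, w =>
    { carrier := {τ | ∃ σ ∈ relCochain n m w, ∀ X, d n m σ X = τ.1 X}
      add_mem' := by
        rintro τ τ' ⟨σ, hσ, h⟩ ⟨σ', hσ', h'⟩
        refine ⟨σ + σ', add_mem hσ hσ', fun X => ?_⟩
        rw [map_add, Pi.add_apply, h, h']
        rfl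
      zero_mem' := ⟨0, zero_mem _, fun X => by rw [map_zero]; rfl⟩
      smul_mem' := by
        rintro c τ ⟨σ, hσ, h⟩
        refine ⟨c • σ, Submodule.smul_mem _ c hσ, fun X => ?_⟩
        rw [map_smul, Pi.smul_apply, h]
        rfl }

/-- The Betti number `dim H^m(ham0 n, Sp(2n, ℝ))_w`. -/
def betti (n m w : ℕ) : ℕ :=
  Module.finrank ℝ (cocycles n m w ⧸ (coboundaries n m w).submoduleOf (cocycles n m w))

/-- The Euler characteristic number in weight `w`: the alternating sum of the dimensions of the
relative cochain spaces, the `0`-dimensional cochain space always being counted as `ℝ`.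
There are no nonzero relative cochains of weight `w` and degree `m > w`. -/
def euler (n w : ℕ) : ℤ :=
  1 + ∑ m ∈ Finset.Icc 1 w, (-1 : ℤ) ^ m * (Module.finrank ℝ (relCochain n m w) : ℤ)

/-! ### The representations `Λ^{k_3} S^{3*} ⊗ Λ^{k_4} S^{4*} ⊗ ⋯` -/

/-- `S^l`, the homogeneous polynomials of degree `l` in `q, p`. -/
abbrev Sym (n l : ℕ) : Submodule ℝ (MvPolynomial (Fin n ⊕ Fin n) ℝ) :=
  MvPolynomial.homogeneousSubmodule (Fin n ⊕ Fin n) ℝ l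

/-- `f ↦ f ∘ A` on `S^l`. -/
def symMap {n : ℕ} (l : ℕ) (A : Matrix (Fin n ⊕ Fin n) (Fin n ⊕ Fin n) ℝ) :
    Sym n l →ₗ[ℝ] Sym n l :=
  (MvPolynomial.aeval (linForm A)).toLinearMap.restrict fun f hf => by
    have h := MvPolynomial.IsHomogeneous.aeval
      (show f.IsHomogeneous l from hf) (linForm A) (isHomogeneous_linForm A)
    rw [one_mul] at h
    exact h

theorem symMap_one {n : ℕ} (l : ℕ) :
    symMap l (1 : Matrix (Fin n ⊕ Fin n) (Fin n ⊕ Fin n) ℝ) = 1 := by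
  ext f : 2
  have : linForm (1 : Matrix (Fin n ⊕ Fin n) (Fin n ⊕ Fin n) ℝ) = MvPolynomial.X := by
    funext i
    simp [linForm, Matrix.one_apply]
  simp [symMap, this]

theorem symMap_mul {n : ℕ} (l : ℕ) (A B : Matrix (Fin n ⊕ Fin n) (Fin n ⊕ Fin n) ℝ) :
    symMap l (A * B) = symMap l B * symMap l A := by
  ext f : 2
  have h : MvPolynomial.aeval (linForm (A * B)) =
      (MvPolynomial.aeval (linForm B)).comp (MvPolynomial.aeval (R := ℝ) (linForm A)) := by
    ext1 i
    simp only [MvPolynomial.aeval_X, AlgHom.comp_apply]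
    simp only [linForm, map_sum, map_mul, MvPolynomial.aeval_X, MvPolynomial.algHom_C,
      MvPolynomial.algebraMap_eq, Matrix.mul_apply, Finset.mul_sum, Finset.sum_mul]
    rw [Finset.sum_comm]
    simp only [mul_assoc]
  exact DFunLike.congr_fun h f.1

/-- The representation `a · f = f ∘ a⁻¹` of `Sp(2n, ℝ)` on `S^l`. -/
def symRep (n l : ℕ) : Representation ℝ (Sp n) (Sym n l) where
  toFun a := symMap l (a⁻¹ : Sp n).1
  map_one' := by rw [inv_one]; exact symMap_one l
  map_mul' a b := by rw [mul_inv_rev]; exact symMap_mul l _ _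

/-- The `k`-th exterior power of a representation. -/
def extRep {G V : Type*} [Monoid G] [AddCommGroup V] [Module ℝ V] (k : ℕ)
    (ρ : Representation ℝ G V) : Representation ℝ G (⋀[ℝ]^k V) where
  toFun a := exteriorPower.map k (ρ a)
  map_one' := by rw [map_one]; exact exteriorPower.map_id
  map_mul' a b := by rw [map_mul]; exact exteriorPower.map_comp _ _

/-- The tensor product of a finite family of representations. -/
def tensorRep {G ι : Type*} [Monoid G] [Fintype ι] {V : ι → Type*}
    [∀ i, AddCommGroup (V i)] [∀ i, Module ℝ (V i)] (ρ : ∀ i, Representation ℝ G (V i)) :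
    Representation ℝ G (⨂[ℝ] i, V i) where
  toFun a := PiTensorProduct.map fun i => ρ i a
  map_one' := by simp only [map_one]; exact PiTensorProduct.map_one
  map_mul' a b := by simp only [map_mul]; exact PiTensorProduct.map_mul _ _

/-- The representation `Λ^{k_3} S^{3*} ⊗ Λ^{k_4} S^{4*} ⊗ ⋯ ⊗ Λ^{k_{s+2}} S^{(s+2)*}` of
`Sp(2n, ℝ)`; the entry `k i` is the exponent `k_{i+3}`, for `i = 0, …, s - 1`. -/
def typeRep (n : ℕ) {s : ℕ} (k : Fin s → ℕ) :
    Representation ℝ (Sp n) (⨂[ℝ] i : Fin s, ⋀[ℝ]^(k i) (Module.Dual ℝ (Sym n (i + 3)))) :=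
  tensorRep fun i : Fin s => extRep (k i) (symRep n (i + 3)).dual

/-- The multiplicity of the trivial representation in `ρ`. -/
def trivMult {G V : Type*} [Monoid G] [AddCommMonoid V] [Module ℝ V]
    (ρ : Representation ℝ G V) : ℕ :=
  Module.finrank ℝ ((Representation.trivial ℝ G ℝ).IntertwiningMap ρ)

/-- The types `(k_3, k_4, …)` with `∑ k_j = m` and `∑ (j - 2) k_j = w`. The second condition
forces `k_j = 0` for `j > w + 2`, so a type is a tuple `(k_3, …, k_{w+2})`. -/
def types (m w : ℕ) : Finset (Fin w → ℕ) :=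
  {k ∈ Finset.piAntidiag Finset.univ m | ∑ i : Fin w, ((i : ℕ) + 1) * k i = w}

/-! ### The table -/

/-- The rows `(w, [dim C^1_w, dim C^2_w, …], χ)`; the dimensions not listed are zero. -/
def table : List (ℕ × List ℕ × ℤ) :=
  [(2, [0, 1], 2),
   (4, [0, 0, 1, 1], 1),
   (6, [0, 1, 1, 0, 0], 1),
   (8, [0, 0, 4, 5, 1, 0], 1),
   (10, [0, 1, 3, 9, 12, 4, 0], 0),
   (12, [0, 0, 8, 23, 22, 13, 5, 0], 2),
   (14, [0, 1, 6, 31, 71, 58, 15, 2, 1], 0),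
   (16, [0, 0, 12, 61, 126, 147, 95, 24, 0], 0),
   (18, [0, 1, 10, 80, 262, 380, 268, 100, 21, 1], 2),
   (20, [0, 0, 17, 124, 423, 791, 801, 414, 96, 9, 1], 1),
   (22, [0, 1, 14, 163, 738, 1586, 1874, 1276, 479, 82, 3], 1),
   (24, [0, 0, 23, 229, 1091, 2897, 4281, 3534, 1628, 408, 49, 1], -2),
   (26, [0, 1, 19, 285, 1722, 5102, 8613, 8735, 5222, 1703, 266, 19, 1], 3),
   (28, [0, 0, 29, 385, 2428, 8465, 16905, 19930, 14133, 5981, 1408, 144, 2], 1),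
   (30, [0, 1, 25, 468, 3541, 13661, 30687, 42291, 35986, 18457, 5431, 855, 63, 0], 1)]

end FormalHam

end

/-!
A relative cochain of weight `w` involves only the monomials of degrees `3, …, w + 2`: it is
determined by its values on tuples of monomials (`eq_zero_of_monomials`), vanishes as soon as one of
them is quadratic, and a monomial of degree `l` contributes `l - 2` to the weight. Hence `C^m_w` is
the space of `Sp(2, ℝ)`-invariants (`mem_relCochain_iff`) in a space whose basis consists of the
exterior monomials in the dual monomials, `m` at a time and of total weight `w` (`cochainBasis`).
This gives the finiteness, and since every factor has weight at least `1` there are no cochains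
with `m > w` (`relCochain_eq_bot`).

The invariants are counted by `𝔰𝔩₂`-theory. In a finite-dimensional representation with diagonal
torus the raising operator maps the weight space of weight `0` onto that of weight `2`, and its
kernel there consists of the invariants, so their dimension is the difference of the dimensions of
the two weight spaces (`finrank_sl2_invariants`). `IsSmoothRep` singles out the representations to
which this applies: representations of the monoid of all `2 × 2` matrices with differentiable
entries, on which diagonal matrices act by monomials (`IsSmoothRep.finrank_invariants`). Both the
cochains and the tensor products `Λ^{k_3} S^{3*} ⊗ Λ^{k_4} S^{4*} ⊗ ⋯` are of this kind, because
on `Sp(2, ℝ)` the contragredient of a substitution is a transposed substitution, which makes sense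
for every matrix. In both cases the weight vectors are sets of monomials, with the degree in `q`
minus the degree in `p` as weight (`finrank_eq_familyCount`, `trivMult_eq_typeCount`). Sorting the
sets of monomials by the numbers `k_3, k_4, …` of members of given degree yields the formula for
`dim C^m_w` (`finrank_relCochain_eq_sum`).

The sets of monomials with given number of members, weight and degree in `q` are counted by the
coefficients of a product of binomials. At a large enough integer `B` in place of the variable,
these coefficients are the digits in base `B` of the value (`digit_sum`), so that the dimensions
are primitive recursive by inspection (`typeCount_eq_digit`, `familyCount_eq_digit`). The table is
read off from one such product, taken modulo a power of two: with base `2 ^ 37`, which is large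
enough by an estimate of the number of all families of weight at most `30` (`card_code_lt`), all
of its entries are digits of a single number, and these are compared by evaluation in the kernel
(`checkRows_table`).

The last assertion is the Euler-Poincaré principle. The Cartan relations `interior_ceDiff`,
`lieDer_lie` and `lieDer_ceDiff` for the algebraic Chevalley-Eilenberg complex give `d ∘ d = 0`.
Invariance of `σ` under `Sp(2, ℝ)` implies `L_X σ = 0` for quadratic `X` (`lieDer_eq_zero`), and
then `ι_X dσ = L_X σ - d ι_X σ = 0`, so that `d` preserves relative cochains
(`cochainDiff_mem_relCochain`). If all cohomology in degrees `m ≥ 1` vanished, the alternating sum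
of the dimensions would telescope to `χ(w) = 1` (`euler_eq_one`).
-/

namespace FormalHam

/-! ### Weight vectors and invariants of `𝔰𝔩₂` -/

section Sl2

open Module Matrix

attribute [local instance 100] LieRing.ofAssociativeRing

/-- The weight of a nonzero weight vector killed by `E` is a natural number. -/
theorem sl2_eq_zero_of_neg_weight {M : Type*} [AddCommGroup M] [Module ℝ M]
    [FiniteDimensional ℝ M] {E F H : End ℝ M} (hEF : E * F - F * E = H)
    (hHE : H * E - E * H = (2 : ℝ) • E) (hHF : H * F - F * H = -((2 : ℝ) • F)) {v : M} {c : ℝ}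
    (hc : c < 0) (hH : H v = c • v) (hE : E v = 0) : v = 0 := by
  by_contra hv
  have t : IsSl2Triple H E F :=
    { h_ne_zero := by
        rintro rfl
        rw [LinearMap.zero_apply] at hH
        exact (smul_ne_zero hc.ne hv) hH.symm
      lie_e_f := hEF
      lie_h_e_nsmul := by rw [Ring.lie_def, hHE, two_smul, two_nsmul]
      lie_h_f_nsmul := by rw [Ring.lie_def, hHF, two_smul, two_nsmul] }
  have P : t.HasPrimitiveVectorWith v c := ⟨hv, hH, hE⟩
  obtain ⟨n, rfl⟩ := P.exists_nat
  exact absurd hc (not_lt.2 (Nat.cast_nonneg n))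

theorem sum_mul_dite {I : Type*} [Fintype I] (p : I → Prop) [DecidablePred p] (f : I → ℝ)
    (u : {i // p i} → ℝ) :
    ∑ i, f i * (if h : p i then u ⟨i, h⟩ else 0) = ∑ i : {i // p i}, f i * u i := by
  rw [← Fintype.sum_subtype_add_sum_subtype p]
  have h2 : ∑ i : {i // ¬ p i}, f i * (if h : p i then u ⟨i, h⟩ else 0) = 0 :=
    Finset.sum_eq_zero fun i _ => by rw [dif_neg i.2, mul_zero]
  rw [h2, add_zero]
  exact Finset.sum_congr rfl fun i _ => by rw [dif_pos i.2]

/-- For a finite-dimensional representation of `𝔰𝔩₂` on which `H` is diagonal with integral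
eigenvalues, the operator `E` maps the weight space of weight `0` onto the one of weight `2`, and
its kernel there consists of the invariants. -/
theorem finrank_sl2_invariants {I : Type*} [Fintype I] [DecidableEq I] (c : I → ℤ)
    (E F : Matrix I I ℝ)
    (hEF : E * F - F * E = diagonal fun i => (c i : ℝ))
    (hHE : (diagonal fun i => (c i : ℝ)) * E - E * (diagonal fun i => (c i : ℝ)) = (2 : ℝ) • E)
    (hHF : (diagonal fun i => (c i : ℝ)) * F - F * (diagonal fun i => (c i : ℝ)) =
      -((2 : ℝ) • F))
    (K : Submodule ℝ (I → ℝ))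
    (hK : ∀ v, v ∈ K ↔ E *ᵥ v = 0 ∧ F *ᵥ v = 0 ∧ (diagonal fun i => (c i : ℝ)) *ᵥ v = 0) :
    finrank ℝ K + Fintype.card {i // c i = 2} = Fintype.card {i // c i = 0} := by
  set H : Matrix I I ℝ := diagonal fun i => (c i : ℝ) with hH
  have hE0 : ∀ i j, c i ≠ c j + 2 → E i j = 0 := by
    intro i j hij
    have h := congrFun (congrFun hHE i) j
    simp only [hH, Matrix.sub_apply, diagonal_mul, mul_diagonal, Matrix.smul_apply, smul_eq_mul] at h
    have h2 : ((c i : ℝ) - (c j + 2)) * E i j = 0 := by linarith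
    refine (mul_eq_zero.1 h2).resolve_left fun h3 => hij ?_
    exact_mod_cast sub_eq_zero.1 h3
  have lift : ∀ {A B C : Matrix I I ℝ}, A * B - B * A = C →
      A.mulVecLin * B.mulVecLin - B.mulVecLin * A.mulVecLin = C.mulVecLin := by
    rintro A B _ rfl
    exact LinearMap.ext fun v => by simp
  have key : ∀ {E F H : Matrix I I ℝ}, E * F - F * E = H → H * E - E * H = (2 : ℝ) • E →
      H * F - F * H = -((2 : ℝ) • F) → ∀ v : I → ℝ, H *ᵥ v = (-2 : ℝ) • v → E *ᵥ v = 0 →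
      v = 0 := by
    intro E F H h1 h2 h3 v hv hEv
    refine sl2_eq_zero_of_neg_weight (E := E.mulVecLin) (F := F.mulVecLin) (H := H.mulVecLin)
      (lift h1) ?_ ?_ (c := -2) (by norm_num) hv hEv
    · rw [lift h2]
      exact LinearMap.ext fun v => by simp
    · rw [lift h3]
      exact LinearMap.ext fun v => by simp
  -- the block of `E` from weight `0` to weight `2`; it is surjective because its transpose is
  -- injective: a nonzero vector killed by `Eᵀ`, the raising operator of the triple `(Eᵀ, Fᵀ, -H)`,
  -- cannot have weight `-2` for `-H`
  let N : Matrix {i // c i = 2} {i // c i = 0} ℝ := E.submatrix Subtype.val Subtype.val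
  have hN : LinearMap.ker Nᵀ.mulVecLin = ⊥ := by
    refine (Submodule.eq_bot_iff _).2 fun u hu => ?_
    let v : I → ℝ := fun i => if h : c i = 2 then u ⟨i, h⟩ else 0
    have hv : v = 0 := by
      refine key (E := Eᵀ) (F := Fᵀ) (H := -H) ?_ ?_ ?_ v ?_ ?_
      · rw [← hEF, ← transpose_mul, ← transpose_mul, ← transpose_sub, ← neg_sub, transpose_neg,
          hEF, hH, diagonal_transpose]
      · have := congrArg transpose hHE
        rw [transpose_sub, transpose_mul, transpose_mul, hH, diagonal_transpose,
          transpose_smul] at this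
        rw [← this, hH]
        simp only [Matrix.neg_mul, Matrix.mul_neg]
        abel
      · have := congrArg transpose hHF
        rw [transpose_sub, transpose_mul, transpose_mul, hH, diagonal_transpose, transpose_neg,
          transpose_smul] at this
        rw [← this, hH]
        simp only [Matrix.neg_mul, Matrix.mul_neg]
        abel
      · ext i
        rw [neg_mulVec, Pi.neg_apply, hH, mulVec_diagonal, Pi.smul_apply, smul_eq_mul]
        by_cases h : c i = 2
        · rw [h]; push_cast; ring
        · simp [v, h]
      · ext j
        rw [mulVec, dotProduct]
        change ∑ i, Eᵀ j i * (if h : c i = 2 then u ⟨i, h⟩ else 0) = 0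
        rw [sum_mul_dite]
        by_cases hj : c j = 0
        · exact congrFun (show Nᵀ *ᵥ u = 0 from hu) ⟨j, hj⟩
        · refine Finset.sum_eq_zero fun i _ => ?_
          rw [transpose_apply, hE0 _ _ (by rw [i.2]; omega), zero_mul]
    ext i
    have := congrFun hv i
    simpa [v, i.2] using this
  have hrank : N.rank = Fintype.card {i // c i = 2} := by
    rw [← rank_transpose]
    have := LinearMap.finrank_range_add_finrank_ker Nᵀ.mulVecLin
    rw [hN, finrank_bot, add_zero, finrank_fintype_fun_eq_card] at this
    exact this
  have hker : finrank ℝ K = finrank ℝ (LinearMap.ker N.mulVecLin) := by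
    have hsupp : ∀ v, H *ᵥ v = 0 → ∀ i, c i ≠ 0 → v i = 0 := by
      intro v hv i hi
      have := congrFun hv i
      rw [hH, mulVec_diagonal, Pi.zero_apply] at this
      exact (mul_eq_zero.1 this).resolve_left (by exact_mod_cast hi)
    let r : K →ₗ[ℝ] ({i // c i = 0} → ℝ) :=
      (LinearMap.funLeft ℝ ℝ (Subtype.val : {i // c i = 0} → I)).comp K.subtype
    have hr : Function.Injective r := by
      rw [← LinearMap.ker_eq_bot, Submodule.eq_bot_iff]
      intro v hv
      ext i
      by_cases hi : c i = 0
      · exact congrFun (show r v = 0 from hv) ⟨i, hi⟩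
      · exact hsupp v.1 ((hK v.1).1 v.2).2.2 i hi
    have hrange : LinearMap.range r = LinearMap.ker N.mulVecLin := by
      ext u
      constructor
      · rintro ⟨v, rfl⟩
        have h := (hK v.1).1 v.2
        change N *ᵥ (fun i => v.1 i.1) = 0
        ext i
        have h1 := congrFun h.1 i.1
        rw [mulVec, dotProduct, ← Fintype.sum_subtype_add_sum_subtype (fun j => c j = 0)] at h1
        rw [Finset.sum_eq_zero (s := (Finset.univ : Finset {j // ¬ c j = 0}))
          (fun j _ => by rw [hsupp v.1 h.2.2 j.1 j.2, mul_zero]), add_zero] at h1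
        exact h1
      · intro hu
        let v : I → ℝ := fun i => if h : c i = 0 then u ⟨i, h⟩ else 0
        have hHv : H *ᵥ v = 0 := by
          ext i
          rw [hH, mulVec_diagonal, Pi.zero_apply]
          by_cases h : c i = 0 <;> simp [v, h]
        have hEv : E *ᵥ v = 0 := by
          ext i
          rw [mulVec, dotProduct]
          change ∑ j, E i j * (if h : c j = 0 then u ⟨j, h⟩ else 0) = 0
          rw [sum_mul_dite]
          by_cases hi : c i = 2
          · exact congrFun (show N *ᵥ u = 0 from hu) ⟨i, hi⟩
          · refine Finset.sum_eq_zero fun j _ => ?_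
            rw [hE0 _ _ (by rw [j.2]; omega), zero_mul]
        -- `F v` has weight `-2` and `E F v = F E v + H v = 0`
        have hFv : F *ᵥ v = 0 := by
          refine key hEF hHE hHF _ ?_ ?_
          · have := congrArg (fun A => A *ᵥ v) hHF
            simp only [sub_mulVec, neg_mulVec, smul_mulVec, ← mulVec_mulVec] at this
            rw [hHv, mulVec_zero, sub_zero] at this
            rw [this, neg_smul]
          · have := congrArg (fun A => A *ᵥ v) hEF
            simp only [sub_mulVec, ← mulVec_mulVec] at this
            rwa [hEv, mulVec_zero, sub_zero, hHv] at this
        refine ⟨⟨v, (hK v).2 ⟨hEv, hFv, hHv⟩⟩, ?_⟩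
        ext i
        change v i.1 = u i
        simp [v, i.2]
    rw [← hrange, LinearMap.finrank_range_of_inj hr]
  have := LinearMap.finrank_range_add_finrank_ker N.mulVecLin
  rw [finrank_fintype_fun_eq_card] at this
  rw [hker, ← this, ← hrank, Matrix.rank, add_comm]

end Sl2

/-! ### Invariants of `Sp(2, ℝ)` in polynomial representations -/

section Rep

open Module Matrix

/-- The monoid of all `2 × 2` matrices, indexed like the variables `q, p`. -/
abbrev Mat : Type := Matrix (Fin 1 ⊕ Fin 1) (Fin 1 ⊕ Fin 1) ℝ

/-- The matrix with rows `(x, y)` and `(z, w)`. -/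
def mat2 (x y z w : ℝ) : Mat :=
  Matrix.of fun i j => Sum.elim (fun _ => Sum.elim (fun _ => x) (fun _ => y) j)
    (fun _ => Sum.elim (fun _ => z) (fun _ => w) j) i

theorem mat2_eta (a : Mat) :
    a = mat2 (a (.inl 0) (.inl 0)) (a (.inl 0) (.inr 0)) (a (.inr 0) (.inl 0))
      (a (.inr 0) (.inr 0)) := by
  ext (i | i) (j | j) <;> rw [Subsingleton.elim i 0, Subsingleton.elim j 0] <;> rfl

theorem mat2_mul (x y z w x' y' z' w' : ℝ) :
    mat2 x y z w * mat2 x' y' z' w' =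
      mat2 (x * x' + y * z') (x * y' + y * w') (z * x' + w * z') (z * y' + w * w') := by
  ext (i | i) (j | j) <;> simp [mat2, Matrix.mul_apply]

theorem mat2_one : mat2 1 0 0 1 = 1 := by
  ext (i | i) (j | j) <;> simp [mat2, Matrix.one_apply, Subsingleton.elim i j]

theorem mat2_mem (x y z w : ℝ) :
    mat2 x y z w ∈ Matrix.symplecticGroup (Fin 1) ℝ ↔ x * w - y * z = 1 := by
  have hJ : Matrix.J (Fin 1) ℝ = mat2 0 (-1) 1 0 := by
    ext (i | i) (j | j) <;> simp [mat2, Matrix.J, Subsingleton.elim i j]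
  have ht : (mat2 x y z w)ᵀ = mat2 x z y w := by
    ext (i | i) (j | j) <;> simp [mat2]
  rw [SymplecticGroup.mem_iff, hJ, ht, mat2_mul, mat2_mul]
  constructor
  · intro h
    have := congrFun (congrFun h (.inr 0)) (.inl 0)
    simp [mat2] at this
    linarith
  · intro h
    congr 1
    · ring
    · linarith
    · linarith
    · ring

variable {I V : Type*} [AddCommGroup V] [Module ℝ V]

/-- A representation of the monoid of `2 × 2` matrices whose matrix entries in a basis `b` are
differentiable, and on which the diagonal matrices `diag(x, y)` act on the basis vector `b i` by
`x ^ p i * y ^ q i`. -/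
structure IsSmoothRep (ρ : Representation ℝ Mat V) (b : Basis I ℝ V) (p q : I → ℕ) : Prop where
  differentiable : ∀ i j, Differentiable ℝ
    fun x : (Fin 1 ⊕ Fin 1) → (Fin 1 ⊕ Fin 1) → ℝ => b.repr (ρ (Matrix.of x) (b j)) i
  torus : ∀ x y j, ρ (mat2 x 0 0 y) (b j) = (x ^ p j * y ^ q j) • b j

/-- Entrywise derivative of a matrix-valued function of a real variable. -/
def HasMatDerivAt {m n : Type*} (A : ℝ → Matrix m n ℝ) (A' : Matrix m n ℝ) (s : ℝ) : Prop :=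
  ∀ i j, HasDerivAt (fun s => A s i j) (A' i j) s

theorem HasMatDerivAt.mul {m n l : Type*} [Fintype n] {A : ℝ → Matrix m n ℝ}
    {A' : Matrix m n ℝ} {B : ℝ → Matrix n l ℝ} {B' : Matrix n l ℝ} {s : ℝ}
    (hA : HasMatDerivAt A A' s) (hB : HasMatDerivAt B B' s) :
    HasMatDerivAt (fun s => A s * B s) (A' * B s + A s * B') s := by
  intro i j
  simp only [Matrix.mul_apply, Matrix.add_apply, ← Finset.sum_add_distrib]
  exact HasDerivAt.fun_sum fun k _ => (hA i k).mul (hB k j)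

theorem hasMatDerivAt_const {m n : Type*} (A : Matrix m n ℝ) (s : ℝ) :
    HasMatDerivAt (fun _ => A) 0 s := fun _ _ => hasDerivAt_const _ _

theorem HasMatDerivAt.unique {m n : Type*} {A : ℝ → Matrix m n ℝ} {A' A'' : Matrix m n ℝ} {s : ℝ}
    (h : HasMatDerivAt A A' s) (h' : HasMatDerivAt A A'' s) : A' = A'' := by
  ext i j
  exact (h i j).unique (h' i j)

/-- The differential at the identity of the matrix representation attached to `ρ` and `b`. -/
noncomputable def repDeriv (ρ : Representation ℝ Mat V) (b : Basis I ℝ V) (X : Mat) : Matrix I I ℝ :=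
  Matrix.of fun i j => fderiv ℝ
    (fun x : (Fin 1 ⊕ Fin 1) → (Fin 1 ⊕ Fin 1) → ℝ => b.repr (ρ (Matrix.of x) (b j)) i)
    (fun i j => (1 : Mat) i j) (fun i j => X i j)

theorem repDeriv_add (ρ : Representation ℝ Mat V) (b : Basis I ℝ V) (X Y : Mat) :
    repDeriv ρ b (X + Y) = repDeriv ρ b X + repDeriv ρ b Y := by
  ext i j
  simp only [repDeriv, Matrix.of_apply, Matrix.add_apply]
  rw [← map_add]
  rfl

theorem repDeriv_smul (ρ : Representation ℝ Mat V) (b : Basis I ℝ V) (c : ℝ) (X : Mat) :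
    repDeriv ρ b (c • X) = c • repDeriv ρ b X := by
  ext i j
  simp only [repDeriv, Matrix.of_apply, Matrix.smul_apply]
  rw [← map_smul]
  rfl

namespace IsSmoothRep

variable [Fintype I] [DecidableEq I]
variable {ρ : Representation ℝ Mat V} {b : Basis I ℝ V} {p q : I → ℕ}

theorem hasMatDerivAt (h : IsSmoothRep ρ b p q) {γ : ℝ → Mat} {X : Mat} {s : ℝ}
    (hγ : HasMatDerivAt γ X s) (h1 : γ s = 1) :
    HasMatDerivAt (fun s => LinearMap.toMatrix b b (ρ (γ s))) (repDeriv ρ b X) s := by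
  intro i j
  have hf := (h.differentiable i j (fun i j => (1 : Mat) i j)).hasFDerivAt
  have hg : HasDerivAt (fun s => (fun i j => γ s i j : (Fin 1 ⊕ Fin 1) → (Fin 1 ⊕ Fin 1) → ℝ))
      (fun i j => X i j) s :=
    hasDerivAt_pi.2 fun i => hasDerivAt_pi.2 fun j => hγ i j
  have h1' : (fun i j => (1 : Mat) i j) = (fun i j => γ s i j) := by rw [h1]
  rw [h1'] at hf
  have := hf.comp_hasDerivAt s hg
  rw [← h1'] at this
  simp only [LinearMap.toMatrix_apply]
  exact this

theorem hasMatDerivAt_line (X : Mat) (s : ℝ) :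
    HasMatDerivAt (fun s : ℝ => 1 + s • X) X s := by
  intro i j
  simpa using ((hasDerivAt_id s).mul_const (X i j)).const_add ((1 : Mat) i j)

theorem repDeriv_conj (h : IsSmoothRep ρ b p q) (X : Mat) {g g' : Mat} (hg : g * g' = 1) :
    LinearMap.toMatrix b b (ρ g) * repDeriv ρ b X * LinearMap.toMatrix b b (ρ g') =
      repDeriv ρ b (g * X * g') := by
  have h1 := h.hasMatDerivAt (hasMatDerivAt_line X 0) (by simp)
  have h2 : HasMatDerivAt (fun s : ℝ => g * (1 + s • X) * g') (g * X * g') 0 := by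
    simpa using ((hasMatDerivAt_const g 0).mul (hasMatDerivAt_line X 0)).mul
      (hasMatDerivAt_const g' 0)
  have h3 := h.hasMatDerivAt h2 (by simpa using hg)
  have h4 := ((hasMatDerivAt_const (LinearMap.toMatrix b b (ρ g)) 0).mul h1).mul
    (hasMatDerivAt_const (LinearMap.toMatrix b b (ρ g')) 0)
  simp only [map_mul, LinearMap.toMatrix_mul] at h3
  simpa using h4.unique h3

/-- The differential of a representation respects commutators, at least with a square-zero
matrix: differentiate `ρ(g) dρ(X) ρ(g⁻¹) = dρ(g X g⁻¹)` along `g = 1 + s Y`. -/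
theorem repDeriv_lie (h : IsSmoothRep ρ b p q) (X : Mat) {Y : Mat} (hY : Y * Y = 0) :
    repDeriv ρ b Y * repDeriv ρ b X - repDeriv ρ b X * repDeriv ρ b Y =
      repDeriv ρ b (Y * X - X * Y) := by
  have h1 := h.hasMatDerivAt (hasMatDerivAt_line Y 0) (by simp)
  have hl : HasMatDerivAt (fun s : ℝ => 1 + s • (-Y)) (-Y) 0 := hasMatDerivAt_line (-Y) 0
  have h2 := h.hasMatDerivAt hl (by simp)
  have h3 := (h1.mul (hasMatDerivAt_const (repDeriv ρ b X) 0)).mul h2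
  have hconj : ∀ s : ℝ, LinearMap.toMatrix b b (ρ (1 + s • Y)) * repDeriv ρ b X *
      LinearMap.toMatrix b b (ρ (1 + s • (-Y))) =
      repDeriv ρ b X + s • repDeriv ρ b (Y * X - X * Y) -
        (s * s) • repDeriv ρ b (Y * X * Y) := by
    intro s
    rw [h.repDeriv_conj, ← repDeriv_smul, ← repDeriv_smul, ← repDeriv_add, eq_sub_iff_add_eq,
      ← repDeriv_add]
    · congr 1
      simp only [add_mul, mul_add, one_mul, mul_one, smul_mul_assoc, mul_smul_comm, smul_neg,
        mul_neg, smul_sub, smul_add, smul_smul, mul_assoc]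
      abel
    · simp [add_mul, mul_add, hY]
  have h4 : HasMatDerivAt (fun s : ℝ => repDeriv ρ b X + s • repDeriv ρ b (Y * X - X * Y) -
      (s * s) • repDeriv ρ b (Y * X * Y)) (repDeriv ρ b (Y * X - X * Y)) 0 := by
    intro i j
    have := (((hasDerivAt_id (0 : ℝ)).mul_const (repDeriv ρ b (Y * X - X * Y) i j)).const_add
      (repDeriv ρ b X i j)).fun_sub (((hasDerivAt_id (0 : ℝ)).fun_mul
        (hasDerivAt_id (0 : ℝ))).mul_const (repDeriv ρ b (Y * X * Y) i j))
    simpa using this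
  simp only [hconj] at h3
  have h5 := h3.unique h4
  rw [← h5]
  have hneg : repDeriv ρ b (-Y) = - repDeriv ρ b Y := by
    rw [← neg_one_smul ℝ Y, repDeriv_smul, neg_one_smul]
  simp [hneg, sub_eq_add_neg]

theorem repDeriv_torus (h : IsSmoothRep ρ b p q) :
    repDeriv ρ b (mat2 1 0 0 (-1)) = diagonal fun i => (((p i : ℤ) - q i : ℤ) : ℝ) := by
  have h0 : ∀ s : ℝ, 1 + s • mat2 1 0 0 (-1) = mat2 (1 + s) 0 0 (1 - s) := by
    intro s
    rw [← mat2_one]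
    ext (i | i) (j | j) <;> simp [mat2, sub_eq_add_neg]
  have h1 := h.hasMatDerivAt (hasMatDerivAt_line (mat2 1 0 0 (-1)) 0) (by simp)
  refine h1.unique fun i j => ?_
  have h2 : ∀ s : ℝ, LinearMap.toMatrix b b (ρ (1 + s • mat2 1 0 0 (-1))) i j =
      (1 + s) ^ p j * (1 - s) ^ q j * (1 : Matrix I I ℝ) i j := by
    intro s
    rw [h0, LinearMap.toMatrix_apply, h.torus, map_smul, Basis.repr_self, Finsupp.smul_apply,
      smul_eq_mul, Finsupp.single_apply, Matrix.one_apply]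
    simp only [eq_comm]
  simp only [h2]
  have h3 := (((((hasDerivAt_id (0 : ℝ)).const_add 1).fun_pow (p j)).fun_mul
    (((hasDerivAt_id (0 : ℝ)).const_sub 1).fun_pow (q j))).mul_const ((1 : Matrix I I ℝ) i j))
  refine h3.congr_deriv ?_
  rw [diagonal_apply, Matrix.one_apply]
  split_ifs with hij
  · subst hij
    simp [sub_eq_add_neg]
  · simp

/-- A vector is fixed by the one-parameter group `1 + s Y`, with `Y` of square zero, as soon as
it is killed by its generator. -/
theorem mulVec_line_iff (h : IsSmoothRep ρ b p q) {Y : Mat} (hY : Y * Y = 0) (v : I → ℝ) :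
    (∀ s : ℝ, LinearMap.toMatrix b b (ρ (1 + s • Y)) *ᵥ v = v) ↔ repDeriv ρ b Y *ᵥ v = 0 := by
  have hd : ∀ s : ℝ, ∀ i, HasDerivAt
      (fun s : ℝ => (LinearMap.toMatrix b b (ρ (1 + s • Y)) *ᵥ v) i)
      ((LinearMap.toMatrix b b (ρ (1 + s • Y)) *ᵥ (repDeriv ρ b Y *ᵥ v)) i) s := by
    intro s i
    have hl : HasMatDerivAt (fun t : ℝ => 1 + (t - s) • Y) Y s := by
      intro i j
      simpa using (((hasDerivAt_id s).sub_const s).mul_const (Y i j)).const_add ((1 : Mat) i j)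
    have h1 := (hasMatDerivAt_const (LinearMap.toMatrix b b (ρ (1 + s • Y))) s).mul
      (h.hasMatDerivAt hl (by simp))
    have h2 : ∀ t : ℝ, LinearMap.toMatrix b b (ρ (1 + s • Y)) *
        LinearMap.toMatrix b b (ρ (1 + (t - s) • Y)) = LinearMap.toMatrix b b (ρ (1 + t • Y)) := by
      intro t
      rw [← LinearMap.toMatrix_mul, ← map_mul]
      congr 2
      simp only [add_mul, mul_add, one_mul, mul_one, smul_mul_assoc, mul_smul_comm, hY, smul_zero,
        add_zero]
      module
    simp only [h2, zero_mul, zero_add] at h1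
    simp only [mulVec_mulVec]
    exact HasDerivAt.fun_sum fun j _ => (h1 i j).mul_const (v j)
  constructor
  · intro hv
    ext i
    have := hd 0 i
    simp only [hv, zero_smul, add_zero, map_one, LinearMap.toMatrix_one, one_mulVec] at this
    exact this.unique (hasDerivAt_const _ _)
  · intro hv s
    ext i
    have hc := is_const_of_deriv_eq_zero (fun s => (hd s i).differentiableAt)
      (fun s => by rw [(hd s i).deriv, hv, mulVec_zero, Pi.zero_apply]) s 0
    simpa using hc

/-- The dimension of the space of `Sp(2, ℝ)`-invariants is the difference of the multiplicities
of the weights `0` and `2`. -/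
theorem finrank_invariants (h : IsSmoothRep ρ b p q) (K : Submodule ℝ V)
    (hK : ∀ v, v ∈ K ↔ ∀ a : Sp 1, ρ a.1 v = v) :
    finrank ℝ K + Fintype.card {i // p i = q i + 2} = Fintype.card {i // p i = q i} := by
  have hY : mat2 0 1 0 0 * mat2 0 1 0 0 = 0 := by
    rw [mat2_mul]; ext (i | i) (j | j) <;> simp [mat2]
  have hZ : mat2 0 0 1 0 * mat2 0 0 1 0 = 0 := by
    rw [mat2_mul]; ext (i | i) (j | j) <;> simp [mat2]
  have hT := h.repDeriv_torus
  have e1 : mat2 0 1 0 0 * mat2 0 0 1 0 - mat2 0 0 1 0 * mat2 0 1 0 0 = mat2 1 0 0 (-1) := by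
    rw [mat2_mul, mat2_mul]; ext (i | i) (j | j) <;> simp [mat2]
  have e2 : mat2 0 1 0 0 * mat2 1 0 0 (-1) - mat2 1 0 0 (-1) * mat2 0 1 0 0 =
      (-2 : ℝ) • mat2 0 1 0 0 := by
    rw [mat2_mul, mat2_mul]; ext (i | i) (j | j) <;> simp [mat2]; norm_num
  have e3 : mat2 0 0 1 0 * mat2 1 0 0 (-1) - mat2 1 0 0 (-1) * mat2 0 0 1 0 =
      (2 : ℝ) • mat2 0 0 1 0 := by
    rw [mat2_mul, mat2_mul]; ext (i | i) (j | j) <;> simp [mat2]; norm_num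
  have r1 := h.repDeriv_lie (mat2 0 0 1 0) hY
  have r2 := h.repDeriv_lie (mat2 1 0 0 (-1)) hY
  have r3 := h.repDeriv_lie (mat2 1 0 0 (-1)) hZ
  rw [e1, hT] at r1
  rw [e2, repDeriv_smul, hT] at r2
  rw [e3, repDeriv_smul, hT] at r3
  have lY : ∀ s : ℝ, 1 + s • mat2 0 1 0 0 = mat2 1 s 0 1 := fun s => by
    rw [← mat2_one]; ext (i | i) (j | j) <;> simp [mat2]
  have lZ : ∀ s : ℝ, 1 + s • mat2 0 0 1 0 = mat2 1 0 s 1 := fun s => by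
    rw [← mat2_one]; ext (i | i) (j | j) <;> simp [mat2]
  have hv : ∀ (a : Mat) (v : V), ρ a v = v ↔
      LinearMap.toMatrix b b (ρ a) *ᵥ b.equivFun v = b.equivFun v := by
    intro a v
    rw [← b.equivFun.injective.eq_iff]
    have := LinearMap.toMatrix_mulVec_repr b b (ρ a) v
    exact ⟨fun h => this.trans h, fun h => this.symm.trans h⟩
  have hmem : ∀ v : V, v ∈ K ↔ (repDeriv ρ b (mat2 0 1 0 0) *ᵥ b.equivFun v = 0 ∧
      repDeriv ρ b (mat2 0 0 1 0) *ᵥ b.equivFun v = 0) := by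
    intro v
    rw [hK, ← h.mulVec_line_iff hY, ← h.mulVec_line_iff hZ]
    simp only [lY, lZ, ← hv]
    constructor
    · intro hf
      exact ⟨fun s => hf ⟨_, (mat2_mem _ _ _ _).2 (by ring)⟩,
        fun s => hf ⟨_, (mat2_mem _ _ _ _).2 (by ring)⟩⟩
    · rintro ⟨hy, hz⟩
      -- a matrix of determinant one with nonzero lower left entry is a product of three shears
      have key : ∀ x y z w : ℝ, x * w - y * z = 1 → z ≠ 0 → ρ (mat2 x y z w) v = v := by
        intro x y z w hdet hz0
        have : mat2 x y z w = mat2 1 ((x - 1) / z) 0 1 * mat2 1 0 z 1 *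
            mat2 1 ((w - 1) / z) 0 1 := by
          rw [mat2_mul, mat2_mul]
          congr 1 <;> field_simp <;> linarith
        rw [this, map_mul, map_mul, Module.End.mul_apply, Module.End.mul_apply, hy, hz, hy]
      rintro ⟨a, ha⟩
      change ρ a v = v
      rw [mat2_eta a] at ha ⊢
      rw [mat2_mem] at ha
      by_cases hz0 : a (.inr 0) (.inl 0) = 0
      · have hx : a (.inl 0) (.inl 0) ≠ 0 := by
          intro hx
          rw [hx, hz0] at ha
          simp at ha
        have h1 : ρ (mat2 1 0 1 1 * mat2 (a (.inl 0) (.inl 0)) (a (.inl 0) (.inr 0))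
            (a (.inr 0) (.inl 0)) (a (.inr 0) (.inr 0))) v = v := by
          rw [mat2_mul]
          exact key _ _ _ _ (by linarith) (by simpa [hz0] using hx)
        rw [map_mul, Module.End.mul_apply] at h1
        have h2 := congrArg (ρ (mat2 1 0 (-1) 1)) h1
        rw [hz, ← Module.End.mul_apply, ← map_mul, mat2_mul] at h2
        simpa [mat2_one] using h2
      · exact key _ _ _ _ ha hz0
  have hfin : finrank ℝ K = finrank ℝ (K.map (b.equivFun : V →ₗ[ℝ] (I → ℝ))) :=
    (LinearEquiv.finrank_eq (b.equivFun.submoduleMap K))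
  have hmain := finrank_sl2_invariants (fun i => (p i : ℤ) - q i) _ _ r1
    (by rw [← neg_sub, r2, neg_smul, neg_neg]) (by rw [← neg_sub, r3])
    (K.map (b.equivFun : V →ₗ[ℝ] (I → ℝ))) (by
      intro v
      obtain ⟨u, rfl⟩ := b.equivFun.surjective v
      have : b.equivFun u ∈ K.map (b.equivFun : V →ₗ[ℝ] (I → ℝ)) ↔ u ∈ K :=
        ⟨fun ⟨w, hw, e⟩ => b.equivFun.injective e ▸ hw, fun hu => ⟨u, hu, rfl⟩⟩
      rw [this, hmem]
      refine ⟨fun hu => ⟨hu.1, hu.2, ?_⟩, fun hu => ⟨hu.1, hu.2.1⟩⟩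
      rw [← r1, sub_mulVec, ← mulVec_mulVec, ← mulVec_mulVec, hu.1, hu.2]
      simp)
  rw [hfin]
  rw [Fintype.card_congr (Equiv.subtypeEquivRight (q := fun i => (p i : ℤ) - q i = 2)
    fun i => by omega), Fintype.card_congr (Equiv.subtypeEquivRight
      (p := fun i => p i = q i) (q := fun i => (p i : ℤ) - q i = 0) fun i => by omega)]
  exact hmain

end IsSmoothRep

end Rep

/-! ### The representations `Λ^{k_3} S^{3*} ⊗ Λ^{k_4} S^{4*} ⊗ ⋯` of the matrix monoid -/

section TypeRep

open Module Matrix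

theorem differentiable_finsetProd {E ι : Type*} [NormedAddCommGroup E] [NormedSpace ℝ E]
    (s : Finset ι) {f : ι → E → ℝ} (h : ∀ i, Differentiable ℝ (f i)) :
    Differentiable ℝ fun x => ∏ i ∈ s, f i x := by
  classical
  induction s using Finset.induction_on with
  | empty => simp
  | insert i s hi ih => simp only [Finset.prod_insert hi]; exact (h i).mul ih

theorem differentiable_det {E : Type*} [NormedAddCommGroup E] [NormedSpace ℝ E] {m : ℕ}
    {A : E → Matrix (Fin m) (Fin m) ℝ} (h : ∀ i j, Differentiable ℝ fun x => A x i j) :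
    Differentiable ℝ fun x => (A x).det := by
  simp only [Matrix.det_apply]
  refine Differentiable.fun_sum fun σ _ => Differentiable.fun_const_smul ?_ _
  exact differentiable_finsetProd _ fun i => h _ _

theorem prod_ofFinEmbEquiv_symm {I M : Type*} [LinearOrder I] [CommMonoid M] {k : ℕ}
    (S : Set.powersetCard I k) (f : I → M) :
    ∏ i, f (Set.powersetCard.ofFinEmbEquiv.symm S i) = ∏ j ∈ S.1, f j := by
  have h := Finset.map_orderEmbOfFin_univ S.1 S.2
  rw [← h, Finset.prod_map]
  rfl

/-- In the basis of exterior monomials, the entries of an exterior power are minors. -/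
theorem IsSmoothRep.extRep {I V : Type*} [LinearOrder I] [AddCommGroup V] [Module ℝ V]
    {ρ : Representation ℝ Mat V} {b : Basis I ℝ V} {p q : I → ℕ} (h : IsSmoothRep ρ b p q)
    (k : ℕ) : IsSmoothRep (extRep k ρ) (b.exteriorPower k) (fun S => ∑ i ∈ S.1, p i)
      (fun S => ∑ i ∈ S.1, q i) where
  differentiable S T := by
    simp only [FormalHam.extRep, MonoidHom.coe_mk, OneHom.coe_mk, exteriorPower.basis_repr_apply,
      exteriorPower.basis_apply]
    simp only [exteriorPower.map_apply_ιMulti_family]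
    simp only [exteriorPower.ιMulti_family, exteriorPower.ιMultiDual_apply_ιMulti]
    exact differentiable_det fun i j => h.differentiable _ _
  torus x y T := by
    simp only [FormalHam.extRep, MonoidHom.coe_mk, OneHom.coe_mk, exteriorPower.basis_apply]
    rw [exteriorPower.map_apply_ιMulti_family]
    simp only [exteriorPower.ιMulti_family]
    have : (ρ (mat2 x 0 0 y) ∘ b) ∘ (Set.powersetCard.ofFinEmbEquiv.symm T) =
        fun i => (fun j => x ^ p j * y ^ q j) (Set.powersetCard.ofFinEmbEquiv.symm T i) •
          (b ∘ Set.powersetCard.ofFinEmbEquiv.symm T) i := by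
      funext i
      exact h.torus x y _
    rw [this, ← AlternatingMap.coe_multilinearMap, MultilinearMap.map_smul_univ,
      prod_ofFinEmbEquiv_symm T (fun j => x ^ p j * y ^ q j), Finset.prod_mul_distrib, Finset.prod_pow_eq_pow_sum,
      Finset.prod_pow_eq_pow_sum]

/-- The entries of a tensor product are products of entries. -/
theorem IsSmoothRep.tensorRep {ι : Type*} [Fintype ι] {I V : ι → Type*}
    [∀ i, AddCommGroup (V i)] [∀ i, Module ℝ (V i)]
    {ρ : ∀ i, Representation ℝ Mat (V i)} {b : ∀ i, Basis (I i) ℝ (V i)} {p q : ∀ i, I i → ℕ}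
    (h : ∀ i, IsSmoothRep (ρ i) (b i) (p i) (q i)) :
    IsSmoothRep (tensorRep ρ) (Basis.piTensorProduct b)
      (fun S => ∑ i, p i (S i)) (fun S => ∑ i, q i (S i)) where
  differentiable S T := by
    simp only [FormalHam.tensorRep, MonoidHom.coe_mk, OneHom.coe_mk,
      Basis.piTensorProduct_apply, PiTensorProduct.map_tprod,
      Basis.piTensorProduct_repr_tprod_apply]
    exact differentiable_finsetProd _ fun i => (h i).differentiable _ _
  torus x y T := by
    simp only [FormalHam.tensorRep, MonoidHom.coe_mk, OneHom.coe_mk,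
      Basis.piTensorProduct_apply, PiTensorProduct.map_tprod, (h _).torus]
    rw [MultilinearMap.map_smul_univ, Finset.prod_mul_distrib, Finset.prod_pow_eq_pow_sum,
      Finset.prod_pow_eq_pow_sum]

/-- The exponent of the monomial `q ^ a * p ^ b`. -/
noncomputable def expo (a b : ℕ) : (Fin 1 ⊕ Fin 1) →₀ ℕ :=
  Finsupp.single (.inl 0) a + Finsupp.single (.inr 0) b

@[simp] theorem expo_inl (a b : ℕ) (i : Fin 1) : expo a b (.inl i) = a := by
  simp [expo, Subsingleton.elim i 0]

@[simp] theorem expo_inr (a b : ℕ) (i : Fin 1) : expo a b (.inr i) = b := by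
  simp [expo, Subsingleton.elim i 0]

theorem expo_eta (e : (Fin 1 ⊕ Fin 1) →₀ ℕ) : expo (e (.inl 0)) (e (.inr 0)) = e := by
  ext (i | i) <;> simp [Subsingleton.elim i 0]

@[simp] theorem degree_expo (a b : ℕ) : (expo a b).degree = a + b := by
  simp [expo]

theorem degree_eq (e : (Fin 1 ⊕ Fin 1) →₀ ℕ) : e.degree = e (.inl 0) + e (.inr 0) := by
  rw [← expo_eta e, degree_expo]
  simp

theorem expo_inj {a b a' b' : ℕ} : expo a b = expo a' b' ↔ a = a' ∧ b = b' := by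
  constructor
  · intro h
    exact ⟨by simpa using DFunLike.congr_fun h (.inl 0), by simpa using DFunLike.congr_fun h (.inr 0)⟩
  · rintro ⟨rfl, rfl⟩
    rfl

/-- The monomial `q ^ a * p ^ (l - a)` as an element of `S^l`. -/
noncomputable def symMonomial (l : ℕ) (a : Fin (l + 1)) : Sym 1 l :=
  ⟨MvPolynomial.monomial (expo a (l - a)) 1, by
    refine (MvPolynomial.mem_homogeneousSubmodule _ _).2
      (MvPolynomial.isHomogeneous_monomial _ ?_)
    rw [degree_expo]
    omega⟩

/-- The basis of monomials `q ^ a * p ^ (l - a)` of `S^l`. -/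
noncomputable def symBasis (l : ℕ) : Basis (Fin (l + 1)) ℝ (Sym 1 l) :=
  Basis.ofEquivFun
    { toFun := fun f a => f.1.coeff (expo a (l - a))
      map_add' := fun f g => by ext; simp
      map_smul' := fun c f => by ext; simp
      invFun := fun g => ∑ a, g a • symMonomial l a
      left_inv := fun f => by
        ext e
        rw [Submodule.coe_sum, MvPolynomial.coeff_sum]
        simp only [Submodule.coe_smul, MvPolynomial.coeff_smul, smul_eq_mul, symMonomial,
          MvPolynomial.coeff_monomial, mul_ite, mul_one, mul_zero]
        by_cases he : e.degree = l
        · have h1 := degree_eq e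
          rw [Finset.sum_eq_single ⟨e (.inl 0), by omega⟩]
          · have : expo (e (.inl 0)) (l - e (.inl 0)) = e := by
              rw [← he, h1, Nat.add_sub_cancel_left, expo_eta]
            simp only [this, if_true]
          · intro b _ hb
            rw [if_neg]
            rintro rfl
            exact hb (Fin.ext (by simp))
          · simp
        · rw [Finset.sum_eq_zero, (show f.1.IsHomogeneous l from f.2).coeff_eq_zero he]
          intro a _
          rw [if_neg]
          rintro rfl
          exact he (by rw [degree_expo]; omega)
      right_inv := fun g => by
        ext a
        change (∑ a, g a • symMonomial l a : Sym 1 l).1.coeff (expo a (l - a)) = g a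
        rw [Submodule.coe_sum, MvPolynomial.coeff_sum]
        simp only [Submodule.coe_smul, MvPolynomial.coeff_smul, smul_eq_mul, symMonomial,
          MvPolynomial.coeff_monomial, mul_ite, mul_one, mul_zero]
        rw [Finset.sum_eq_single a]
        · simp
        · intro b _ hb
          rw [if_neg]
          rw [expo_inj]
          exact fun h => hb (Fin.ext h.1)
        · simp }

theorem symBasis_repr (l : ℕ) (f : Sym 1 l) (a : Fin (l + 1)) :
    (symBasis l).repr f a = f.1.coeff (expo a (l - a)) := rfl

theorem symBasis_apply (l : ℕ) (a : Fin (l + 1)) : symBasis l a = symMonomial l a := by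
  refine (symBasis l).repr.injective (Finsupp.ext fun c => ?_)
  rw [Basis.repr_self, symBasis_repr, symMonomial, MvPolynomial.coeff_monomial,
    Finsupp.single_apply]
  refine if_congr ?_ rfl rfl
  rw [expo_inj, Fin.ext_iff]
  omega

/-- The action of the matrix monoid on the dual of `S^l` by transposed substitution. On `Sp(2, ℝ)`
it is the contragredient representation. -/
noncomputable def dualRep (l : ℕ) : Representation ℝ Mat (Dual ℝ (Sym 1 l)) where
  toFun a := (symMap l a).dualMap
  map_one' := by rw [symMap_one]; exact LinearMap.dualMap_id
  map_mul' a b := by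
    rw [symMap_mul]
    exact (LinearMap.dualMap_comp_dualMap (symMap l a) (symMap l b)).symm

theorem differentiable_coeff_mul {E : Type*} [NormedAddCommGroup E] [NormedSpace ℝ E] {τ : Type*}
    {F G : E → MvPolynomial τ ℝ} (hF : ∀ e, Differentiable ℝ fun x => (F x).coeff e)
    (hG : ∀ e, Differentiable ℝ fun x => (G x).coeff e) (e : τ →₀ ℕ) :
    Differentiable ℝ fun x => (F x * G x).coeff e := by
  classical
  simp only [MvPolynomial.coeff_mul]
  exact Differentiable.fun_sum fun c _ => (hF _).mul (hG _)

theorem differentiable_coeff_pow {E : Type*} [NormedAddCommGroup E] [NormedSpace ℝ E] {τ : Type*}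
    {F : E → MvPolynomial τ ℝ} (hF : ∀ e, Differentiable ℝ fun x => (F x).coeff e) (k : ℕ) :
    ∀ e, Differentiable ℝ fun x => (F x ^ k).coeff e := by
  induction k with
  | zero => intro e; simp only [pow_zero]; exact differentiable_const _
  | succ k ih => intro e; simp only [pow_succ]; exact differentiable_coeff_mul ih hF e

theorem aeval_linForm_monomial (A : Mat) (a b : ℕ) :
    MvPolynomial.aeval (linForm A) (MvPolynomial.monomial (expo a b) (1 : ℝ)) =
      linForm A (.inl 0) ^ a * linForm A (.inr 0) ^ b := by
  rw [MvPolynomial.aeval_monomial, map_one, one_mul, Finsupp.prod_fintype _ _ (by simp)]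
  simp

theorem differentiable_coeff_aeval_linForm (a b : ℕ) (e : (Fin 1 ⊕ Fin 1) →₀ ℕ) :
    Differentiable ℝ fun x : (Fin 1 ⊕ Fin 1) → (Fin 1 ⊕ Fin 1) → ℝ =>
      (MvPolynomial.aeval (linForm (Matrix.of x))
        (MvPolynomial.monomial (expo a b) (1 : ℝ))).coeff e := by
  have h : ∀ i e, Differentiable ℝ fun x : (Fin 1 ⊕ Fin 1) → (Fin 1 ⊕ Fin 1) → ℝ =>
      (linForm (Matrix.of x) i).coeff e := by
    intro i e
    simp only [linForm, MvPolynomial.coeff_sum, MvPolynomial.coeff_C_mul, Matrix.of_apply]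
    fun_prop
  simp only [aeval_linForm_monomial]
  exact differentiable_coeff_mul (differentiable_coeff_pow (h _) a)
    (differentiable_coeff_pow (h _) b) e

theorem linForm_diag (x y : ℝ) : linForm (mat2 x 0 0 y) (.inl 0) =
      MvPolynomial.C x * MvPolynomial.X (.inl 0) ∧
    linForm (mat2 x 0 0 y) (.inr 0) = MvPolynomial.C y * MvPolynomial.X (.inr 0) := by
  constructor <;> simp [linForm, mat2]

theorem aeval_linForm_diag (x y : ℝ) (a b : ℕ) :
    MvPolynomial.aeval (linForm (mat2 x 0 0 y)) (MvPolynomial.monomial (expo a b) (1 : ℝ)) =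
      MvPolynomial.C (x ^ a * y ^ b) * MvPolynomial.monomial (expo a b) 1 := by
  have : MvPolynomial.monomial (expo a b) (1 : ℝ) =
      MvPolynomial.X (.inl 0) ^ a * MvPolynomial.X (.inr 0) ^ b := by
    rw [MvPolynomial.monomial_eq, Finsupp.prod_fintype _ _ (by simp)]
    simp
  rw [aeval_linForm_monomial, (linForm_diag x y).1, (linForm_diag x y).2, this]
  simp only [mul_pow, map_mul, map_pow]
  ring

/-- The dual of the monomial `q ^ a * p ^ (l - a)` has weight `a - (l - a)`, as the transposed
substitution acts on it like the substitution on the monomial itself. -/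
theorem isSmoothRep_dualRep (l : ℕ) :
    IsSmoothRep (dualRep l) (symBasis l).dualBasis (fun a => (a : ℕ)) (fun a => l - a) where
  differentiable i j := by
    simp only [dualRep, MonoidHom.coe_mk, OneHom.coe_mk, Basis.dualBasis_repr,
      LinearMap.dualMap_apply, Basis.dualBasis_apply, symBasis_repr, symBasis_apply]
    exact differentiable_coeff_aeval_linForm _ _ _
  torus x y j := by
    refine (symBasis l).ext fun i => ?_
    simp only [dualRep, MonoidHom.coe_mk, OneHom.coe_mk,
      LinearMap.dualMap_apply, Basis.dualBasis_apply, symBasis_repr, symBasis_apply,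
      LinearMap.smul_apply, smul_eq_mul]
    have : (symMap l (mat2 x 0 0 y) (symMonomial l i)).1 =
        MvPolynomial.C (x ^ (i : ℕ) * y ^ (l - i)) *
          MvPolynomial.monomial (expo i (l - i)) 1 := aeval_linForm_diag _ _ _ _
    rw [this, symMonomial, MvPolynomial.coeff_C_mul, MvPolynomial.coeff_monomial]
    split_ifs with h
    · rw [expo_inj] at h
      rw [h.1]
    · simp

/-- The index set of the monomial basis of `Λ^{k_3} S^{3*} ⊗ Λ^{k_4} S^{4*} ⊗ ⋯`: families of
sets of `k_j` monomials of degree `j`. -/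
abbrev TypeIndex {s : ℕ} (k : Fin s → ℕ) : Type :=
  ∀ i : Fin s, Set.powersetCard (Fin ((i : ℕ) + 3 + 1)) (k i)

/-- An intertwining map from the trivial representation is given by the image of `1`, an arbitrary
invariant vector. -/
theorem trivMult_eq_finrank {G V : Type*} [Monoid G] [AddCommMonoid V] [Module ℝ V]
    (ρ : Representation ℝ G V) (K : Submodule ℝ V) (hK : ∀ v, v ∈ K ↔ ∀ g, ρ g v = v) :
    trivMult ρ = finrank ℝ K :=
  LinearEquiv.finrank_eq
    { toFun := fun f => ⟨f 1, (hK _).2 fun g => by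
        rw [← Representation.IntertwiningMap.isIntertwining]; rfl⟩
      map_add' := fun f g => rfl
      map_smul' := fun c f => rfl
      invFun := fun v => LinearMap.intertwiningMap_of_isIntertwiningMap
        _ _ (LinearMap.toSpanSingleton ℝ V v.1) (fun g x => by
          simp only [LinearMap.toSpanSingleton_apply, map_smul, (hK _).1 v.2 g]
          rfl)
      left_inv := fun f => by
        ext
        change (1 : ℝ) • f 1 = f 1
        rw [one_smul]
      right_inv := fun v => by
        ext
        change (1 : ℝ) • v.1 = v.1
        rw [one_smul] }

/-- The vectors fixed by `Sp(2, ℝ)` in a representation of the matrix monoid. -/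
def spInvariants {V : Type*} [AddCommMonoid V] [Module ℝ V] (ρ : Representation ℝ Mat V) :
    Submodule ℝ V where
  carrier := {v | ∀ a : Sp 1, ρ a.1 v = v}
  add_mem' hv hw a := by rw [map_add, hv a, hw a]
  zero_mem' a := map_zero _
  smul_mem' c v hv a := by rw [map_smul, hv a]

/-- The multiplicity of the trivial representation in `Λ^{k_3} S^{3*} ⊗ Λ^{k_4} S^{4*} ⊗ ⋯` as
the difference of the multiplicities of the weights `0` and `2`. -/
theorem trivMult_typeRep {s : ℕ} (k : Fin s → ℕ) :
    trivMult (typeRep 1 k) +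
      Fintype.card {S : TypeIndex k // ∑ i, ∑ a ∈ (S i).1, (a : ℕ) =
        ∑ i, ∑ a ∈ (S i).1, ((i : ℕ) + 3 - a) + 2} =
      Fintype.card {S : TypeIndex k // ∑ i, ∑ a ∈ (S i).1, (a : ℕ) =
        ∑ i, ∑ a ∈ (S i).1, ((i : ℕ) + 3 - a)} := by
  have h := IsSmoothRep.tensorRep fun i : Fin s => (isSmoothRep_dualRep ((i : ℕ) + 3)).extRep (k i)
  have hk : ∀ a : Sp 1, typeRep 1 k a = tensorRep (fun i : Fin s =>
      extRep (k i) (dualRep ((i : ℕ) + 3))) a.1 := by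
    intro a
    have : ∀ i : Fin s, (symRep 1 ((i : ℕ) + 3)).dual a = dualRep ((i : ℕ) + 3) a.1 := by
      intro i
      ext f x : 2
      change f (symMap _ (a⁻¹⁻¹ : Sp 1).1 x) = f (symMap _ a.1 x)
      rw [inv_inv]
    simp only [typeRep, tensorRep, extRep, MonoidHom.coe_mk, OneHom.coe_mk]
    simp only [this]
  rw [trivMult_eq_finrank (typeRep 1 k) (spInvariants (tensorRep (fun i : Fin s =>
      extRep (k i) (dualRep ((i : ℕ) + 3)))))
    (fun v => forall_congr' fun a => by rw [hk])]
  exact h.finrank_invariants _ fun v => Iff.rfl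

end TypeRep

/-! ### Linear substitutions in formal Hamiltonian vector fields -/

section Subst

open Module Matrix MvPowerSeries

theorem coe_aeval_linForm (A : Mat) (P : MvPolynomial (Fin 1 ⊕ Fin 1) ℝ) :
    ((MvPolynomial.aeval (linForm A) P : MvPolynomial (Fin 1 ⊕ Fin 1) ℝ) :
      MvPowerSeries (Fin 1 ⊕ Fin 1) ℝ) =
      subst (fun i => (linForm A i : MvPowerSeries (Fin 1 ⊕ Fin 1) ℝ))
        (P : MvPowerSeries (Fin 1 ⊕ Fin 1) ℝ) := by
  rw [subst_coe]
  induction P using MvPolynomial.induction_on with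
  | C r => simp [MvPowerSeries.algebraMap_apply]
  | add P Q hP hQ => rw [map_add, map_add, MvPolynomial.coe_add, hP, hQ]
  | mul_X P i hP => rw [map_mul, map_mul, MvPolynomial.coe_mul, hP, MvPolynomial.aeval_X,
      MvPolynomial.aeval_X]

theorem subst_linForm_monomial (A : Mat) (e : (Fin 1 ⊕ Fin 1) →₀ ℕ) :
    subst (fun i => (linForm A i : MvPowerSeries (Fin 1 ⊕ Fin 1) ℝ))
      (MvPowerSeries.monomial e (1 : ℝ)) =
      (MvPolynomial.aeval (linForm A) (MvPolynomial.monomial e (1 : ℝ)) :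
        MvPolynomial (Fin 1 ⊕ Fin 1) ℝ) := by
  rw [coe_aeval_linForm, MvPolynomial.coe_monomial]

/-- A coefficient of `f ∘ A` depends on the finitely many coefficients of `f` of the same degree. -/
theorem coeff_subst_linForm (A : Mat) (f : MvPowerSeries (Fin 1 ⊕ Fin 1) ℝ)
    (e : (Fin 1 ⊕ Fin 1) →₀ ℕ) :
    coeff e (subst (fun i => (linForm A i : MvPowerSeries (Fin 1 ⊕ Fin 1) ℝ)) f) =
      ∑ i ∈ Finset.range (e.degree + 1), coeff (expo i (e.degree - i)) f *
        (MvPolynomial.aeval (linForm A)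
          (MvPolynomial.monomial (expo i (e.degree - i)) (1 : ℝ))).coeff e := by
  classical
  have h1 : ∀ c : (Fin 1 ⊕ Fin 1) →₀ ℕ,
      coeff e (c.prod fun i n => (linForm A i : MvPowerSeries (Fin 1 ⊕ Fin 1) ℝ) ^ n) =
        (MvPolynomial.aeval (linForm A) (MvPolynomial.monomial c (1 : ℝ))).coeff e := by
    intro c
    rw [← MvPolynomial.coeff_coe, ← subst_linForm_monomial, subst_monomial (hasSubst_linForm A),
      map_one, one_mul]
  rw [coeff_subst (hasSubst_linForm A)]
  simp only [h1, smul_eq_mul]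
  rw [finsum_eq_sum_of_support_subset (s := (Finset.range (e.degree + 1)).image
    fun i => expo i (e.degree - i)), Finset.sum_image]
  · intro i _ j _ hij
    exact (expo_inj.1 hij).1
  · intro c hc
    have h2 := right_ne_zero_of_mul hc
    have h3 : c.degree = e.degree := by
      by_contra hne
      refine h2 (MvPolynomial.IsHomogeneous.coeff_eq_zero (n := c.degree) ?_ (Ne.symm hne))
      have := MvPolynomial.IsHomogeneous.aeval
        (MvPolynomial.isHomogeneous_monomial (d := c) (1 : ℝ) rfl) (linForm A)
        (isHomogeneous_linForm A)
      rwa [one_mul] at this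
    have h4 := degree_eq c
    rw [Finset.coe_image]
    refine ⟨c (.inl 0), by simp; omega, ?_⟩
    change expo (c (.inl 0)) (e.degree - c (.inl 0)) = c
    rw [← h3, h4, Nat.add_sub_cancel_left, expo_eta]

/-- The substitution `f ↦ f ∘ A` on formal Hamiltonian vector fields, for an arbitrary matrix. -/
noncomputable def substHam (A : Mat) : ham0 1 →L[ℝ] ham0 1 where
  toFun f := ⟨subst (fun i => (linForm A i : MvPowerSeries (Fin 1 ⊕ Fin 1) ℝ)) f.1, by
    intro e he
    rw [coeff_subst_linForm]
    refine Finset.sum_eq_zero fun i hi => ?_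
    rw [Finset.mem_range] at hi
    rw [f.2 _ (by rw [degree_expo]; omega), zero_mul]⟩
  map_add' f g := Subtype.ext (subst_add (hasSubst_linForm A) f.1 g.1)
  map_smul' c f := Subtype.ext (subst_smul (hasSubst_linForm A) c f.1)
  cont := by
    refine Continuous.subtype_mk ?_ _
    refine continuous_pi fun e => ?_
    change Continuous fun f : ham0 1 =>
      coeff e (subst (fun i => (linForm A i : MvPowerSeries (Fin 1 ⊕ Fin 1) ℝ)) f.1)
    simp only [coeff_subst_linForm]
    exact continuous_finsetSum _ fun i _ =>
      ((WithPiTopology.continuous_coeff ℝ _).comp continuous_subtype_val).mul continuous_const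

theorem substHam_val (A : Mat) (f : ham0 1) : (substHam A f).1 =
    subst (fun i => (linForm A i : MvPowerSeries (Fin 1 ⊕ Fin 1) ℝ)) f.1 := rfl

theorem act_eq_substHam (a : Sp 1) (f : ham0 1) : act a f = substHam (a⁻¹ : Sp 1).1 f := rfl

theorem aeval_linForm_linForm (A B : Mat) (i : Fin 1 ⊕ Fin 1) :
    MvPolynomial.aeval (linForm B) (linForm A i) = linForm (A * B) i := by
  simp only [linForm, map_sum, map_mul, MvPolynomial.aeval_X, MvPolynomial.algHom_C,
    MvPolynomial.algebraMap_eq, Matrix.mul_apply, Finset.mul_sum, Finset.sum_mul]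
  rw [Finset.sum_comm]
  simp only [mul_assoc]

theorem substHam_mul (A B : Mat) (f : ham0 1) :
    substHam (A * B) f = substHam B (substHam A f) := by
  refine Subtype.ext ?_
  rw [substHam_val, substHam_val, substHam_val,
    subst_comp_subst_apply (hasSubst_linForm A) (hasSubst_linForm B)]
  congr 1
  funext i
  rw [← coe_aeval_linForm, aeval_linForm_linForm]

theorem linForm_one : linForm (1 : Mat) = MvPolynomial.X := by
  funext i
  simp [linForm, Matrix.one_apply]

theorem substHam_one (f : ham0 1) : substHam 1 f = f := by
  refine Subtype.ext ?_
  rw [substHam_val, linForm_one]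
  simp only [MvPolynomial.coe_X]
  rw [subst_self]
  rfl

theorem isHomogeneous_iff {f : MvPowerSeries (Fin 1 ⊕ Fin 1) ℝ} {l : ℕ} :
    f.IsHomogeneous l ↔ ∀ e, e.degree ≠ l → coeff e f = 0 := by
  refine ⟨fun h e he => h.coeff_eq_zero he, fun h e he => ?_⟩
  by_contra hne
  refine he (h e fun hd => hne ?_)
  rw [Finsupp.degree_eq_weight_one] at hd
  exact hd

theorem isHomogeneous_substHam (A : Mat) {f : ham0 1} {l : ℕ} (hf : f.1.IsHomogeneous l) :
    (substHam A f).1.IsHomogeneous l := by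
  rw [isHomogeneous_iff] at hf ⊢
  intro e he
  rw [substHam_val, coeff_subst_linForm]
  refine Finset.sum_eq_zero fun i hi => ?_
  rw [Finset.mem_range] at hi
  rw [hf _ (by rw [degree_expo]; omega), zero_mul]

/-- The monomial with exponent `e` as a formal Hamiltonian vector field; it is set to `0` when the
degree is less than `2`. -/
noncomputable def hamMonomial (e : (Fin 1 ⊕ Fin 1) →₀ ℕ) : ham0 1 :=
  if h : 2 ≤ e.degree then ⟨MvPowerSeries.monomial e 1, fun c hc => by
    classical
    rw [coeff_monomial, if_neg (by rintro rfl; omega)]⟩ else 0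

theorem hamMonomial_val {e : (Fin 1 ⊕ Fin 1) →₀ ℕ} (h : 2 ≤ e.degree) :
    (hamMonomial e).1 = MvPowerSeries.monomial e 1 := by
  rw [hamMonomial, dif_pos h]

theorem isHomogeneous_hamMonomial (e : (Fin 1 ⊕ Fin 1) →₀ ℕ) :
    (hamMonomial e).1.IsHomogeneous e.degree := by
  classical
  rw [isHomogeneous_iff]
  intro c hc
  rw [hamMonomial]
  split_ifs with h
  · rw [coeff_monomial, if_neg (by rintro rfl; exact hc rfl)]
  · exact map_zero _

theorem hasSum_hamMonomial (f : ham0 1) :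
    HasSum (fun e => coeff e f.1 • hamMonomial e) f := by
  refine (Topology.IsInducing.hasSum_iff (g := (ham0 1).subtype) .subtypeVal _ _).1 ?_
  have h := WithPiTopology.hasSum_of_monomials_self f.1
  convert h using 1
  · funext e
    change coeff e f.1 • (hamMonomial e).1 = _
    by_cases he : 2 ≤ e.degree
    · rw [hamMonomial_val he, ← map_smul, smul_eq_mul, mul_one]
    · rw [f.2 e (by omega), zero_smul, map_zero]
  · rfl

/-- The monomials span a dense subspace, so a continuous multilinear form is determined by its
values on monomials. -/
theorem eq_zero_of_monomials {m : ℕ} (φ : ContinuousMultilinearMap ℝ (fun _ : Fin m => ham0 1) ℝ)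
    (h : ∀ e : Fin m → ((Fin 1 ⊕ Fin 1) →₀ ℕ), (∀ i, 2 ≤ (e i).degree) →
      φ (fun i => hamMonomial (e i)) = 0) : φ = 0 := by
  have key : ∀ S : Finset (Fin m), ∀ f : Fin m → ham0 1,
      (∀ i, i ∉ S → ∃ e, 2 ≤ e.degree ∧ f i = hamMonomial e) → φ f = 0 := by
    intro S
    induction S using Finset.induction_on with
    | empty =>
      intro f hf
      choose e he using fun i => hf i (Finset.notMem_empty i)
      have : f = fun i => hamMonomial (e i) := funext fun i => (he i).2
      rw [this]
      exact h e fun i => (he i).1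
    | insert i S hi ih =>
      intro f hf
      have h1 := (hasSum_hamMonomial (f i)).map (φ.toContinuousLinearMap f i)
        (φ.toContinuousLinearMap f i).continuous
      have h2 : (φ.toContinuousLinearMap f i) (f i) = φ f :=
        congrArg φ (Function.update_eq_self i f)
      rw [h2] at h1
      refine h1.unique ?_
      convert hasSum_zero using 1
      funext e
      change φ.toContinuousLinearMap f i (coeff e (f i).1 • hamMonomial e) = 0
      by_cases he : 2 ≤ e.degree
      · rw [map_smul]
        have : φ (Function.update f i (hamMonomial e)) = 0 := by
          refine ih _ fun j hj => ?_
          by_cases hji : j = i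
          · subst hji
            exact ⟨e, he, by rw [Function.update_self]⟩
          · obtain ⟨e', he', h'⟩ := hf j (by simp [hji, hj])
            exact ⟨e', he', by rw [Function.update_of_ne hji, h']⟩
        exact (congrArg _ this).trans (smul_zero _)
      · rw [(f i).2 e (by omega), zero_smul, map_zero]
  ext f
  exact key Finset.univ f fun i hi => absurd (Finset.mem_univ i) hi

end Subst

/-! ### The relative cochain spaces as invariants -/

section RelCochain

open Module Matrix MvPowerSeries

/-- The index set of the monomials of degrees `3, …, N + 2`: the pair `(j, a)` stands for
`q ^ a * p ^ (j + 3 - a)`. -/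
def MonoIndex (N : ℕ) : Type := (j : Fin N) × Fin ((j : ℕ) + 3 + 1)

instance (N : ℕ) : Fintype (MonoIndex N) :=
  inferInstanceAs (Fintype ((j : Fin N) × Fin ((j : ℕ) + 3 + 1)))

/-- An arbitrary linear order on the monomials, used to write exterior monomials as ordered
products. -/
noncomputable instance (N : ℕ) : LinearOrder (MonoIndex N) :=
  LinearOrder.lift' (Fintype.equivFin (MonoIndex N)) (Fintype.equivFin (MonoIndex N)).injective

namespace MonoIndex

/-- The exponent of `q`. -/
def qdeg {N : ℕ} (u : MonoIndex N) : ℕ := u.2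

/-- The exponent of `p`. -/
def pdeg {N : ℕ} (u : MonoIndex N) : ℕ := (u.1 : ℕ) + 3 - u.2

/-- The weight, i.e. the degree minus `2`. -/
def wt {N : ℕ} (u : MonoIndex N) : ℕ := (u.1 : ℕ) + 1

/-- The exponent vector. -/
noncomputable def toExpo {N : ℕ} (u : MonoIndex N) : (Fin 1 ⊕ Fin 1) →₀ ℕ := expo u.qdeg u.pdeg

theorem qdeg_add_pdeg {N : ℕ} (u : MonoIndex N) : u.qdeg + u.pdeg = u.wt + 2 := by
  have := u.2.2
  simp only [qdeg, pdeg, wt]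
  omega

theorem degree_toExpo {N : ℕ} (u : MonoIndex N) : u.toExpo.degree = u.wt + 2 := by
  rw [toExpo, degree_expo, qdeg_add_pdeg]

theorem toExpo_injective {N : ℕ} : Function.Injective (toExpo (N := N)) := by
  rintro ⟨j, a⟩ ⟨j', a'⟩ h
  have h1 := expo_inj.1 h
  have h2 := a.2
  have h3 := a'.2
  simp only [qdeg, pdeg] at h1
  obtain rfl : j = j' := Fin.ext (by omega)
  obtain rfl : a = a' := Fin.ext h1.1
  rfl

theorem exists_toExpo_eq {N : ℕ} {e : (Fin 1 ⊕ Fin 1) →₀ ℕ} (h3 : 3 ≤ e.degree)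
    (hN : e.degree ≤ N + 2) : ∃ u : MonoIndex N, u.toExpo = e := by
  have h := degree_eq e
  refine ⟨⟨⟨e.degree - 3, by omega⟩, ⟨e (.inl 0), by simp only; omega⟩⟩, ?_⟩
  conv_rhs => rw [← expo_eta e]
  refine expo_inj.2 ⟨rfl, ?_⟩
  simp only [pdeg]
  omega

end MonoIndex

/-- The cochains of weight `w` that are annihilated by the contractions with `𝔰𝔭(2, ℝ)`. -/
def basicCochain (m w : ℕ) : Submodule ℝ (Cochain 1 m) where
  carrier := {σ | σ ∈ weightCochain 1 m w ∧
    ∀ f : Fin m → ham0 1, (∃ i, (f i).1.IsHomogeneous 2) → σ f = 0}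
  add_mem' ha hb := ⟨add_mem ha.1 hb.1, fun f hf => by
    rw [ContinuousAlternatingMap.add_apply, ha.2 f hf, hb.2 f hf, add_zero]⟩
  zero_mem' := ⟨zero_mem _, fun _ _ => rfl⟩
  smul_mem' c σ h := ⟨Submodule.smul_mem _ c h.1, fun f hf => by
    rw [ContinuousAlternatingMap.smul_apply, h.2 f hf, smul_zero]⟩

/-- The action of the matrix monoid on cochains by substitution in the arguments. -/
noncomputable def cochainRep (m w : ℕ) : Representation ℝ Mat (basicCochain m w) where
  toFun A :=
    { toFun := fun σ => ⟨σ.1.compContinuousLinearMap (substHam A),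
        fun f l hf hl => σ.2.1 _ l (fun i => isHomogeneous_substHam A (hf i)) hl,
        fun f ⟨i, hi⟩ => σ.2.2 _ ⟨i, isHomogeneous_substHam A hi⟩⟩
      map_add' := fun σ τ => rfl
      map_smul' := fun c σ => rfl }
  map_one' := by
    ext σ f
    exact congrArg σ.1 (funext fun i => substHam_one (f i))
  map_mul' A B := by
    ext σ f
    exact congrArg σ.1 (funext fun i => substHam_mul A B (f i))

theorem cochainRep_apply {m w : ℕ} (A : Mat) (σ : basicCochain m w) (f : Fin m → ham0 1) :
    (cochainRep m w A σ).1 f = σ.1 (fun i => substHam A (f i)) := rfl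

theorem relCochain_le (m w : ℕ) : relCochain 1 m w ≤ basicCochain m w :=
  fun _ h => ⟨h.1, h.2.1⟩

theorem mem_relCochain_iff {m w : ℕ} (σ : basicCochain m w) :
    σ.1 ∈ relCochain 1 m w ↔ ∀ a : Sp 1, cochainRep m w a.1 σ = σ := by
  constructor
  · intro h a
    ext f
    have := h.2.2 a⁻¹ f
    simp only [act_eq_substHam, inv_inv] at this
    exact this
  · intro h
    exact ⟨σ.2.1, σ.2.2, fun a f => by
      simp only [act_eq_substHam, ← cochainRep_apply]
      rw [h]⟩

/-- The coordinates with respect to the monomials of degrees `3, …, N + 2`. -/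
noncomputable def monoCoeff (N : ℕ) : ham0 1 →ₗ[ℝ] (MonoIndex N → ℝ) where
  toFun f u := coeff u.toExpo f.1
  map_add' _ _ := rfl
  map_smul' _ _ := rfl

theorem monoCoeff_hamMonomial {N : ℕ} (u : MonoIndex N) :
    monoCoeff N (hamMonomial u.toExpo) = Pi.basisFun ℝ (MonoIndex N) u := by
  ext v
  change coeff v.toExpo (hamMonomial u.toExpo).1 = _
  rw [hamMonomial_val (by rw [u.degree_toExpo]; omega), coeff_monomial, Pi.basisFun_apply,
    Pi.single_apply]
  simp only [MonoIndex.toExpo_injective.eq_iff]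

/-- The exterior monomial attached to a set `T` of monomials: the determinant of the coefficients
at the monomials in `T`. -/
noncomputable def detCochain {N m : ℕ} (T : Set.powersetCard (MonoIndex N) m) : Cochain 1 m :=
  let A : (ham0 1) [⋀^Fin m]→ₗ[ℝ] ℝ :=
    ((exteriorPower.ιMultiDual ℝ m (Pi.basisFun ℝ (MonoIndex N)) T).compAlternatingMap
      (exteriorPower.ιMulti ℝ m)).compLinearMap (monoCoeff N)
  { A with
    cont := by
      change Continuous fun f : Fin m → ham0 1 =>
        exteriorPower.ιMultiDual ℝ m (Pi.basisFun ℝ (MonoIndex N)) T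
          (exteriorPower.ιMulti ℝ m fun i => monoCoeff N (f i))
      simp only [exteriorPower.ιMultiDual_apply_ιMulti]
      refine Continuous.matrix_det (continuous_matrix fun i j => ?_)
      exact (WithPiTopology.continuous_coeff ℝ _).comp
        (continuous_subtype_val.comp (continuous_apply i)) }

/-- The tuple of the monomials in `T`, in increasing order. -/
noncomputable def monoTuple {N m : ℕ} (T : Set.powersetCard (MonoIndex N) m) (i : Fin m) :
    MonoIndex N := Set.powersetCard.ofFinEmbEquiv.symm T i

theorem detCochain_apply {N m : ℕ} (T : Set.powersetCard (MonoIndex N) m) (f : Fin m → ham0 1) :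
    detCochain T f = (Matrix.of fun i j => coeff (monoTuple T j).toExpo (f i).1).det := by
  change exteriorPower.ιMultiDual ℝ m (Pi.basisFun ℝ (MonoIndex N)) T
    (exteriorPower.ιMulti ℝ m fun i => monoCoeff N (f i)) = _
  rw [exteriorPower.ιMultiDual_apply_ιMulti]
  rfl

theorem detCochain_monoTuple {N m : ℕ} (S T : Set.powersetCard (MonoIndex N) m) :
    detCochain T (fun i => hamMonomial (monoTuple S i).toExpo) = if S = T then 1 else 0 := by
  change exteriorPower.ιMultiDual ℝ m (Pi.basisFun ℝ (MonoIndex N)) T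
    (exteriorPower.ιMulti ℝ m fun i => monoCoeff N (hamMonomial (monoTuple S i).toExpo)) = _
  simp only [monoCoeff_hamMonomial]
  change exteriorPower.ιMultiDual ℝ m (Pi.basisFun ℝ (MonoIndex N)) T
    (exteriorPower.ιMulti_family ℝ m (Pi.basisFun ℝ (MonoIndex N)) S) = _
  split_ifs with h
  · rw [h, exteriorPower.ιMultiDual_apply_diag]
  · exact exteriorPower.ιMultiDual_apply_nondiag _ _ _ _ _ (Ne.symm h)

/-- The index set of the basis of exterior monomials: sets of `m` monomials of total weight `w`. -/
abbrev CochainIndex (N m w : ℕ) : Type :=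
  {T : Set.powersetCard (MonoIndex N) m // ∑ u ∈ T.1, u.wt = w}

theorem sum_monoTuple {M : Type*} [AddCommMonoid M] {N m : ℕ}
    (T : Set.powersetCard (MonoIndex N) m) (f : MonoIndex N → M) :
    ∑ i, f (monoTuple T i) = ∑ u ∈ T.1, f u := by
  have h := Finset.map_orderEmbOfFin_univ T.1 T.2
  rw [← h, Finset.sum_map]
  rfl

/-- Each term of the determinant contains one coefficient of every argument, at the monomials in
`T` in some order; these have total weight `w` and none of them is quadratic. -/
theorem detCochain_mem {N m w : ℕ} (T : CochainIndex N m w) :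
    detCochain T.1 ∈ basicCochain m w := by
  have h0 : ∀ (f : Fin m → ham0 1),
      (∀ π : Equiv.Perm (Fin m), ∃ i, coeff (monoTuple T.1 i).toExpo (f (π i)).1 = 0) →
      detCochain T.1 f = 0 := by
    intro f hf
    rw [detCochain_apply, Matrix.det_apply]
    refine Finset.sum_eq_zero fun π _ => ?_
    obtain ⟨i, hi⟩ := hf π
    rw [Finset.prod_eq_zero (Finset.mem_univ i) hi, smul_zero]
  refine ⟨fun f l hf hl => h0 f fun π => ?_, fun f ⟨i, hi⟩ => h0 f fun π => ⟨π.symm i, ?_⟩⟩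
  · by_contra! hne
    refine hl ?_
    have h1 : ∀ i, l (π i) = (monoTuple T.1 i).wt + 2 := by
      intro i
      rw [← MonoIndex.degree_toExpo]
      by_contra hd
      exact hne i (MvPowerSeries.IsHomogeneous.coeff_eq_zero (hf (π i)) (Ne.symm hd))
    rw [← Equiv.sum_comp π]
    simp only [h1]
    have h2 := sum_monoTuple T.1 MonoIndex.wt
    have h3 : ((∑ i, (monoTuple T.1 i).wt : ℕ) : ℤ) = w := by rw [h2, T.2]
    rw [← h3]
    push_cast
    exact Finset.sum_congr rfl fun i _ => by ring
  · rw [Equiv.apply_symm_apply]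
    refine hi.coeff_eq_zero ?_
    rw [MonoIndex.degree_toExpo, MonoIndex.wt]
    omega

/-- Evaluation of cochains on increasing tuples of monomials. -/
noncomputable def evalCochain (N m w : ℕ) : basicCochain m w →ₗ[ℝ] (CochainIndex N m w → ℝ) where
  toFun σ T := σ.1 fun i => hamMonomial (monoTuple T.1 i).toExpo
  map_add' _ _ := rfl
  map_smul' _ _ := rfl

/-- A cochain of weight `w` without quadratic arguments is determined by its values on tuples of
monomials of degrees `3, …, w + 2`: a degree above `w + 2` makes the weight exceed `w`. -/
theorem evalCochain_injective {N m w : ℕ} (hN : w ≤ N) :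
    Function.Injective (evalCochain N m w) := by
  rw [← LinearMap.ker_eq_bot, Submodule.eq_bot_iff]
  intro σ hσ
  -- the alternating form obtained by restriction to the span of the monomials
  let τ : (MonoIndex N → ℝ) [⋀^Fin m]→ₗ[ℝ] ℝ := σ.1.toAlternatingMap.compLinearMap
    ((Pi.basisFun ℝ (MonoIndex N)).constr ℝ fun u => hamMonomial u.toExpo)
  have hτ : ∀ u : Fin m → MonoIndex N, τ (fun i => Pi.basisFun ℝ _ (u i)) =
      σ.1 fun i => hamMonomial (u i).toExpo := by
    intro u
    change σ.1 (fun i => (Pi.basisFun ℝ (MonoIndex N)).constr ℝ _ (Pi.basisFun ℝ _ (u i))) = _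
    simp only [Basis.constr_basis]
  have hτ0 : τ = 0 := by
    refine exteriorPower.alternatingMapLinearEquiv.injective ?_
    refine ((Pi.basisFun ℝ (MonoIndex N)).exteriorPower m).ext fun T => ?_
    rw [exteriorPower.basis_apply, exteriorPower.ιMulti_family,
      exteriorPower.alternatingMapLinearEquiv_apply_ιMulti, map_zero, LinearMap.zero_apply]
    refine (hτ (monoTuple T)).trans ?_
    by_cases hT : ∑ u ∈ T.1, u.wt = w
    · exact congrFun (show evalCochain N m w σ = 0 from hσ) ⟨T, hT⟩
    · refine σ.2.1 _ _ (fun i => isHomogeneous_hamMonomial _) fun h => hT ?_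
      simp only [MonoIndex.degree_toExpo] at h
      rw [← sum_monoTuple T MonoIndex.wt]
      have h' : ((∑ i, (monoTuple T i).wt : ℕ) : ℤ) = w := by
        rw [← h]
        push_cast
        exact Finset.sum_congr rfl fun i _ => by ring
      exact_mod_cast h'
  have h0 : σ.1.toContinuousMultilinearMap = 0 := by
    refine eq_zero_of_monomials _ fun e he => ?_
    change σ.1 _ = 0
    by_cases h2 : ∃ i, (e i).degree = 2
    · obtain ⟨i, hi⟩ := h2
      exact σ.2.2 _ ⟨i, hi ▸ isHomogeneous_hamMonomial (e i)⟩
    by_cases hw : ∑ i, (((e i).degree : ℤ) - 2) = w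
    · have h3 : ∀ i, 3 ≤ (e i).degree := fun i => by
        have := he i
        have : (e i).degree ≠ 2 := fun h => h2 ⟨i, h⟩
        omega
      have hle : ∀ i, (e i).degree ≤ N + 2 := by
        intro i
        have := Finset.single_le_sum (f := fun i => (((e i).degree : ℤ) - 2))
          (fun j _ => by have := he j; omega) (Finset.mem_univ i)
        rw [hw] at this
        omega
      choose u hu using fun i => MonoIndex.exists_toExpo_eq (h3 i) (hle i)
      simp only [← hu]
      rw [← hτ, hτ0]
      rfl
    · exact σ.2.1 _ _ (fun i => isHomogeneous_hamMonomial _) hw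
  refine Subtype.ext (ContinuousAlternatingMap.toContinuousMultilinearMap_injective h0)

theorem evalCochain_detCochain {N m w : ℕ} (T : CochainIndex N m w) :
    evalCochain N m w ⟨detCochain T.1, detCochain_mem T⟩ = Pi.single T 1 := by
  ext S
  change detCochain T.1 (fun i => hamMonomial (monoTuple S.1 i).toExpo) = _
  rw [detCochain_monoTuple, Pi.single_apply]
  simp only [Subtype.ext_iff]

theorem evalCochain_surjective (N m w : ℕ) : Function.Surjective (evalCochain N m w) := by
  classical
  intro g
  refine ⟨∑ T, g T • ⟨detCochain T.1, detCochain_mem T⟩, ?_⟩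
  rw [map_sum]
  simp only [map_smul, evalCochain_detCochain]
  ext S
  simp [Finset.sum_apply, Pi.single_apply]

/-- The basis of exterior monomials. -/
noncomputable def cochainBasis {N m w : ℕ} (hN : w ≤ N) :
    Basis (CochainIndex N m w) ℝ (basicCochain m w) :=
  Basis.ofEquivFun (LinearEquiv.ofBijective (evalCochain N m w)
    ⟨evalCochain_injective hN, evalCochain_surjective N m w⟩)

theorem cochainBasis_repr {N m w : ℕ} (hN : w ≤ N) (σ : basicCochain m w)
    (T : CochainIndex N m w) :
    (cochainBasis hN).repr σ T = σ.1 fun i => hamMonomial (monoTuple T.1 i).toExpo := rfl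

theorem cochainBasis_apply {N m w : ℕ} (hN : w ≤ N) (T : CochainIndex N m w) :
    cochainBasis hN T = ⟨detCochain T.1, detCochain_mem T⟩ := by
  refine evalCochain_injective hN ?_
  rw [evalCochain_detCochain]
  ext S
  have := DFunLike.congr_fun ((cochainBasis hN).repr_self T) S
  rw [cochainBasis_repr, Finsupp.single_apply] at this
  rw [Pi.single_apply]
  simp only [eq_comm (a := S)]
  exact this

theorem coeff_substHam_hamMonomial (A : Mat) (a b : ℕ) (h : 2 ≤ a + b)
    (e : (Fin 1 ⊕ Fin 1) →₀ ℕ) : coeff e (substHam A (hamMonomial (expo a b))).1 =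
      (MvPolynomial.aeval (linForm A) (MvPolynomial.monomial (expo a b) (1 : ℝ))).coeff e := by
  rw [substHam_val, hamMonomial_val (by rwa [degree_expo]), subst_linForm_monomial,
    MvPolynomial.coeff_coe]

theorem substHam_diag_hamMonomial (x y : ℝ) (a b : ℕ) (h : 2 ≤ a + b) :
    substHam (mat2 x 0 0 y) (hamMonomial (expo a b)) =
      (x ^ a * y ^ b) • hamMonomial (expo a b) := by
  refine Subtype.ext (MvPowerSeries.ext fun e => ?_)
  rw [coeff_substHam_hamMonomial _ _ _ h, aeval_linForm_diag, MvPolynomial.coeff_C_mul]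
  change _ = coeff e ((x ^ a * y ^ b) • (hamMonomial (expo a b)).1)
  rw [map_smul, hamMonomial_val (by rwa [degree_expo]), ← MvPolynomial.coeff_coe,
    MvPolynomial.coe_monomial, smul_eq_mul]

/-- The entries of `cochainRep` are minors of the matrix of a linear substitution on polynomials. -/
theorem isSmoothRep_cochainRep {N m w : ℕ} (hN : w ≤ N) :
    IsSmoothRep (cochainRep m w) (cochainBasis hN) (fun T => ∑ u ∈ T.1.1, u.qdeg)
      (fun T => ∑ u ∈ T.1.1, u.pdeg) where
  differentiable S T := by
    simp only [cochainBasis_repr, cochainBasis_apply, cochainRep_apply, detCochain_apply]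
    refine differentiable_det fun i j => ?_
    have h : 2 ≤ (monoTuple S.1 i).qdeg + (monoTuple S.1 i).pdeg := by
      rw [MonoIndex.qdeg_add_pdeg]; omega
    simp only [Matrix.of_apply, MonoIndex.toExpo, coeff_substHam_hamMonomial _ _ _ h]
    exact differentiable_coeff_aeval_linForm _ _ _
  torus x y T := by
    refine evalCochain_injective hN ?_
    ext S
    rw [map_smul, cochainBasis_apply, Pi.smul_apply, evalCochain_detCochain]
    change detCochain T.1 (fun i => substHam (mat2 x 0 0 y)
      (hamMonomial (monoTuple S.1 i).toExpo)) = _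
    have : (fun i => substHam (mat2 x 0 0 y) (hamMonomial (monoTuple S.1 i).toExpo)) =
        fun i => (x ^ (monoTuple S.1 i).qdeg * y ^ (monoTuple S.1 i).pdeg) •
          hamMonomial (monoTuple S.1 i).toExpo := by
      funext i
      exact substHam_diag_hamMonomial _ _ _ _ (by rw [MonoIndex.qdeg_add_pdeg]; omega)
    rw [this, ContinuousAlternatingMap.map_smul_univ, detCochain_monoTuple,
      Finset.prod_mul_distrib, Finset.prod_pow_eq_pow_sum, Finset.prod_pow_eq_pow_sum,
      sum_monoTuple S.1 MonoIndex.qdeg, sum_monoTuple S.1 MonoIndex.pdeg, Pi.single_apply]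
    simp only [Subtype.ext_iff]
    split_ifs with h
    · rw [h]
    · simp

instance (m w : ℕ) : FiniteDimensional ℝ (basicCochain m w) :=
  Module.Finite.of_basis (cochainBasis (le_refl w))

theorem finiteDimensional_relCochain (m w : ℕ) : FiniteDimensional ℝ (relCochain 1 m w) :=
  Module.Finite.of_injective (Submodule.inclusion (relCochain_le m w))
    (Submodule.inclusion_injective _)

/-- The dimension of a relative cochain space as the difference of the multiplicities of the
weights `0` and `2` in the space spanned by exterior monomials. -/
theorem finrank_relCochain {N m w : ℕ} (hN : w ≤ N) :
    finrank ℝ (relCochain 1 m w) +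
      Fintype.card {T : CochainIndex N m w // ∑ u ∈ T.1.1, u.qdeg = ∑ u ∈ T.1.1, u.pdeg + 2} =
      Fintype.card {T : CochainIndex N m w // ∑ u ∈ T.1.1, u.qdeg = ∑ u ∈ T.1.1, u.pdeg} := by
  have h := (isSmoothRep_cochainRep (m := m) hN).finrank_invariants
    ((relCochain 1 m w).comap (basicCochain m w).subtype) mem_relCochain_iff
  rwa [LinearEquiv.finrank_eq (Submodule.comapSubtypeEquivOfLe (relCochain_le m w))] at h

/-- Every monomial of degree at least `3` has weight at least `1`, so `m` of them have weight at
least `m`. -/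
theorem relCochain_eq_bot {m w : ℕ} (h : w < m) : relCochain 1 m w = ⊥ := by
  rw [Submodule.eq_bot_iff]
  intro σ hσ
  have : (⟨σ, relCochain_le m w hσ⟩ : basicCochain m w) = 0 := by
    refine evalCochain_injective (le_refl w) (funext fun T => ?_)
    exfalso
    have h1 : ∑ u ∈ T.1.1, 1 ≤ ∑ u ∈ T.1.1, u.wt :=
      Finset.sum_le_sum fun u _ => Nat.le_add_left 1 _
    rw [T.2, Finset.sum_const, smul_eq_mul, mul_one, T.1.2] at h1
    omega
  exact congrArg Subtype.val this

end RelCochain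

/-! ### Counting sets of monomials -/

section Count

open Module

/-- Families of sets of monomials of degrees `3, …, s + 2`; `a ∈ F j` stands for
`q ^ a * p ^ (j + 3 - a)`. -/
abbrev Family (s : ℕ) : Type := ∀ j : Fin s, Finset (Fin ((j : ℕ) + 3 + 1))

/-- The total degree in `q`. -/
def Family.qdeg {s : ℕ} (F : Family s) : ℕ := ∑ j, ∑ a ∈ F j, (a : ℕ)

/-- The number of families with `k j` monomials of degree `j + 3` whose degree in `q` exceeds the
degree in `p` by `c`. -/
def typeCount {s : ℕ} (k : Fin s → ℕ) (c : ℕ) : ℕ :=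
  Fintype.card {F : Family s // (∀ j, (F j).card = k j) ∧
    2 * F.qdeg = ∑ j : Fin s, ((j : ℕ) + 3) * k j + c}

/-- The number of families of `m` monomials of total weight `w` whose degree in `q` exceeds the
degree in `p` by `c`. -/
def familyCount (N m w c : ℕ) : ℕ :=
  Fintype.card {F : Family N // ∑ j, (F j).card = m ∧ ∑ j : Fin N, ((j : ℕ) + 1) * (F j).card = w ∧
    2 * F.qdeg = w + 2 * m + c}

theorem Family.qdeg_add_pdeg {s : ℕ} (F : Family s) :
    F.qdeg + ∑ j, ∑ a ∈ F j, ((j : ℕ) + 3 - a) = ∑ j : Fin s, ((j : ℕ) + 3) * (F j).card := by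
  rw [qdeg, ← Finset.sum_add_distrib]
  refine Finset.sum_congr rfl fun j _ => ?_
  rw [← Finset.sum_add_distrib, mul_comm, ← smul_eq_mul, ← Finset.sum_const]
  exact Finset.sum_congr rfl fun a _ => by have := a.2; omega

/-- The multiplicity of the trivial representation as a difference of numbers of families. -/
theorem trivMult_eq_typeCount {s : ℕ} (k : Fin s → ℕ) :
    trivMult (typeRep 1 k) + typeCount k 2 = typeCount k 0 := by
  have h : ∀ c, Fintype.card {S : TypeIndex k // ∑ i, ∑ a ∈ (S i).1, (a : ℕ) =
      ∑ i, ∑ a ∈ (S i).1, ((i : ℕ) + 3 - a) + c} = typeCount k c := by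
    intro c
    have hc : ∀ F : Family s, (∀ j, (F j).card = k j) →
        (∑ i, ∑ a ∈ F i, (a : ℕ) = ∑ i, ∑ a ∈ F i, ((i : ℕ) + 3 - a) + c ↔
          2 * F.qdeg = ∑ j : Fin s, ((j : ℕ) + 3) * k j + c) := by
      intro F hF
      have := F.qdeg_add_pdeg
      simp only [hF] at this
      rw [← this]
      simp only [Family.qdeg]
      omega
    exact Fintype.card_congr
      { toFun := fun S => ⟨fun i => (S.1 i).1, fun i => (S.1 i).2,
          (hc _ fun i => (S.1 i).2).1 S.2⟩
        invFun := fun F => ⟨fun i => ⟨F.1 i, F.2.1 i⟩, (hc _ F.2.1).2 F.2.2⟩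
        left_inv := fun _ => rfl
        right_inv := fun _ => rfl }
  rw [← h 2, ← h 0]
  exact trivMult_typeRep k

/-- The monomial `q ^ a * p ^ (j + 3 - a)`. -/
def MonoIndex.mk {N : ℕ} (j : Fin N) (a : Fin ((j : ℕ) + 3 + 1)) : MonoIndex N := ⟨j, a⟩

/-- A set of monomials is the family of its parts of given degree. -/
noncomputable def finsetEquivFamily (N : ℕ) : Finset (MonoIndex N) ≃ Family N where
  toFun T j := Finset.univ.filter fun a => MonoIndex.mk j a ∈ T
  invFun F := Finset.univ.sigma F
  left_inv T := by
    ext ⟨j, a⟩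
    refine Finset.mem_sigma.trans ?_
    simp only [Finset.mem_univ, true_and, Finset.mem_filter]
    rfl
  right_inv F := by
    funext j
    ext a
    simp only [Finset.mem_filter, Finset.mem_univ, true_and]
    exact Finset.mem_sigma.trans (and_iff_right (Finset.mem_univ _))

theorem sum_eq_sum_family {N : ℕ} (T : Finset (MonoIndex N)) (f : MonoIndex N → ℕ) :
    ∑ u ∈ T, f u = ∑ j, ∑ a ∈ finsetEquivFamily N T j, f ⟨j, a⟩ := by
  conv_lhs => rw [← (finsetEquivFamily N).symm_apply_apply T]
  exact Finset.sum_sigma Finset.univ (finsetEquivFamily N T) f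

/-- The dimension of a relative cochain space as a difference of numbers of families. Any bound
`N ≥ w` on the weights of the monomials gives the same numbers; a common `N` for several `w` allows
for one generating function. -/
theorem finrank_eq_familyCount {N m w : ℕ} (hN : w ≤ N) :
    finrank ℝ (relCochain 1 m w) + familyCount N m w 2 = familyCount N m w 0 := by
  have h : ∀ c, Fintype.card {T : CochainIndex N m w // ∑ u ∈ T.1.1, u.qdeg =
      ∑ u ∈ T.1.1, u.pdeg + c} = familyCount N m w c := by
    intro c
    have e1 : {T : CochainIndex N m w // ∑ u ∈ T.1.1, u.qdeg = ∑ u ∈ T.1.1, u.pdeg + c} ≃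
        {T : Finset (MonoIndex N) // T.card = m ∧ ∑ u ∈ T, u.wt = w ∧
          ∑ u ∈ T, u.qdeg = ∑ u ∈ T, u.pdeg + c} :=
      { toFun := fun T => ⟨T.1.1.1, T.1.1.2, T.1.2, T.2⟩
        invFun := fun T => ⟨⟨⟨T.1, T.2.1⟩, T.2.2.1⟩, T.2.2.2⟩
        left_inv := fun _ => rfl
        right_inv := fun _ => rfl }
    refine Fintype.card_congr (e1.trans (Equiv.subtypeEquiv (finsetEquivFamily N) fun T => ?_))
    have h1 : T.card = ∑ j, (finsetEquivFamily N T j).card := by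
      rw [Finset.card_eq_sum_ones, sum_eq_sum_family]
      simp
    have h2 : ∑ u ∈ T, u.wt = ∑ j : Fin N, ((j : ℕ) + 1) * (finsetEquivFamily N T j).card := by
      rw [sum_eq_sum_family]
      refine Finset.sum_congr rfl fun j _ => ?_
      rw [mul_comm, ← smul_eq_mul, ← Finset.sum_const]
      rfl
    have h3 : ∑ u ∈ T, u.qdeg = (finsetEquivFamily N T).qdeg := sum_eq_sum_family _ _
    have h4 : ∑ u ∈ T, u.qdeg + ∑ u ∈ T, u.pdeg = ∑ u ∈ T, u.wt + 2 * T.card := by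
      rw [← Finset.sum_add_distrib, Finset.sum_congr rfl fun u _ => u.qdeg_add_pdeg,
        Finset.sum_add_distrib, Finset.sum_const, smul_eq_mul, mul_comm]
    rw [← h1, ← h2, ← h3]
    refine and_congr_right fun hm => and_congr_right fun hw => ?_
    rw [hm, hw] at h4
    omega
  rw [← h 2, ← h 0]
  exact finrank_relCochain hN

theorem mem_types {m w : ℕ} {k : Fin w → ℕ} : k ∈ types m w ↔
    ∑ i, k i = m ∧ ∑ i : Fin w, ((i : ℕ) + 1) * k i = w := by
  simp [types, Finset.mem_piAntidiag]

/-- Families are sorted by their type, the sequence of the numbers of members of given degree. -/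
theorem sum_typeCount (m w c : ℕ) :
    ∑ k ∈ types m w, typeCount k c = familyCount w m w c := by
  classical
  rw [familyCount, Fintype.card_subtype]
  rw [Finset.card_eq_sum_card_fiberwise (f := fun F : Family w => fun j => (F j).card)
    (t := types m w)]
  · refine Finset.sum_congr rfl fun k hk => ?_
    rw [mem_types] at hk
    rw [typeCount, Fintype.card_subtype, Finset.filter_filter]
    congr 1
    refine Finset.filter_congr fun F _ => ?_
    -- the degree is the weight plus `2` for every member
    have h1 : ∑ j : Fin w, ((j : ℕ) + 3) * k j = w + 2 * m := by
      have : ∀ j : Fin w, ((j : ℕ) + 3) * k j = ((j : ℕ) + 1) * k j + 2 * k j := fun j => by ring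
      rw [Finset.sum_congr rfl fun j _ => this j, Finset.sum_add_distrib, ← Finset.mul_sum,
        hk.1, hk.2]
    rw [h1]
    constructor
    · rintro ⟨hF, hc⟩
      simp only [hF]
      exact ⟨⟨hk.1, hk.2, hc⟩, trivial⟩
    · rintro ⟨⟨_, _, hc⟩, hF⟩
      exact ⟨fun j => congrFun hF j, hc⟩
  · intro F hF
    rw [Finset.mem_coe, Finset.mem_filter] at hF
    exact mem_types.2 ⟨hF.2.1, hF.2.2.1⟩

theorem finrank_relCochain_eq_sum (m w : ℕ) :
    finrank ℝ (relCochain 1 m w) = ∑ k ∈ types m w, trivMult (typeRep 1 k) := by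
  have h := finrank_eq_familyCount (m := m) (le_refl w)
  rw [← sum_typeCount, ← sum_typeCount,
    Finset.sum_congr rfl fun k _ => (trivMult_eq_typeCount k).symm, Finset.sum_add_distrib] at h
  omega

end Count

/-! ### Reading off coefficients as digits -/

section Digit

/-- The digit of `x` at position `E` in base `B`. -/
def digit (B E x : ℕ) : ℕ := x / B ^ E % B

/-- The part of a digit expansion below position `E` is less than `B ^ E`. -/
theorem sum_lt_pow {T : Type*} (s : Finset T) (v e : T → ℕ) (B : ℕ) (E : ℕ)
    (h : ∀ i < E, ∑ t ∈ s with e t = i, v t < B) :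
    ∑ t ∈ s with e t < E, v t * B ^ e t < B ^ E := by
  induction E with
  | zero => simp
  | succ E ih =>
    have h1 := ih fun i hi => h i (by omega)
    have h2 := h E (by omega)
    have h3 : ∑ t ∈ s with e t < E + 1, v t * B ^ e t =
        ∑ t ∈ s with e t < E, v t * B ^ e t + (∑ t ∈ s with e t = E, v t) * B ^ E := by
      classical
      have : s.filter (fun t => e t < E + 1) =
          (s.filter fun t => e t < E) ∪ (s.filter fun t => e t = E) := by
        ext t
        simp only [Finset.mem_filter, Finset.mem_union, Nat.lt_succ_iff_lt_or_eq, and_or_left]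
      rw [this, Finset.sum_union, Finset.sum_mul]
      · congr 1
        exact Finset.sum_congr rfl fun t ht => by rw [(Finset.mem_filter.1 ht).2]
      · exact Finset.disjoint_filter.2 fun t _ h1 h2 => by omega
    rw [h3, pow_succ]
    calc _ < B ^ E + (∑ t ∈ s with e t = E, v t) * B ^ E := by omega
      _ = (∑ t ∈ s with e t = E, v t + 1) * B ^ E := by ring
      _ ≤ B * B ^ E := Nat.mul_le_mul_right _ h2
      _ = B ^ E * B := mul_comm _ _

/-- The digits of a sum of powers of `B` are the multiplicities of the exponents, as long as these
are smaller than `B`. -/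
theorem digit_sum {T : Type*} (s : Finset T) (v e : T → ℕ) (B E : ℕ)
    (h : ∀ i ≤ E, ∑ t ∈ s with e t = i, v t < B) :
    digit B E (∑ t ∈ s, v t * B ^ e t) = ∑ t ∈ s with e t = E, v t := by
  classical
  have h1 := sum_lt_pow s v e B E fun i hi => h i hi.le
  have h2 := h E le_rfl
  have h3 : ∑ t ∈ s with e t = E, v t * B ^ e t = (∑ t ∈ s with e t = E, v t) * B ^ E := by
    rw [Finset.sum_mul]
    exact Finset.sum_congr rfl fun t ht => by rw [(Finset.mem_filter.1 ht).2]
  obtain ⟨R, hR⟩ : B ^ (E + 1) ∣ ∑ t ∈ s with E < e t, v t * B ^ e t :=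
    Finset.dvd_sum fun t ht => Dvd.dvd.mul_left (pow_dvd_pow _ (Finset.mem_filter.1 ht).2) _
  have h4 : ∑ t ∈ s, v t * B ^ e t = ∑ t ∈ s with e t < E, v t * B ^ e t +
      B ^ E * (∑ t ∈ s with e t = E, v t + B * R) := by
    have : s = (s.filter fun t => e t < E) ∪ ((s.filter fun t => e t = E) ∪
        (s.filter fun t => E < e t)) := by
      ext t
      simp only [Finset.mem_filter, Finset.mem_union]
      have := lt_trichotomy (e t) E
      tauto
    conv_lhs => rw [this]
    rw [Finset.sum_union, Finset.sum_union, h3, hR]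
    · ring
    · exact Finset.disjoint_filter.2 fun t _ h1 h2 => by omega
    · exact Finset.disjoint_union_right.2 ⟨Finset.disjoint_filter.2 fun t _ h1 h2 => by omega,
        Finset.disjoint_filter.2 fun t _ h1 h2 => by omega⟩
  have hpos : 0 < B ^ E := Nat.zero_lt_of_lt h1
  rw [digit, h4, Nat.add_mul_div_left _ _ hpos, Nat.div_eq_of_lt h1, zero_add,
    Nat.add_mul_mod_self_left, Nat.mod_eq_of_lt h2]

theorem digit_mod {B E M : ℕ} (h : E < M) (x : ℕ) : digit B E (x % B ^ M) = digit B E x := by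
  obtain ⟨d, rfl⟩ := Nat.exists_eq_add_of_lt h
  rw [digit, digit, show E + d + 1 = E + (d + 1) by ring, pow_add, Nat.mod_mul_right_div_self,
    pow_succ, mul_comm (B ^ d) B, Nat.mod_mul_right_mod]

theorem prod_one_add_pow {α : Type*} [DecidableEq α] (s : Finset α) (e : α → ℕ) (B : ℕ) :
    ∏ a ∈ s, (1 + B ^ e a) = ∑ S ∈ s.powerset, B ^ ∑ a ∈ S, e a := by
  rw [Finset.prod_one_add]
  exact Finset.sum_congr rfl fun S _ => Finset.prod_pow_eq_pow_sum _ _ _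

/-- The Gaussian binomial coefficient, as the sum of `B ^ ∑ a ∈ S, a` over the subsets `S` of size
`k` of `{0, …, n - 1}`: the coefficient of `C ^ k` in `∏ a, (1 + C * B ^ a)`. -/
def gauss (B n k : ℕ) : ℕ :=
  digit (∏ a ∈ Finset.range n, (1 + B ^ a) + 1) k
    (∏ a ∈ Finset.range n, (1 + (∏ a ∈ Finset.range n, (1 + B ^ a) + 1) * B ^ a))

/-- The base `C` of the digit expansion in `gauss` exceeds the sum of all coefficients. -/
theorem gauss_eq (B n k : ℕ) :
    gauss B n k = ∑ S : Finset (Fin n) with S.card = k, B ^ ∑ a ∈ S, (a : ℕ) := by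
  set C := ∏ a ∈ Finset.range n, (1 + B ^ a) + 1 with hC
  have h1 : ∏ a ∈ Finset.range n, (1 + B ^ a) = ∑ S : Finset (Fin n), B ^ ∑ a ∈ S, (a : ℕ) := by
    rw [← Fin.prod_univ_eq_prod_range (fun a => 1 + B ^ a), prod_one_add_pow,
      Finset.powerset_univ]
  have h2 : ∏ a ∈ Finset.range n, (1 + C * B ^ a) =
      ∑ S : Finset (Fin n), (B ^ ∑ a ∈ S, (a : ℕ)) * C ^ S.card := by
    rw [← Fin.prod_univ_eq_prod_range (fun a => 1 + C * B ^ a), Finset.prod_one_add,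
      Finset.powerset_univ]
    refine Finset.sum_congr rfl fun S _ => ?_
    rw [Finset.prod_mul_distrib, Finset.prod_const, Finset.prod_pow_eq_pow_sum, mul_comm]
  rw [gauss, ← hC, h2]
  refine digit_sum _ _ _ _ _ fun i _ => ?_
  rw [hC, h1]
  exact Nat.lt_succ_of_le (Finset.sum_le_sum_of_subset (Finset.filter_subset _ _))

/-- The digit that counts the families of type `k` of weight `c`, in base `B`. -/
theorem typeCount_eq_digit {s : ℕ} (k : Fin s → ℕ) (c B A : ℕ)
    (hB : 2 ^ ∑ j ∈ Finset.range s, (j + 4) < B)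
    (hA : 2 * A = ∑ j : Fin s, ((j : ℕ) + 3) * k j + c) :
    typeCount k c = digit B A (∏ j : Fin s, gauss B ((j : ℕ) + 4) (k j)) := by
  classical
  have h1 : ∏ j : Fin s, gauss B ((j : ℕ) + 4) (k j) =
      ∑ F ∈ Fintype.piFinset fun j : Fin s =>
        (Finset.univ : Finset (Finset (Fin ((j : ℕ) + 3 + 1)))).filter fun S => S.card = k j,
        1 * B ^ Family.qdeg F := by
    simp only [gauss_eq]
    rw [Finset.prod_univ_sum]
    refine Finset.sum_congr rfl fun F _ => ?_
    rw [Finset.prod_pow_eq_pow_sum, one_mul, Family.qdeg]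
  have hcard : Fintype.card (Family s) = 2 ^ ∑ j ∈ Finset.range s, (j + 4) := by
    rw [Fintype.card_pi, ← Finset.prod_pow_eq_pow_sum,
      ← Fin.prod_univ_eq_prod_range (fun j => 2 ^ (j + 4))]
    exact Finset.prod_congr rfl fun j _ => by rw [Fintype.card_finset, Fintype.card_fin]
  rw [h1, digit_sum]
  · rw [typeCount, Fintype.card_subtype, Finset.card_eq_sum_ones]
    refine Finset.sum_congr ?_ fun _ _ => rfl
    ext F
    simp only [Finset.mem_filter, Finset.mem_univ, true_and, Fintype.mem_piFinset]
    refine and_congr_right fun _ => ?_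
    omega
  · intro i _
    refine lt_of_le_of_lt ?_ hB
    rw [← hcard, ← Finset.card_eq_sum_ones]
    exact Finset.card_le_univ _

/-- The degree in `q` and the degree in `p` differ by a number of the parity of the total degree. -/
theorem typeCount_eq_zero {s : ℕ} (k : Fin s → ℕ) (c : ℕ)
    (hA : (∑ j : Fin s, ((j : ℕ) + 3) * k j + c) % 2 = 1) : typeCount k c = 0 := by
  rw [typeCount, Fintype.card_eq_zero_iff]
  exact ⟨fun F => by have := F.2.2; omega⟩

/-- The generating number of all sets of monomials of degrees `3, …, N + 2`: the exponent of `B`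
records the degree in `q`, the number and the weight as digits in the mixed radix `Q₁, Q₂`. -/
def genNumber (B Q₁ Q₂ N : ℕ) : ℕ :=
  ∏ j ∈ Finset.range N, ∏ a ∈ Finset.range (j + 4), (1 + B ^ (a + Q₁ + Q₁ * Q₂ * (j + 1)))

/-- The exponent contributed by a family to `genNumber`. -/
def Family.code (Q₁ Q₂ : ℕ) {N : ℕ} (F : Family N) : ℕ :=
  ∑ j : Fin N, ∑ a ∈ F j, ((a : ℕ) + Q₁ + Q₁ * Q₂ * ((j : ℕ) + 1))

theorem genNumber_eq (B Q₁ Q₂ N : ℕ) :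
    genNumber B Q₁ Q₂ N = ∑ F : Family N, 1 * B ^ F.code Q₁ Q₂ := by
  classical
  rw [genNumber, ← Fin.prod_univ_eq_prod_range
    (fun j => ∏ a ∈ Finset.range (j + 4), (1 + B ^ (a + Q₁ + Q₁ * Q₂ * (j + 1))))]
  have : ∀ j : Fin N, ∏ a ∈ Finset.range ((j : ℕ) + 4),
      (1 + B ^ (a + Q₁ + Q₁ * Q₂ * ((j : ℕ) + 1))) =
      ∑ S : Finset (Fin ((j : ℕ) + 3 + 1)),
        B ^ ∑ a ∈ S, ((a : ℕ) + Q₁ + Q₁ * Q₂ * ((j : ℕ) + 1)) := by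
    intro j
    rw [← Fin.prod_univ_eq_prod_range
      (fun a => 1 + B ^ (a + Q₁ + Q₁ * Q₂ * ((j : ℕ) + 1))), prod_one_add_pow,
      Finset.powerset_univ]
  rw [Finset.prod_congr rfl fun j _ => this j, Finset.prod_univ_sum, Fintype.piFinset_univ]
  refine Finset.sum_congr rfl fun F _ => ?_
  rw [Finset.prod_pow_eq_pow_sum, one_mul, Family.code]

theorem Family.code_eq (Q₁ Q₂ : ℕ) {N : ℕ} (F : Family N) :
    F.code Q₁ Q₂ = F.qdeg + Q₁ * ∑ j, (F j).card +
      Q₁ * Q₂ * ∑ j : Fin N, ((j : ℕ) + 1) * (F j).card := by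
  simp only [code, qdeg, Finset.sum_add_distrib, Finset.sum_const, smul_eq_mul, Finset.mul_sum]
  congr 1
  · congr 1
    exact Finset.sum_congr rfl fun j _ => mul_comm _ _
  · exact Finset.sum_congr rfl fun j _ => by ring

theorem Family.card_le {N : ℕ} (F : Family N) :
    ∑ j, (F j).card ≤ ∑ j : Fin N, ((j : ℕ) + 1) * (F j).card :=
  Finset.sum_le_sum fun j _ => Nat.le_mul_of_pos_left _ (by omega)

theorem Family.qdeg_le {N : ℕ} (F : Family N) :
    F.qdeg ≤ 3 * ∑ j : Fin N, ((j : ℕ) + 1) * (F j).card := by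
  rw [qdeg, Finset.mul_sum]
  refine Finset.sum_le_sum fun j _ => ?_
  calc ∑ a ∈ F j, (a : ℕ) ≤ ∑ _a ∈ F j, 3 * ((j : ℕ) + 1) :=
        Finset.sum_le_sum fun a _ => by have := a.2; omega
    _ = 3 * (((j : ℕ) + 1) * (F j).card) := by rw [Finset.sum_const, smul_eq_mul]; ring

theorem Family.wt_le_of_code_lt {Q₁ Q₂ w N : ℕ} (F : Family N)
    (h : F.code Q₁ Q₂ < Q₁ * Q₂ * (w + 1)) : ∑ j : Fin N, ((j : ℕ) + 1) * (F j).card ≤ w := by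
  rw [code_eq] at h
  by_contra! hw
  have := Nat.mul_le_mul_left (Q₁ * Q₂) hw
  rw [Nat.succ_eq_add_one] at this
  omega

theorem code_lt {Q₁ Q₂ m w A : ℕ} (hA : A < Q₁) (hm : m < Q₂) :
    A + Q₁ * m + Q₁ * Q₂ * w < Q₁ * Q₂ * (w + 1) := by
  have := Nat.mul_le_mul_left Q₁ hm
  rw [Nat.succ_eq_add_one, mul_add, mul_one] at this
  rw [mul_add, mul_one]
  omega

/-- The code of a family determines its degree in `q`, its number of members and its weight, as long
as the first two are below the radices. -/
theorem Family.code_eq_iff {Q₁ Q₂ m w A N : ℕ}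
    (hF : ∀ F : Family N, ∑ j : Fin N, ((j : ℕ) + 1) * (F j).card ≤ w →
      F.qdeg < Q₁ ∧ ∑ j, (F j).card < Q₂)
    (hA : A < Q₁) (hm : m < Q₂) (F : Family N) : F.code Q₁ Q₂ = A + Q₁ * m + Q₁ * Q₂ * w ↔
      ∑ j, (F j).card = m ∧ ∑ j : Fin N, ((j : ℕ) + 1) * (F j).card = w ∧ F.qdeg = A := by
  constructor
  · intro h
    -- the weight is the leading digit, so it is bounded without knowledge of the lower digits
    have hw := F.wt_le_of_code_lt (h ▸ code_lt hA hm)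
    obtain ⟨hq, hc⟩ := hF F hw
    rw [code_eq] at h
    generalize ∑ j, (F j).card = m' at *
    generalize ∑ j : Fin N, ((j : ℕ) + 1) * (F j).card = w' at *
    generalize F.qdeg = A' at *
    have e1 : A' = A := by
      have := congrArg (· % Q₁) h
      simp only [mul_assoc, Nat.add_mul_mod_self_left] at this
      rwa [Nat.mod_eq_of_lt (by omega), Nat.mod_eq_of_lt hA] at this
    subst e1
    have e2 : m' + Q₂ * w' = m + Q₂ * w := by
      refine Nat.eq_of_mul_eq_mul_left (show 0 < Q₁ by omega) ?_
      rw [mul_add, mul_add, ← mul_assoc, ← mul_assoc]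
      omega
    have e3 : m' = m := by
      have := congrArg (· % Q₂) e2
      simp only [Nat.add_mul_mod_self_left] at this
      rwa [Nat.mod_eq_of_lt (by omega), Nat.mod_eq_of_lt hm] at this
    subst e3
    exact ⟨rfl, Nat.eq_of_mul_eq_mul_left (show 0 < Q₂ by omega) (by omega), rfl⟩
  · rintro ⟨rfl, rfl, rfl⟩
    rw [code_eq]

/-- The digit that counts the families of `m` monomials of weight `w` whose degree in `q` exceeds the
degree in `p` by `c`: such a family has degree `A` in `q`, as the total degree is `w + 2 * m`. -/
theorem familyCount_eq_digit {B Q₁ Q₂ m w A N c : ℕ}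
    (hF : ∀ F : Family N, ∑ j : Fin N, ((j : ℕ) + 1) * (F j).card ≤ w →
      F.qdeg < Q₁ ∧ ∑ j, (F j).card < Q₂)
    (hA : A < Q₁) (hm : m < Q₂) (hc : 2 * A = w + 2 * m + c)
    (hB : ∀ i ≤ A + Q₁ * m + Q₁ * Q₂ * w,
      (Finset.univ.filter fun F : Family N => F.code Q₁ Q₂ = i).card < B) :
    familyCount N m w c = digit B (A + Q₁ * m + Q₁ * Q₂ * w) (genNumber B Q₁ Q₂ N) := by
  rw [genNumber_eq, digit_sum]
  · rw [familyCount, Fintype.card_subtype, Finset.card_eq_sum_ones]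
    refine Finset.sum_congr (Finset.filter_congr fun F _ => ?_) fun _ _ => rfl
    rw [Family.code_eq_iff hF hA hm]
    refine and_congr_right fun _ => and_congr_right fun _ => ?_
    omega
  · intro i hi
    rw [← Finset.card_eq_sum_ones]
    exact hB i hi

theorem familyCount_eq_zero {N m w c : ℕ} (h : (w + 2 * m + c) % 2 = 1) :
    familyCount N m w c = 0 := by
  rw [familyCount, Fintype.card_eq_zero_iff]
  exact ⟨fun F => by have := F.2.2.2; omega⟩

theorem card_family (N : ℕ) :
    Fintype.card (Family N) = 2 ^ ∑ j ∈ Finset.range N, (j + 4) := by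
  rw [Fintype.card_pi, ← Finset.prod_pow_eq_pow_sum,
    ← Fin.prod_univ_eq_prod_range (fun j => 2 ^ (j + 4))]
  exact Finset.prod_congr rfl fun j _ => by rw [Fintype.card_finset, Fintype.card_fin]

end Digit

/-! ### Computability -/

section Computability

variable {α : Type*} [Primcodable α]

theorem primrec_sum_range {n : α → ℕ} {f : α → ℕ → ℕ} (hn : Primrec n) (hf : Primrec₂ f) :
    Primrec fun a => ∑ i ∈ Finset.range (n a), f a i := by
  refine (Primrec.nat_rec' (h := fun a p => p.2 + f a p.1) hn (Primrec.const 0)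
    (Primrec.nat_add.comp (Primrec.snd.comp Primrec.snd)
      (hf.comp Primrec.fst (Primrec.fst.comp Primrec.snd)))).of_eq fun a => ?_
  induction n a with
  | zero => rfl
  | succ k ih => rw [Finset.sum_range_succ, ← ih]

theorem primrec_prod_range {n : α → ℕ} {f : α → ℕ → ℕ} (hn : Primrec n) (hf : Primrec₂ f) :
    Primrec fun a => ∏ i ∈ Finset.range (n a), f a i := by
  refine (Primrec.nat_rec' (h := fun a p => p.2 * f a p.1) hn (Primrec.const 1)
    (Primrec.nat_mul.comp (Primrec.snd.comp Primrec.snd)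
      (hf.comp Primrec.fst (Primrec.fst.comp Primrec.snd)))).of_eq fun a => ?_
  induction n a with
  | zero => rfl
  | succ k ih => rw [Finset.prod_range_succ, ← ih]

theorem primrec_pow {f g : α → ℕ} (hf : Primrec f) (hg : Primrec g) :
    Primrec fun a => f a ^ g a :=
  (Primrec₂.unpaired'.1 Nat.Primrec.pow).comp hf hg

theorem primrec_add {f g : α → ℕ} (hf : Primrec f) (hg : Primrec g) :
    Primrec fun a => f a + g a := Primrec.nat_add.comp hf hg

theorem primrec_sub {f g : α → ℕ} (hf : Primrec f) (hg : Primrec g) :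
    Primrec fun a => f a - g a := Primrec.nat_sub.comp hf hg

theorem primrec_mul {f g : α → ℕ} (hf : Primrec f) (hg : Primrec g) :
    Primrec fun a => f a * g a := Primrec.nat_mul.comp hf hg

theorem primrec_div {f g : α → ℕ} (hf : Primrec f) (hg : Primrec g) :
    Primrec fun a => f a / g a := Primrec.nat_div.comp hf hg

theorem primrec_mod {f g : α → ℕ} (hf : Primrec f) (hg : Primrec g) :
    Primrec fun a => f a % g a := Primrec.nat_mod.comp hf hg

theorem primrec_digit {B E x : α → ℕ} (hB : Primrec B) (hE : Primrec E) (hx : Primrec x) :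
    Primrec fun a => digit (B a) (E a) (x a) :=
  primrec_mod (primrec_div hx (primrec_pow hB hE)) hB

theorem primrec_gauss {B n k : α → ℕ} (hB : Primrec B) (hn : Primrec n) (hk : Primrec k) :
    Primrec fun a => gauss (B a) (n a) (k a) := by
  have h : Primrec fun a => ∏ i ∈ Finset.range (n a), (1 + B a ^ i) + 1 :=
    primrec_add (primrec_prod_range hn (primrec_add (Primrec.const 1)
      (primrec_pow (hB.comp Primrec.fst) Primrec.snd))) (Primrec.const 1)
  exact primrec_digit h hk (primrec_prod_range hn (primrec_add (Primrec.const 1)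
    (primrec_mul (h.comp Primrec.fst) (primrec_pow (hB.comp Primrec.fst) Primrec.snd))))

theorem primrec_genNumber {B Q₁ Q₂ N : α → ℕ} (hB : Primrec B) (h1 : Primrec Q₁)
    (h2 : Primrec Q₂) (hN : Primrec N) :
    Primrec fun a => genNumber (B a) (Q₁ a) (Q₂ a) (N a) := by
  have pf {β γ : Type _} [Primcodable β] [Primcodable γ] {f : α → ℕ} (hf : Primrec f) :
      Primrec fun p : (α × β) × γ => f p.1.1 := hf.comp (Primrec.fst.comp Primrec.fst)
  refine primrec_prod_range hN (primrec_prod_range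
    (primrec_add Primrec.snd (Primrec.const 4)) ?_)
  exact primrec_add (Primrec.const 1) (primrec_pow (pf hB) (primrec_add
    (primrec_add Primrec.snd (pf h1)) (primrec_mul (primrec_mul (pf h1) (pf h2))
      (primrec_add (Primrec.snd.comp Primrec.fst) (Primrec.const 1)))))

theorem primrec_sum_add_four {s : α → ℕ} (hs : Primrec s) :
    Primrec fun a => 2 ^ (∑ j ∈ Finset.range (s a), (j + 4)) + 1 :=
  primrec_add (primrec_pow (Primrec.const 2) (primrec_sum_range hs
    (primrec_add Primrec.snd (Primrec.const 4)))) (Primrec.const 1)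

theorem primrec_intCast_sub {f g : α → ℕ} (hf : Primrec f) (hg : Primrec g) :
    Primrec fun a => (f a : ℤ) - g a := by
  refine Primrec.encode_iff.1 ((Primrec.ite (Primrec.nat_le.comp hg hf)
    (primrec_mul (Primrec.const 2) (primrec_sub hf hg))
    (primrec_add (primrec_mul (Primrec.const 2) (primrec_sub (primrec_sub hg hf)
      (Primrec.const 1))) (Primrec.const 1))).of_eq fun a => ?_)
  -- integers are encoded by `n ↦ 2 * n` and `-(n + 1) ↦ 2 * n + 1`
  change _ = Equiv.intEquivNat ((f a : ℤ) - g a)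
  split_ifs with h
  · rw [← Nat.cast_sub h]
    rfl
  · obtain ⟨n, hn⟩ := Nat.exists_eq_add_of_lt (not_le.1 h)
    rw [hn, show ((f a : ℤ) - ((f a + n + 1 : ℕ) : ℤ)) = Int.negSucc n by
      rw [Int.negSucc_eq]; push_cast; ring, show f a + n + 1 - f a - 1 = n by omega]
    rfl

/-- The multiplicity of a type is computed by a digit expansion. -/
theorem typeCount_get_eq (k : List ℕ) (c : ℕ) :
    typeCount k.get c =
      (1 - (∑ j ∈ Finset.range k.length, (j + 3) * k.getD j 0 + c) % 2) *
        digit (2 ^ (∑ j ∈ Finset.range k.length, (j + 4)) + 1)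
          ((∑ j ∈ Finset.range k.length, (j + 3) * k.getD j 0 + c) / 2)
          (∏ j ∈ Finset.range k.length,
            gauss (2 ^ (∑ j ∈ Finset.range k.length, (j + 4)) + 1) (j + 4) (k.getD j 0)) := by
  have h1 : ∑ j ∈ Finset.range k.length, (j + 3) * k.getD j 0 =
      ∑ j : Fin k.length, ((j : ℕ) + 3) * k.get j := by
    rw [← Fin.sum_univ_eq_sum_range (fun j => (j + 3) * k.getD j 0)]
    exact Finset.sum_congr rfl fun j _ => by simp
  have h2 : ∀ B, ∏ j ∈ Finset.range k.length, gauss B (j + 4) (k.getD j 0) =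
      ∏ j : Fin k.length, gauss B ((j : ℕ) + 4) (k.get j) := by
    intro B
    rw [← Fin.prod_univ_eq_prod_range (fun j => gauss B (j + 4) (k.getD j 0))]
    exact Finset.prod_congr rfl fun j _ => by simp
  rw [h1, h2]
  rcases Nat.mod_two_eq_zero_or_one (∑ j : Fin k.length, ((j : ℕ) + 3) * k.get j + c) with h | h
  · rw [h, typeCount_eq_digit k.get c _
      ((∑ j : Fin k.length, ((j : ℕ) + 3) * k.get j + c) / 2) (Nat.lt_succ_self _) (by omega),
      Nat.sub_zero, one_mul]
  · rw [h, typeCount_eq_zero k.get c h, Nat.sub_self, zero_mul]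

theorem primrec_typeCount (c : ℕ) : Primrec fun k : List ℕ => typeCount k.get c := by
  have hl : Primrec (List.length : List ℕ → ℕ) := Primrec.list_length
  have hB := primrec_sum_add_four hl
  have hg : Primrec fun p : List ℕ × ℕ => p.1.getD p.2 0 := Primrec.list_getD 0
  have hs : Primrec fun k : List ℕ => ∑ j ∈ Finset.range k.length, (j + 3) * k.getD j 0 + c :=
    primrec_add (primrec_sum_range hl (primrec_mul
      (primrec_add Primrec.snd (Primrec.const 3)) hg)) (Primrec.const c)
  refine Primrec.of_eq ?_ fun k => (typeCount_get_eq k c).symm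
  exact primrec_mul (primrec_sub (Primrec.const 1) (primrec_mod hs (Primrec.const 2)))
    (primrec_digit hB (primrec_div hs (Primrec.const 2)) (primrec_prod_range hl
      (primrec_gauss (hB.comp Primrec.fst) (primrec_add Primrec.snd (Primrec.const 4)) hg)))

theorem computable_trivMult :
    Computable fun k : List ℕ => trivMult (typeRep 1 k.get) :=
  ((primrec_sub (primrec_typeCount 0) (primrec_typeCount 2)).of_eq fun k =>
    (Nat.eq_sub_of_add_eq (trivMult_eq_typeCount k.get)).symm).to_comp

/-- The number of families is computed by a digit expansion. -/
theorem familyCount_eq (m w c : ℕ) (hc : c ≤ 2) :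
    familyCount w m w c = (1 - (w + 2 * m + c) % 2) *
      digit (2 ^ (∑ j ∈ Finset.range w, (j + 4)) + 1)
        ((w + 2 * m + c) / 2 + (3 * w + 2 * m + 3) * m +
          (3 * w + 2 * m + 3) * (w + m + 1) * w)
        (genNumber (2 ^ (∑ j ∈ Finset.range w, (j + 4)) + 1)
          (3 * w + 2 * m + 3) (w + m + 1) w) := by
  rcases Nat.mod_two_eq_zero_or_one (w + 2 * m + c) with h | h
  · rw [h, Nat.sub_zero, one_mul]
    refine familyCount_eq_digit
      (fun F hF => ⟨by have := F.qdeg_le; omega, by have := F.card_le; omega⟩)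
      (by omega) (by omega) (by omega) fun i _ => ?_
    rw [← card_family]
    exact Nat.lt_succ_of_le (Finset.card_le_univ _)
  · rw [h, familyCount_eq_zero h, Nat.sub_self, zero_mul]

theorem primrec_familyCount (c : ℕ) (hc : c ≤ 2) :
    Primrec fun p : ℕ × ℕ => familyCount p.2 p.1 p.2 c := by
  refine Primrec.of_eq ?_ fun p => (familyCount_eq p.1 p.2 c hc).symm
  have hm : Primrec fun p : ℕ × ℕ => p.1 := Primrec.fst
  have hw : Primrec fun p : ℕ × ℕ => p.2 := Primrec.snd
  have hB := primrec_sum_add_four hw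
  have hs := primrec_add (primrec_add hw (primrec_mul (Primrec.const 2) hm)) (Primrec.const c)
  have h1 := primrec_add (primrec_add (primrec_mul (Primrec.const 3) hw)
    (primrec_mul (Primrec.const 2) hm)) (Primrec.const 3)
  have h2 := primrec_add (primrec_add hw hm) (Primrec.const 1)
  exact primrec_mul (primrec_sub (Primrec.const 1) (primrec_mod hs (Primrec.const 2)))
    (primrec_digit hB (primrec_add (primrec_add (primrec_div hs (Primrec.const 2))
      (primrec_mul h1 hm)) (primrec_mul (primrec_mul h1 h2) hw))
      (primrec_genNumber hB h1 h2 hw))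

theorem primrec_finrank_relCochain :
    Primrec fun p : ℕ × ℕ => Module.finrank ℝ (relCochain 1 p.1 p.2) :=
  (primrec_sub (primrec_familyCount 0 (by omega)) (primrec_familyCount 2 le_rfl)).of_eq fun _ =>
    (Nat.eq_sub_of_add_eq (finrank_eq_familyCount le_rfl)).symm

theorem Icc_one_eq_map (w : ℕ) :
    Finset.Icc 1 w = (Finset.range w).map (addRightEmbedding 1) := by
  rw [Finset.range_eq_Ico, Finset.map_add_right_Ico]
  rfl

/-- The Euler characteristic as a difference of natural numbers, the contributions of the even and
of the odd degrees. -/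
theorem euler_eq (w : ℕ) : euler 1 w =
    ((1 + ∑ i ∈ Finset.range w, i % 2 * Module.finrank ℝ (relCochain 1 (i + 1) w) : ℕ) : ℤ) -
      (∑ i ∈ Finset.range w, (1 - i % 2) * Module.finrank ℝ (relCochain 1 (i + 1) w) : ℕ) := by
  rw [euler, Icc_one_eq_map, Finset.sum_map]
  push_cast
  rw [add_sub_assoc, ← Finset.sum_sub_distrib]
  congr 1
  refine Finset.sum_congr rfl fun i _ => ?_
  rw [addRightEmbedding_apply]
  rcases Nat.even_or_odd' i with ⟨j, rfl | rfl⟩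
  · simp [pow_succ, pow_mul]
  · simp [pow_succ, pow_mul, Nat.add_mod]

theorem computable_euler : Computable fun w : ℕ => euler 1 w := by
  have hf : Primrec fun p : ℕ × ℕ => Module.finrank ℝ (relCochain 1 (p.2 + 1) p.1) :=
    primrec_finrank_relCochain.comp
      (Primrec.pair (primrec_add Primrec.snd (Primrec.const 1)) Primrec.fst)
  have hi : Primrec fun p : ℕ × ℕ => p.2 % 2 := primrec_mod Primrec.snd (Primrec.const 2)
  refine (Primrec.of_eq ?_ fun w => (euler_eq w).symm).to_comp
  exact primrec_intCast_sub
    (primrec_add (Primrec.const 1) (primrec_sum_range Primrec.id (primrec_mul hi hf)))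
    (primrec_sum_range Primrec.id (primrec_mul (primrec_sub (Primrec.const 1) hi) hf))

end Computability

/-! ### The table -/

section Table

/-- In weight at most `30` a family has at most `14` members: each member contributes at least `3`,
apart from the at most `4` members of weight `1` and the at most `5` members of weight `2`. -/
theorem Family.card_le_fourteen (F : Family 30)
    (h : ∑ j : Fin 30, ((j : ℕ) + 1) * (F j).card ≤ 30) : ∑ j, (F j).card ≤ 14 := by
  have h0 : (F 0).card ≤ 4 := (Finset.card_le_univ _).trans_eq (Fintype.card_fin _)
  have h1 : (F 1).card ≤ 5 := (Finset.card_le_univ _).trans_eq (Fintype.card_fin _)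
  rw [Fin.sum_univ_succ, Fin.sum_univ_succ] at h ⊢
  have h2 : ∑ i : Fin 28, 3 * (F i.succ.succ).card ≤
      ∑ i : Fin 28, ((i.succ.succ : ℕ) + 1) * (F i.succ.succ).card :=
    Finset.sum_le_sum fun i _ => Nat.mul_le_mul_right _ (by simp)
  rw [← Finset.mul_sum] at h2
  simp only [Fin.succ_zero_eq_one, Fin.val_zero, Fin.val_one] at *
  omega

theorem Family.qdeg_le_wt_add {N : ℕ} (F : Family N) :
    F.qdeg ≤ ∑ j : Fin N, ((j : ℕ) + 1) * (F j).card + 2 * ∑ j, (F j).card := by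
  rw [qdeg, Finset.mul_sum, ← Finset.sum_add_distrib]
  refine Finset.sum_le_sum fun j _ => ?_
  calc ∑ a ∈ F j, (a : ℕ) ≤ ∑ _a ∈ F j, ((j : ℕ) + 3) :=
        Finset.sum_le_sum fun a _ => by have := a.2; omega
    _ = ((j : ℕ) + 1) * (F j).card + 2 * (F j).card := by rw [Finset.sum_const, smul_eq_mul]; ring

/-- The radices `64` and `16` are admissible for the codes of families of weight at most `30`. -/
theorem Family.bounds {w : ℕ} (hw : w ≤ 30) (F : Family 30)
    (h : ∑ j : Fin 30, ((j : ℕ) + 1) * (F j).card ≤ w) :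
    F.qdeg < 64 ∧ ∑ j, (F j).card < 16 := by
  have h1 := F.card_le_fourteen (h.trans hw)
  have h2 := F.qdeg_le_wt_add
  omega

/-- The number of families of weight at most `w` is estimated by weighing a family of weight `v`
with `2 ^ (w - v)`, which gives a generating function that factors. -/
theorem card_family_le (N w : ℕ) (p : Family N → Prop) [DecidablePred p]
    (hp : ∀ F, p F → ∑ j : Fin N, ((j : ℕ) + 1) * (F j).card ≤ w) :
    ((Finset.univ.filter p).card : ℚ) ≤
      2 ^ w * ∏ j ∈ Finset.range N, (1 + (1 / 2 : ℚ) ^ (j + 1)) ^ (j + 4) := by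
  classical
  have h1 : ∏ j ∈ Finset.range N, (1 + (1 / 2 : ℚ) ^ (j + 1)) ^ (j + 4) =
      ∑ F : Family N, (1 / 2 : ℚ) ^ ∑ j : Fin N, ((j : ℕ) + 1) * (F j).card := by
    rw [← Fin.prod_univ_eq_prod_range (fun j => (1 + (1 / 2 : ℚ) ^ (j + 1)) ^ (j + 4))]
    have : ∀ j : Fin N, (1 + (1 / 2 : ℚ) ^ ((j : ℕ) + 1)) ^ ((j : ℕ) + 4) =
        ∑ S : Finset (Fin ((j : ℕ) + 3 + 1)), (1 / 2 : ℚ) ^ (((j : ℕ) + 1) * S.card) := by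
      intro j
      have := Finset.prod_one_add (Finset.univ : Finset (Fin ((j : ℕ) + 3 + 1)))
        (f := fun _ => (1 / 2 : ℚ) ^ ((j : ℕ) + 1))
      rw [Finset.prod_const, Finset.card_univ, Fintype.card_fin, Finset.powerset_univ] at this
      rw [show (j : ℕ) + 4 = (j : ℕ) + 3 + 1 by ring, this]
      exact Finset.sum_congr rfl fun S _ => by rw [Finset.prod_const, pow_mul]
    rw [Finset.prod_congr rfl fun j _ => this j, Finset.prod_univ_sum, Fintype.piFinset_univ]
    exact Finset.sum_congr rfl fun F _ => Finset.prod_pow_eq_pow_sum _ _ _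
  rw [h1, Finset.mul_sum, Finset.cast_card]
  refine (Finset.sum_le_sum fun F hF => ?_).trans
    (Finset.sum_le_sum_of_subset_of_nonneg (Finset.filter_subset p Finset.univ)
      fun F _ _ => by positivity)
  have := hp F (Finset.mem_filter.1 hF).2
  rw [one_div, inv_pow, ← div_eq_mul_inv, one_le_div (by positivity)]
  exact pow_le_pow_right₀ (by norm_num) this

/-- Every digit of `genNumber` up to the last one needed is less than the base `2 ^ 37`. -/
theorem card_code_lt {w i : ℕ} (hw : w ≤ 30) (hi : i < 64 * 16 * (w + 1)) :
    (Finset.univ.filter fun F : Family 30 => F.code 64 16 = i).card < 2 ^ 37 := by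
  have h := card_family_le 30 30 (fun F : Family 30 => F.code 64 16 = i)
    fun F hF => (F.wt_le_of_code_lt (hF ▸ hi)).trans hw
  have h2 : (2 ^ 30 * ∏ j ∈ Finset.range 30, (1 + (1 / 2 : ℚ) ^ (j + 1)) ^ (j + 4)) < 2 ^ 37 := by
    -- the estimate of `card_family_le`, cleared of denominators
    have : (2 ^ 30 * ∏ j ∈ Finset.range 30, (2 ^ (j + 1) + 1) ^ (j + 4) : ℕ) <
        2 ^ 37 * ∏ j ∈ Finset.range 30, (2 ^ (j + 1)) ^ (j + 4) := by decide +kernel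
    have h3 : ∏ j ∈ Finset.range 30, (1 + (1 / 2 : ℚ) ^ (j + 1)) ^ (j + 4) =
        (∏ j ∈ Finset.range 30, ((2 : ℚ) ^ (j + 1) + 1) ^ (j + 4)) /
          ∏ j ∈ Finset.range 30, ((2 : ℚ) ^ (j + 1)) ^ (j + 4) := by
      rw [← Finset.prod_div_distrib]
      refine Finset.prod_congr rfl fun j _ => ?_
      rw [← div_pow]
      congr 1
      rw [eq_div_iff (by positivity), add_mul, ← mul_pow, one_div_mul_cancel two_ne_zero, one_pow,
        one_mul]
    rw [h3, mul_div_assoc', div_lt_iff₀ (Finset.prod_pos fun j _ => by positivity)]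
    exact_mod_cast this
  exact_mod_cast h.trans_lt h2

/-- Application of a function to a natural number. The case distinction on the number makes the
kernel evaluate the number before it is substituted. -/
def force {α : Type} (n : ℕ) (f : ℕ → α) : α := Nat.rec (f 0) (fun k _ => f (k + 1)) n

theorem force_eq {α : Type} (n : ℕ) (f : ℕ → α) : force n f = f n := by
  cases n <;> rfl

/-- The product of the `1 + 2 ^ (b * e)`, for `e` in a list, and of `P`, modulo `2 ^ K`. -/
def truncProd (b K : ℕ) : List ℕ → ℕ → ℕ
  | [], P => P
  | e :: l, P => force ((P + P <<< (b * e)) &&& (2 ^ K - 1)) (truncProd b K l)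

/-- Truncation after each multiplication does not change the product modulo `2 ^ K`. -/
theorem truncProd_mod (b K : ℕ) (l : List ℕ) (P : ℕ) :
    truncProd b K l P % 2 ^ K = P * (l.map fun e => 1 + (2 ^ b) ^ e).prod % 2 ^ K := by
  induction l generalizing P with
  | nil => simp [truncProd]
  | cons e l ih =>
    rw [truncProd, force_eq, ih, Nat.and_two_pow_sub_one_eq_mod, Nat.shiftLeft_eq, List.map_cons,
      List.prod_cons, Nat.mod_mul_mod, ← pow_mul]
    congr 1
    ring

/-- The exponents of the factors of `genNumber`. -/
def genExponents (Q₁ Q₂ N : ℕ) : List ℕ :=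
  (List.range N).flatMap fun j => (List.range (j + 4)).map fun a => a + Q₁ + Q₁ * Q₂ * (j + 1)

theorem prod_genExponents (B Q₁ Q₂ N : ℕ) :
    ((genExponents Q₁ Q₂ N).map fun e => 1 + B ^ e).prod = genNumber B Q₁ Q₂ N := by
  have h (n : ℕ) (f : ℕ → ℕ) : ((List.range n).map f).prod = ∏ i ∈ Finset.range n, f i := rfl
  rw [genExponents, genNumber, ← h, List.map_flatMap, List.flatMap, List.prod_flatten,
    List.map_map]
  simp only [← h, List.map_map]
  rfl

/-- The difference of digits of `x` that gives `dim C^m_w` is compared with the rows of a table. -/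
def checkRows (rows : List (ℕ × List ℕ × ℤ)) (x : ℕ) : Bool :=
  rows.all fun row => (List.range 14).all fun m =>
    (x >>> (37 * (row.1 / 2 + (m + 1) + 64 * (m + 1) + 64 * 16 * row.1))) % 2 ^ 37 ==
      row.2.1.getD m 0 +
      (x >>> (37 * (row.1 / 2 + (m + 1) + 1 + 64 * (m + 1) + 64 * 16 * row.1))) % 2 ^ 37

/-- The table agrees with the digits of the truncated generating number, by evaluation of the latter
in the kernel. The lowest `64 * 16 * 31` digits suffice for the weights up to `30`. -/
theorem checkRows_table :
    force (truncProd 37 (37 * (64 * 16 * 31)) (genExponents 64 16 30) 1) (checkRows table) =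
      true := by
  decide +kernel

/-- Truncation modulo `(2 ^ b) ^ M` preserves the digits below position `M`. -/
theorem digit_truncProd {b E M : ℕ} (hE : E < M) (Q₁ Q₂ N : ℕ) :
    truncProd b (b * M) (genExponents Q₁ Q₂ N) 1 >>> (b * E) % 2 ^ b =
      digit (2 ^ b) E (genNumber (2 ^ b) Q₁ Q₂ N) := by
  rw [← digit_mod hE (genNumber _ _ _ _), ← prod_genExponents, ← pow_mul,
    ← one_mul (List.prod _), ← truncProd_mod, pow_mul, digit_mod hE, digit, Nat.shiftRight_eq_div_pow,
    pow_mul]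

/-- A number that has the required digits, and whose digits agree with the table. -/
theorem exists_checkRows : ∃ x, checkRows table x = true ∧ ∀ E < 64 * 16 * 31,
    x >>> (37 * E) % 2 ^ 37 = digit (2 ^ 37) E (genNumber (2 ^ 37) 64 16 30) :=
  ⟨_, (force_eq _ _).symm.trans checkRows_table, fun _ hE => digit_truncProd hE 64 16 30⟩

theorem finrank_of_mem_table (row : ℕ × List ℕ × ℤ) (hrow : row ∈ table) (m : ℕ) :
    Module.finrank ℝ (relCochain 1 (m + 1) row.1) = row.2.1.getD m 0 := by
  have hev : ∀ row ∈ table, row.1 % 2 = 0 ∧ row.1 ≤ 30 ∧ row.2.1.length ≤ 14 := by decide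
  obtain ⟨h2, hw, hl⟩ := hev row hrow
  have key := finrank_eq_familyCount (m := m + 1) hw
  rcases lt_or_ge m 14 with hm | hm
  · obtain ⟨x, h, hx⟩ := exists_checkRows
    have hB : ∀ A ≤ 46, ∀ i ≤ A + 64 * (m + 1) + 64 * 16 * row.1,
        (Finset.univ.filter fun F : Family 30 => F.code 64 16 = i).card < 2 ^ 37 :=
      fun A hA i hi => card_code_lt hw (by omega)
    rw [familyCount_eq_digit (Family.bounds hw) (A := row.1 / 2 + (m + 1)) (c := 0)
        (by omega) (by omega) (by omega) (hB _ (by omega)),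
      familyCount_eq_digit (Family.bounds hw) (A := row.1 / 2 + (m + 1) + 1) (c := 2)
        (by omega) (by omega) (by omega) (hB _ (by omega)),
      ← hx _ (by omega), ← hx _ (by omega)] at key
    rw [checkRows, List.all_eq_true] at h
    have h := h row hrow
    rw [List.all_eq_true] at h
    have h := beq_iff_eq.1 (h m (List.mem_range.2 hm))
    omega
  -- more than `14` monomials have weight above `30`, and no row lists a dimension there
  · have h0 : familyCount 30 (m + 1) row.1 0 = 0 := by
      rw [familyCount, Fintype.card_eq_zero_iff]
      refine ⟨fun F => ?_⟩
      have := F.1.card_le_fourteen (F.2.2.1.trans_le hw)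
      have := F.2.1
      omega
    rw [List.getD_eq_default _ _ (hl.trans hm)]
    omega

theorem euler_of_mem_table (row : ℕ × List ℕ × ℤ) (hrow : row ∈ table) :
    euler 1 row.1 = row.2.2 := by
  have h : ∀ row ∈ table,
      1 + ∑ m ∈ Finset.range row.1, (-1 : ℤ) ^ (m + 1) * (row.2.1.getD m 0 : ℤ) = row.2.2 := by
    decide +kernel
  rw [← h row hrow, euler, Icc_one_eq_map, Finset.sum_map]
  congr 1
  exact Finset.sum_congr rfl fun m _ => by
    rw [addRightEmbedding_apply, finrank_of_mem_table row hrow]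

end Table

/-! ### Cartan calculus on the cochains of a Lie algebra -/

section Cartan

open AlternatingMap

variable {L : Type*} [LieRing L] [LieAlgebra ℝ L]

/-- The interior product `ι_z σ = σ(z, …)`. -/
noncomputable def interior {m : ℕ} (z : L) : L [⋀^Fin (m + 1)]→ₗ[ℝ] ℝ →ₗ[ℝ] L [⋀^Fin m]→ₗ[ℝ] ℝ :=
  curryLeftLinearMap.flip z

theorem interior_apply {m : ℕ} (z : L) (σ : L [⋀^Fin (m + 1)]→ₗ[ℝ] ℝ) (v : Fin m → L) :
    interior z σ v = σ (Matrix.vecCons z v) := rfl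

theorem interior_add_left {m : ℕ} (x y : L) (σ : L [⋀^Fin (m + 1)]→ₗ[ℝ] ℝ) :
    interior (x + y) σ = interior x σ + interior y σ := map_add σ.curryLeft x y

theorem interior_neg_left {m : ℕ} (x : L) (σ : L [⋀^Fin (m + 1)]→ₗ[ℝ] ℝ) :
    interior (-x) σ = -interior x σ := map_neg σ.curryLeft x

theorem interior_sub_left {m : ℕ} (x y : L) (σ : L [⋀^Fin (m + 1)]→ₗ[ℝ] ℝ) :
    interior (x - y) σ = interior x σ - interior y σ := map_sub σ.curryLeft x y

theorem interior_ext {m : ℕ} {σ τ : L [⋀^Fin (m + 1)]→ₗ[ℝ] ℝ}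
    (h : ∀ z, interior z σ = interior z τ) : σ = τ := by
  ext v
  have := DFunLike.congr_fun (h (Matrix.vecHead v)) (Matrix.vecTail v)
  rwa [interior_apply, interior_apply, Matrix.cons_head_tail] at this

theorem interior_interior {m : ℕ} (x y : L) (σ : L [⋀^Fin (m + 2)]→ₗ[ℝ] ℝ) :
    interior x (interior y σ) = -interior y (interior x σ) := by
  have h (z : L) : interior z (interior z σ) = 0 := curryLeft_same σ z
  have h1 := h (x + y)
  rw [interior_add_left, interior_add_left, map_add, map_add, h, h, zero_add, add_zero] at h1
  exact eq_neg_of_add_eq_zero_left h1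

/-- Antisymmetrization of `f` in its first argument is the alternating sum over the positions of that
argument; the position `0` gives the term `f z`. -/
theorem interior_alternatizeUncurryFin {m : ℕ} (f : L →ₗ[ℝ] L [⋀^Fin (m + 1)]→ₗ[ℝ] ℝ) (z : L) :
    interior z (alternatizeUncurryFin f) = f z - alternatizeUncurryFin (interior z ∘ₗ f) := by
  ext v
  rw [interior_apply, AlternatingMap.sub_apply, alternatizeUncurryFin_apply,
    alternatizeUncurryFin_apply, Fin.sum_univ_succ, sub_eq_add_neg, ← Finset.sum_neg_distrib]
  congr 1
  · simp
  · refine Finset.sum_congr rfl fun i _ => ?_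
    rw [Fin.val_succ, pow_succ, mul_neg_one, neg_smul, Matrix.cons_val_succ]
    congr 2
    change _ = f (v i) (Matrix.vecCons z (i.removeNth v))
    congr 1
    funext k
    refine Fin.cases ?_ (fun k => ?_) k
    · simp [Fin.removeNth]
    · simp [Fin.removeNth]

theorem interior_alternatizeUncurryFin_zero (f : L →ₗ[ℝ] L [⋀^Fin 0]→ₗ[ℝ] ℝ) (z : L) :
    interior z (alternatizeUncurryFin f) = f z := by
  ext v
  rw [interior_apply, alternatizeUncurryFin_apply, Fin.sum_univ_succ]
  simp

/-- The Lie derivative `L_x` on cochains. It is obtained by antisymmetrization of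
`(y, …) ↦ -σ([x, y], …)`. -/
noncomputable def lieDer : (m : ℕ) → L →ₗ[ℝ] L [⋀^Fin m]→ₗ[ℝ] ℝ →ₗ[ℝ] L [⋀^Fin m]→ₗ[ℝ] ℝ
  | 0 => 0
  | m + 1 => LinearMap.mk₂ ℝ
      (fun x σ => -alternatizeUncurryFin (σ.curryLeft ∘ₗ (LieAlgebra.ad ℝ L x : L →ₗ[ℝ] L)))
      (fun x y σ => by
        rw [map_add, LinearMap.comp_add, alternatizeUncurryFin_add, neg_add])
      (fun c x σ => by
        rw [map_smul, LinearMap.comp_smul, alternatizeUncurryFin_smul, smul_neg])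
      (fun x σ τ => by
        rw [curryLeft_add, LinearMap.add_comp, alternatizeUncurryFin_add, neg_add])
      (fun c x σ => by
        rw [curryLeft_smul, LinearMap.smul_comp, alternatizeUncurryFin_smul, smul_neg])

theorem lieDer_succ {m : ℕ} (x : L) (σ : L [⋀^Fin (m + 1)]→ₗ[ℝ] ℝ) : lieDer (m + 1) x σ =
    -alternatizeUncurryFin (σ.curryLeft ∘ₗ (LieAlgebra.ad ℝ L x : L →ₗ[ℝ] L)) := rfl

theorem lieDer_apply {m : ℕ} (x : L) (σ : L [⋀^Fin m]→ₗ[ℝ] ℝ) (v : Fin m → L) :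
    lieDer m x σ v = -∑ i, σ (Function.update v i ⁅x, v i⁆) := by
  cases m with
  | zero => simp [lieDer]
  | succ m =>
    rw [lieDer_succ, AlternatingMap.neg_apply, alternatizeUncurryFin_apply]
    congr 1
    refine Finset.sum_congr rfl fun i _ => ?_
    rw [← Fin.insertNth_removeNth, map_insertNth]
    rfl

/-- The commutator relation `[ι_z, L_x] = -ι_{[x, z]}`. -/
theorem interior_lieDer {m : ℕ} (x z : L) (σ : L [⋀^Fin (m + 1)]→ₗ[ℝ] ℝ) :
    interior z (lieDer (m + 1) x σ) = lieDer m x (interior z σ) - interior ⁅x, z⁆ σ := by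
  cases m with
  | zero =>
    rw [lieDer_succ, map_neg, interior_alternatizeUncurryFin_zero]
    simp only [lieDer, LinearMap.zero_apply, zero_sub]
    rfl
  | succ m =>
    rw [lieDer_succ, map_neg, interior_alternatizeUncurryFin, neg_sub, lieDer_succ,
      sub_eq_add_neg, sub_eq_add_neg]
    have h : interior z ∘ₗ σ.curryLeft ∘ₗ (LieAlgebra.ad ℝ L x : L →ₗ[ℝ] L) =
        (-1 : ℝ) • ((interior z σ).curryLeft ∘ₗ (LieAlgebra.ad ℝ L x : L →ₗ[ℝ] L)) := by
      ext1 y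
      rw [LinearMap.smul_apply, neg_one_smul]
      exact interior_interior z ⁅x, y⁆ σ
    rw [h, alternatizeUncurryFin_smul]
    exact congrArg₂ (· + ·) (AlternatingMap.ext fun _ => neg_one_mul _) rfl

/-- The Chevalley-Eilenberg differential. It is half the antisymmetrization of
`(x, …) ↦ (L_x σ)(…)`. -/
noncomputable def ceDiff (m : ℕ) : L [⋀^Fin m]→ₗ[ℝ] ℝ →ₗ[ℝ] L [⋀^Fin (m + 1)]→ₗ[ℝ] ℝ :=
  (2⁻¹ : ℝ) • (alternatizeUncurryFinLM ∘ₗ (lieDer m).flip)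

theorem ceDiff_eq {m : ℕ} (σ : L [⋀^Fin m]→ₗ[ℝ] ℝ) :
    ceDiff m σ = (2⁻¹ : ℝ) • alternatizeUncurryFin ((lieDer m).flip σ) := rfl

theorem ceDiff_zero (σ : L [⋀^Fin 0]→ₗ[ℝ] ℝ) : ceDiff 0 σ = 0 := by
  have : (lieDer 0).flip σ = 0 := rfl
  rw [ceDiff_eq, this, ← alternatizeUncurryFinLM_apply, _root_.map_zero, smul_zero]

/-- Cartan's formula. -/
theorem interior_ceDiff {m : ℕ} (z : L) (σ : L [⋀^Fin (m + 1)]→ₗ[ℝ] ℝ) :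
    interior z (ceDiff (m + 1) σ) = lieDer (m + 1) z σ - ceDiff m (interior z σ) := by
  have h : interior z ∘ₗ (lieDer (m + 1)).flip σ =
      (lieDer m).flip (interior z σ) + σ.curryLeft ∘ₗ (LieAlgebra.ad ℝ L z : L →ₗ[ℝ] L) := by
    ext1 x
    change interior z (lieDer (m + 1) x σ) = lieDer m x (interior z σ) + interior ⁅z, x⁆ σ
    rw [interior_lieDer, ← lie_skew, interior_neg_left, sub_neg_eq_add]
  rw [ceDiff_eq, ceDiff_eq, map_smul, interior_alternatizeUncurryFin, h,
    alternatizeUncurryFin_add, LinearMap.flip_apply, smul_sub, smul_add, lieDer_succ]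
  module

/-- The Lie derivative is a representation. The proof is by induction on the degree, using
`interior_lieDer`. -/
theorem lieDer_lie {m : ℕ} (x y : L) (σ : L [⋀^Fin m]→ₗ[ℝ] ℝ) :
    lieDer m ⁅x, y⁆ σ = lieDer m x (lieDer m y σ) - lieDer m y (lieDer m x σ) := by
  induction m with
  | zero => simp [lieDer]
  | succ m ih =>
    refine interior_ext fun z => ?_
    simp only [map_sub, interior_lieDer, ih, lie_lie, interior_sub_left]
    abel

/-- The Lie derivative commutes with the differential, by induction on the degree using Cartan's
formula. -/
theorem lieDer_ceDiff {m : ℕ} (x : L) (σ : L [⋀^Fin m]→ₗ[ℝ] ℝ) :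
    lieDer (m + 1) x (ceDiff m σ) = ceDiff m (lieDer m x σ) := by
  induction m with
  | zero => rw [ceDiff_zero, ceDiff_zero, _root_.map_zero]
  | succ m ih =>
    refine interior_ext fun z => ?_
    simp only [map_sub, interior_lieDer, interior_ceDiff, lieDer_lie, ih]
    abel

theorem ceDiff_ceDiff {m : ℕ} (σ : L [⋀^Fin m]→ₗ[ℝ] ℝ) : ceDiff (m + 1) (ceDiff m σ) = 0 := by
  induction m with
  | zero => rw [ceDiff_zero, _root_.map_zero]
  | succ m ih =>
    refine interior_ext fun z => ?_
    rw [interior_ceDiff, interior_ceDiff, lieDer_ceDiff, map_sub, ih, sub_zero, sub_self, _root_.map_zero]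

/-- The differential is the usual sum over pairs of arguments. The pairs are parametrized as in the
definition of `d`. -/
theorem ceDiff_apply {m : ℕ} (σ : L [⋀^Fin (m + 1)]→ₗ[ℝ] ℝ) (v : Fin (m + 2) → L) :
    ceDiff (m + 1) σ v = ∑ i : Fin (m + 1), ∑ j : Fin (m + 1),
      if i ≤ j then
        (-1 : ℝ) ^ ((i : ℕ) + ((j : ℕ) + 1)) *
          σ (Fin.cons ⁅v i.castSucc, v j.succ⁆
            (fun k : Fin m => v (j.succ.succAbove (i.succAbove k))))
      else 0 := by
  let f : L →ₗ[ℝ] L →ₗ[ℝ] L [⋀^Fin m]→ₗ[ℝ] ℝ := LinearMap.mk₂ ℝ (fun x y => interior ⁅x, y⁆ σ)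
    (fun x y z => by rw [add_lie, interior_add_left])
    (fun c x y => by rw [smul_lie]; exact map_smul σ.curryLeft c _)
    (fun x y z => by rw [lie_add, interior_add_left])
    (fun c x y => by rw [lie_smul]; exact map_smul σ.curryLeft c _)
  have h : (lieDer (m + 1)).flip σ = (-1 : ℝ) • (alternatizeUncurryFinLM ∘ₗ f) :=
    LinearMap.ext fun _ => (neg_one_smul ℝ _).symm
  rw [ceDiff_eq, h, alternatizeUncurryFin_smul, AlternatingMap.smul_apply,
    AlternatingMap.smul_apply, alternatizeUncurryFin_alternatizeUncurryFinLM_comp_apply, smul_smul,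
    Finset.smul_sum]
  refine Finset.sum_congr rfl fun i _ => ?_
  rw [← Finset.sum_filter, Finset.smul_sum]
  refine Finset.sum_congr (by ext; simp) fun j hj => ?_
  have hij : i ≤ j := (Finset.mem_filter.1 hj).2
  have h1 : j.removeNth (i.castSucc.removeNth v) =
      fun k : Fin m => v (j.succ.succAbove (i.succAbove k)) := by
    rw [Fin.removeNth_removeNth_eq_swap]
    funext k
    simp [Fin.predAbove, hij.not_gt, Fin.succAbove, Fin.removeNth]
  rw [h1]
  change ((2⁻¹ : ℝ) * -1) • (((-1 : ℤ) ^ ((i : ℕ) + j)) • (interior ⁅v i.castSucc, v j.succ⁆ σ _ -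
    interior ⁅v j.succ, v i.castSucc⁆ σ _)) = _ * interior _ σ _
  rw [← lie_skew (v i.castSucc), interior_neg_left, AlternatingMap.neg_apply, zsmul_eq_mul]
  simp only [smul_eq_mul]
  push_cast
  ring

end Cartan

/-! ### The Lie algebra of formal Hamiltonian vector fields -/

section HamLie

open MvPowerSeries

theorem poisson_eq (f g : MvPowerSeries (Fin 1 ⊕ Fin 1) ℝ) :
    poisson f g = pderiv ℝ (Sum.inl 0) f * pderiv ℝ (Sum.inr 0) g -
      pderiv ℝ (Sum.inr 0) f * pderiv ℝ (Sum.inl 0) g := by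
  rw [poisson, Fin.sum_univ_one]

theorem pderiv_pderiv_comm {σ : Type*} (i j : σ) (f : MvPowerSeries σ ℝ) :
    pderiv ℝ i (pderiv ℝ j f) = pderiv ℝ j (pderiv ℝ i f) := by
  classical
  ext e
  simp only [coeff_pderiv, Finsupp.add_apply, Finsupp.single_apply]
  rw [add_right_comm]
  rcases eq_or_ne i j with rfl | h
  · rfl
  · rw [if_neg h, if_neg h.symm]
    push_cast
    ring

theorem bracket_val (f g : ham0 1) : (⁅f, g⁆ : ham0 1).1 = poisson f.1 g.1 := rfl

noncomputable instance : LieRing (ham0 1) where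
  add_lie f g h := Subtype.ext <| by
    simp only [bracket_val, Submodule.coe_add, poisson_eq, map_add]
    ring
  lie_add f g h := Subtype.ext <| by
    simp only [bracket_val, Submodule.coe_add, poisson_eq, map_add]
    ring
  lie_self f := Subtype.ext <| by
    simp only [bracket_val, poisson_eq, Submodule.coe_zero]
    ring
  leibniz_lie f g h := Subtype.ext <| by
    simp only [bracket_val, Submodule.coe_add, poisson_eq, map_sub, Derivation.leibniz,
      smul_eq_mul, pderiv_pderiv_comm (Sum.inr 0 : Fin 1 ⊕ Fin 1) (Sum.inl 0)]
    ring

noncomputable instance : LieAlgebra ℝ (ham0 1) where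
  lie_smul c f g := Subtype.ext <| by
    simp only [bracket_val, SetLike.val_smul, poisson_eq, Derivation.map_smul, mul_smul_comm,
      smul_sub]

theorem continuous_pderiv (i : Fin 1 ⊕ Fin 1) :
    Continuous (pderiv ℝ i : MvPowerSeries (Fin 1 ⊕ Fin 1) ℝ → _) := by
  refine continuous_pi fun e => ?_
  change Continuous fun f => coeff e (pderiv ℝ i f)
  simp only [coeff_pderiv]
  exact (WithPiTopology.continuous_coeff ℝ _).mul continuous_const

theorem continuous_bracket : Continuous fun p : ham0 1 × ham0 1 => (⁅p.1, p.2⁆ : ham0 1) := by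
  refine Continuous.subtype_mk ?_ _
  simp only [poisson_eq]
  have h1 (i : Fin 1 ⊕ Fin 1) : Continuous fun p : ham0 1 × ham0 1 => pderiv ℝ i p.1.1 :=
    (continuous_pderiv i).comp (continuous_subtype_val.comp continuous_fst)
  have h2 (i : Fin 1 ⊕ Fin 1) : Continuous fun p : ham0 1 × ham0 1 => pderiv ℝ i p.2.1 :=
    (continuous_pderiv i).comp (continuous_subtype_val.comp continuous_snd)
  exact ((h1 _).mul (h2 _)).sub ((h1 _).mul (h2 _))

theorem isHomogeneous_pderiv {f : MvPowerSeries (Fin 1 ⊕ Fin 1) ℝ} {l : ℕ}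
    (hf : f.IsHomogeneous (l + 1)) (i : Fin 1 ⊕ Fin 1) : (pderiv ℝ i f).IsHomogeneous l := by
  rw [isHomogeneous_iff] at hf ⊢
  intro e he
  rw [coeff_pderiv, hf _ (by simpa using he), zero_mul]

theorem isHomogeneous_bracket {f g : ham0 1} {k l : ℕ} (hf : f.1.IsHomogeneous (k + 1))
    (hg : g.1.IsHomogeneous (l + 1)) : (⁅f, g⁆ : ham0 1).1.IsHomogeneous (k + l) := by
  have h (i j : Fin 1 ⊕ Fin 1) := isHomogeneous_iff.1
    (MvPowerSeries.IsHomogeneous.mul (isHomogeneous_pderiv hf i) (isHomogeneous_pderiv hg j))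
  rw [bracket_val, poisson_eq, isHomogeneous_iff]
  intro e he
  rw [map_sub, h _ _ e he, h _ _ e he, sub_zero]

theorem eq_zero_of_isHomogeneous {f : ham0 1} {l : ℕ} (hf : f.1.IsHomogeneous l) (hl : l < 2) :
    f = 0 := by
  refine Subtype.ext (MvPowerSeries.ext fun e => ?_)
  by_cases he : e.degree = l
  · exact f.2 e (by omega)
  · exact isHomogeneous_iff.1 hf e he

/-! ### Linear substitutions preserve the bracket -/

theorem coeff_subst_congr (A : Mat) {f g : MvPowerSeries (Fin 1 ⊕ Fin 1) ℝ}
    {e : (Fin 1 ⊕ Fin 1) →₀ ℕ} (h : ∀ c, c.degree = e.degree → coeff c f = coeff c g) :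
    coeff e (subst (fun i => (linForm A i : MvPowerSeries (Fin 1 ⊕ Fin 1) ℝ)) f) =
      coeff e (subst (fun i => (linForm A i : MvPowerSeries (Fin 1 ⊕ Fin 1) ℝ)) g) := by
  rw [coeff_subst_linForm, coeff_subst_linForm]
  refine Finset.sum_congr rfl fun i hi => ?_
  rw [Finset.mem_range] at hi
  rw [h _ (by rw [degree_expo]; omega)]

/-- The part of degree `l` of a power series is a polynomial. This reduces identities between
coefficients of linear substitutions to polynomials. -/
theorem exists_polynomial (f : MvPowerSeries (Fin 1 ⊕ Fin 1) ℝ) (l : ℕ) :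
    ∃ P : MvPolynomial (Fin 1 ⊕ Fin 1) ℝ, ∀ c, c.degree = l →
      coeff c f = coeff c (P : MvPowerSeries (Fin 1 ⊕ Fin 1) ℝ) := by
  classical
  refine ⟨∑ i ∈ Finset.range (l + 1),
    MvPolynomial.monomial (expo i (l - i)) (coeff (expo i (l - i)) f), fun c hc => ?_⟩
  rw [MvPolynomial.coeff_coe, MvPolynomial.coeff_sum]
  have hc' := expo_eta c
  have hd := degree_eq c
  rw [Finset.sum_eq_single (c (Sum.inl 0))]
  · rw [← hc, hd, Nat.add_sub_cancel_left, hc', MvPolynomial.coeff_monomial, if_pos rfl]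
  · intro i _ hi
    rw [MvPolynomial.coeff_monomial, if_neg]
    rintro rfl
    exact hi (expo_inl _ _ _).symm
  · intro h
    exact absurd (Finset.mem_range.2 (by omega)) h

theorem pderiv_linForm (A : Mat) (i j : Fin 1 ⊕ Fin 1) :
    MvPolynomial.pderiv i (linForm A j) = MvPolynomial.C (A j i) := by
  classical
  rw [linForm, map_sum, Finset.sum_eq_single i]
  · simp
  · intro k _ hk
    simp [MvPolynomial.pderiv_X, hk]
  · simp

theorem pderiv_aeval_linForm (A : Mat) (P : MvPolynomial (Fin 1 ⊕ Fin 1) ℝ)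
    (i : Fin 1 ⊕ Fin 1) :
    MvPolynomial.pderiv i (MvPolynomial.aeval (linForm A) P) =
      ∑ j, MvPolynomial.C (A j i) *
        MvPolynomial.aeval (linForm A) (MvPolynomial.pderiv j P) := by
  classical
  induction P using MvPolynomial.induction_on with
  | C a => simp [MvPolynomial.algebraMap_eq]
  | add P Q hP hQ => simp only [map_add, hP, hQ, mul_add, Finset.sum_add_distrib]
  | mul_X P k hP =>
    simp only [map_mul, MvPolynomial.aeval_X, Derivation.leibniz, hP, pderiv_linForm, smul_eq_mul,
      map_add, MvPolynomial.pderiv_X, mul_add, Finset.sum_add_distrib, Finset.mul_sum]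
    congr 1
    · rw [Finset.sum_eq_single k]
      · simp; ring
      · intro j _ hj
        simp [hj.symm]
      · simp
    · exact Finset.sum_congr rfl fun j _ => by ring

/-- The chain rule. -/
theorem pderiv_subst_linForm (A : Mat) (f : MvPowerSeries (Fin 1 ⊕ Fin 1) ℝ)
    (i : Fin 1 ⊕ Fin 1) :
    pderiv ℝ i (subst (fun i => (linForm A i : MvPowerSeries (Fin 1 ⊕ Fin 1) ℝ)) f) =
      ∑ j, A j i • subst (fun i => (linForm A i : MvPowerSeries (Fin 1 ⊕ Fin 1) ℝ))
        (pderiv ℝ j f) := by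
  ext e
  obtain ⟨P, hP⟩ := exists_polynomial f (e.degree + 1)
  rw [coeff_pderiv, coeff_subst_congr A fun c hc => hP c (by simpa using hc), map_sum]
  have h (j : Fin 1 ⊕ Fin 1) :
      coeff e (A j i • subst (fun i => (linForm A i : MvPowerSeries (Fin 1 ⊕ Fin 1) ℝ))
        (pderiv ℝ j f)) =
      (MvPolynomial.C (A j i) *
        MvPolynomial.aeval (linForm A) (MvPolynomial.pderiv j P)).coeff e := by
    rw [coeff_smul, MvPolynomial.coeff_C_mul, ← MvPolynomial.coeff_coe, coe_aeval_linForm,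
      ← pderiv_coe]
    refine congrArg (A j i * ·) ?_
    refine coeff_subst_congr A fun c hc => ?_
    rw [coeff_pderiv, coeff_pderiv, hP _ (by simpa using hc)]
  rw [Finset.sum_congr rfl fun j _ => h j, ← MvPolynomial.coeff_sum, ← pderiv_aeval_linForm,
    ← MvPolynomial.coeff_coe, ← pderiv_coe, coeff_pderiv, coe_aeval_linForm]

/-- By the chain rule, a linear substitution multiplies the bracket by its determinant, which is `1`
for a symplectic matrix. -/
theorem substHam_bracket {A : Mat} (hA : A ∈ Matrix.symplecticGroup (Fin 1) ℝ) (f g : ham0 1) :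
    substHam A ⁅f, g⁆ = ⁅substHam A f, substHam A g⁆ := by
  obtain ⟨x, y, z, w, rfl⟩ : ∃ x y z w, A = mat2 x y z w := ⟨_, _, _, _, mat2_eta A⟩
  have hdet := (mat2_mem _ _ _ _).1 hA
  refine Subtype.ext ?_
  rw [substHam_val, bracket_val, bracket_val, poisson_eq, poisson_eq, substHam_val, substHam_val,
    ← coe_substAlgHom (hasSubst_linForm _), map_sub, map_mul, map_mul,
    coe_substAlgHom (hasSubst_linForm _)]
  simp only [pderiv_subst_linForm, Fintype.sum_sum_type, Fin.sum_univ_one, mat2,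
    Matrix.of_apply, Sum.elim_inl, Sum.elim_inr, smul_eq_C_mul]
  have hC : C (σ := Fin 1 ⊕ Fin 1) x * C w - C y * C z = 1 := by
    rw [← map_mul, ← map_mul, ← map_sub, hdet, map_one]
  have key (a b c d : MvPowerSeries (Fin 1 ⊕ Fin 1) ℝ) : a * d - b * c =
      (C x * a + C z * b) * (C y * c + C w * d) - (C y * a + C w * b) * (C x * c + C z * d) := by
    linear_combination -(a * d - b * c) * hC
  exact key _ _ _ _

end HamLie

/-! ### The differential of relative cochains -/

section RelDiff

open MvPowerSeries Filter Topology

theorem continuous_cons_bracket {m n : ℕ} (i j : Fin n) (c : Fin m → Fin n) :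
    Continuous fun v : Fin n → ham0 1 =>
      (Fin.cons (⁅v i, v j⁆ : ham0 1) (fun k => v (c k)) : Fin (m + 1) → ham0 1) := by
  refine continuous_pi fun k => ?_
  induction k using Fin.cases with
  | zero =>
    simp only [Fin.cons_zero]
    exact continuous_bracket.comp₂ (continuous_apply i) (continuous_apply j)
  | succ k =>
    simp only [Fin.cons_succ]
    exact continuous_apply _

theorem continuous_ceDiff {m : ℕ} (σ : Cochain 1 m) :
    Continuous fun v => ceDiff m σ.toAlternatingMap v := by
  cases m with
  | zero =>
    rw [ceDiff_zero]
    exact continuous_const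
  | succ m =>
    simp only [ceDiff_apply]
    refine continuous_finsetSum _ fun i _ => continuous_finsetSum _ fun j _ => ?_
    split_ifs
    · have h : Continuous σ := σ.cont
      exact continuous_const.mul (h.comp (continuous_cons_bracket _ _ _))
    · exact continuous_const

/-- The Chevalley-Eilenberg differential of a continuous cochain, as a continuous cochain. -/
noncomputable def cochainDiff (m : ℕ) (σ : Cochain 1 m) : Cochain 1 (m + 1) :=
  { ceDiff m σ.toAlternatingMap with cont := continuous_ceDiff σ }

theorem toAlternatingMap_cochainDiff {m : ℕ} (σ : Cochain 1 m) :
    (cochainDiff m σ).toAlternatingMap = ceDiff m σ.toAlternatingMap := rfl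

theorem d_eq_cochainDiff {m : ℕ} (σ : Cochain 1 m) (X : Fin (m + 1) → ham0 1) :
    d 1 m σ X = cochainDiff m σ X := by
  change _ = ceDiff m σ.toAlternatingMap X
  cases m with
  | zero => rw [ceDiff_zero]; rfl
  | succ m => rw [ceDiff_apply]; rfl

theorem cochainDiff_cochainDiff {m : ℕ} (σ : Cochain 1 m) :
    cochainDiff (m + 1) (cochainDiff m σ) = 0 := by
  refine ContinuousAlternatingMap.toAlternatingMap_injective ?_
  rw [toAlternatingMap_cochainDiff, toAlternatingMap_cochainDiff, ceDiff_ceDiff]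
  rfl

/-- The arguments of a term of `d` are the two that enter the bracket and the remaining ones. -/
theorem sum_eq_of_le {m : ℕ} (l : Fin (m + 2) → ℤ) {i j : Fin (m + 1)} (h : i ≤ j) :
    ∑ k, l k = l i.castSucc + l j.succ + ∑ k : Fin m, l (j.succ.succAbove (i.succAbove k)) := by
  rw [Fin.sum_univ_succAbove l j.succ, Fin.sum_univ_succAbove _ i,
    Fin.succAbove_of_castSucc_lt _ _ (by simpa [Fin.lt_def, Nat.lt_succ_iff] using h)]
  ring

/-- The bracket of elements of degrees `k` and `l` has degree `k + l - 2`, so `d` preserves the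
weight. -/
theorem cochainDiff_mem_weightCochain {m w : ℕ} {σ : Cochain 1 m} (hσ : σ ∈ weightCochain 1 m w) :
    cochainDiff m σ ∈ weightCochain 1 (m + 1) w := by
  intro f l hf hl
  by_cases h2 : ∀ i, 2 ≤ l i
  · cases m with
    | zero => rw [← d_eq_cochainDiff]; rfl
    | succ m =>
      change ceDiff (m + 1) σ.toAlternatingMap f = 0
      rw [ceDiff_apply]
      refine Finset.sum_eq_zero fun i _ => Finset.sum_eq_zero fun j _ => ?_
      split_ifs with hij
      · refine mul_eq_zero_of_right _ (hσ _ (Fin.cons (l i.castSucc + l j.succ - 2)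
          fun k => l (j.succ.succAbove (i.succAbove k))) (fun k => ?_) ?_)
        · refine Fin.cases ?_ (fun k => ?_) k
          · rw [Fin.cons_zero, Fin.cons_zero]
            obtain ⟨a, ha⟩ := Nat.exists_eq_add_of_le' (h2 i.castSucc)
            obtain ⟨b, hb⟩ := Nat.exists_eq_add_of_le' (h2 j.succ)
            have h1 : (f i.castSucc).1.IsHomogeneous (a + 1 + 1) := by rw [← ha]; exact hf _
            have h2 : (f j.succ).1.IsHomogeneous (b + 1 + 1) := by rw [← hb]; exact hf _
            rw [ha, hb, show a + 2 + (b + 2) - 2 = a + 1 + (b + 1) by omega]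
            exact isHomogeneous_bracket h1 h2
          · rw [Fin.cons_succ, Fin.cons_succ]
            exact hf _
        · rw [sum_eq_of_le _ hij] at hl
          rw [Fin.sum_univ_succ]
          simp only [Fin.cons_zero, Fin.cons_succ]
          have := h2 i.castSucc
          intro h
          apply hl
          rw [← h]
          push_cast [Nat.cast_sub (show 2 ≤ l i.castSucc + l j.succ by omega)]
          ring
      · rfl
  -- a homogeneous argument of degree less than `2` is zero
  · push Not at h2
    obtain ⟨i, hi⟩ := h2
    exact (cochainDiff m σ).map_coord_zero i (eq_zero_of_isHomogeneous (hf i) hi)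

theorem cochainDiff_act {m : ℕ} {σ : Cochain 1 m} (a : Sp 1)
    (hσ : ∀ f : Fin m → ham0 1, σ (fun i => act a (f i)) = σ f) (f : Fin (m + 1) → ham0 1) :
    cochainDiff m σ (fun i => act a (f i)) = cochainDiff m σ f := by
  change ceDiff m σ.toAlternatingMap _ = ceDiff m σ.toAlternatingMap _
  cases m with
  | zero => rw [ceDiff_zero]; rfl
  | succ m =>
    rw [ceDiff_apply, ceDiff_apply]
    refine Finset.sum_congr rfl fun i _ => Finset.sum_congr rfl fun j _ => ?_
    split_ifs
    · refine congrArg _ (Eq.trans ?_ (hσ (Fin.cons _ _)))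
      refine congrArg σ ?_
      funext k
      refine Fin.cases ?_ (fun k => ?_) k
      · exact (substHam_bracket (a⁻¹ : Sp 1).2 _ _).symm
      · rfl
    · rfl

/-! ### Invariance under a one-parameter group -/

/-- If a form takes a constant value along `f + s • g s`, then so does its first variation. -/
theorem sum_update_eq_zero {m : ℕ} (σ : Cochain 1 m) (f : Fin m → ham0 1)
    (g : ℝ → Fin m → ham0 1) (hg : ∀ i, ContinuousAt (fun s => g s i) 0)
    (h : ∀ s, σ (fun i => f i + s • g s i) = σ f) :
    ∑ i, σ (Function.update f i (g 0 i)) = 0 := by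
  classical
  -- the quotient of the increment by `s`, extended to `s = 0`
  let φ : ℝ → ℝ := fun s => ∑ S : Finset (Fin m), if S = ∅ then 0 else
    s ^ (S.card - 1) * σ (S.piecewise (g s) f)
  have hφ : ContinuousAt φ 0 := by
    refine tendsto_finsetSum _ fun S _ => ?_
    split_ifs
    · exact tendsto_const_nhds
    · refine ContinuousAt.mul (by fun_prop) (σ.cont.continuousAt.comp (continuousAt_pi.2 fun i => ?_))
      by_cases hi : i ∈ S
      · simpa only [Finset.piecewise_eq_of_mem _ _ _ hi] using hg i
      · simpa only [Finset.piecewise_eq_of_notMem _ _ _ hi] using continuousAt_const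
  have h0 : ∀ s ≠ 0, φ s = 0 := by
    intro s hs
    have h1 := h s
    have h2 := σ.toMultilinearMap.map_add_univ (fun i => s • g s i) f
    have h3 : ∀ S : Finset (Fin m), σ (S.piecewise (fun i => s • g s i) f) =
        s ^ S.card * σ (S.piecewise (g s) f) := by
      intro S
      have := σ.toMultilinearMap.map_piecewise_smul (fun _ => s) (S.piecewise (g s) f) S
      rw [Finset.prod_const] at this
      rw [← smul_eq_mul]
      refine Eq.trans (congrArg σ ?_) this
      funext i
      by_cases hi : i ∈ S <;> simp [hi]
    have h4 : σ (fun i => f i + s • g s i) = ∑ S : Finset (Fin m),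
        s ^ S.card * σ (S.piecewise (g s) f) := by
      rw [← Finset.sum_congr rfl fun S _ => h3 S]
      exact (congrArg σ (funext fun i => add_comm _ _)).trans h2
    -- the terms with nonempty `S` add up to the increment of `σ`
    have h5 : s * φ s = 0 := by
      refine Eq.trans ?_ (sub_eq_zero.2 (h4.symm.trans h1))
      rw [Finset.mul_sum,
        ← Finset.add_sum_erase _ _ (Finset.mem_univ ∅),
        ← Finset.add_sum_erase _ (fun S : Finset (Fin m) => s ^ S.card * σ (S.piecewise (g s) f))
          (Finset.mem_univ ∅)]
      simp only [if_true, mul_zero, zero_add, Finset.card_empty, pow_zero, one_mul,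
        Finset.piecewise_empty, add_sub_cancel_left]
      refine Finset.sum_congr rfl fun S hS => ?_
      have hS := Finset.ne_of_mem_erase hS
      rw [if_neg hS, ← mul_assoc, ← pow_succ', Nat.sub_add_cancel
        (Finset.card_pos.2 (Finset.nonempty_iff_ne_empty.2 hS))]
    exact (mul_eq_zero.1 h5).resolve_left hs
  have h6 : φ 0 = 0 := by
    refine tendsto_nhds_unique (hφ.tendsto.mono_left nhdsWithin_le_nhds) (f := φ)
      (l := 𝓝[≠] (0 : ℝ)) ?_
    exact tendsto_const_nhds.congr' (eventually_mem_nhdsWithin.mono fun s hs => (h0 s hs).symm)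
  have h7 : ∀ S : Finset (Fin m), S ∉ Finset.univ.map ⟨fun i : Fin m => ({i} : Finset (Fin m)),
      Finset.singleton_injective⟩ → (if S = ∅ then 0 else
        (0 : ℝ) ^ (S.card - 1) * σ (S.piecewise (g 0) f)) = 0 := by
    intro S hS
    split_ifs with hE
    · rfl
    · have : S.card - 1 ≠ 0 := by
        intro hc
        have : S.card = 1 := by
          have := Finset.card_pos.2 (Finset.nonempty_iff_ne_empty.2 hE)
          omega
        obtain ⟨i, rfl⟩ := Finset.card_eq_one.1 this
        exact hS (by simp)
      rw [zero_pow this, zero_mul]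
  refine Eq.trans ?_ h6
  change _ = ∑ S : Finset (Fin m), _
  rw [← Finset.sum_subset (Finset.subset_univ (Finset.univ.map ⟨fun i : Fin m =>
    ({i} : Finset (Fin m)), Finset.singleton_injective⟩)) fun S _ hS => h7 S hS, Finset.sum_map]
  refine Finset.sum_congr rfl fun i _ => ?_
  simp [Finset.piecewise_singleton]

end RelDiff

section InfInvariance

open MvPowerSeries Filter Topology

theorem tendsto_ham0_iff {ι : Type*} {l : Filter ι} {u : ι → ham0 1} {y : ham0 1} :
    Tendsto u l (𝓝 y) ↔ ∀ e, Tendsto (fun s => coeff e (u s).1) l (𝓝 (coeff e y.1)) := by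
  rw [tendsto_subtype_rng]
  exact WithPiTopology.tendsto_iff_coeff_tendsto _ _ _

/-- The derivative of a linear substitution along a curve of matrices starting at the identity is
a linear vector field. -/
theorem hasDerivAt_coeff_aeval_linForm {A : ℝ → Mat} {A' : Mat} (h0 : A 0 = 1)
    (hd : ∀ i j, HasDerivAt (fun s => A s i j) (A' i j) 0) (P : MvPolynomial (Fin 1 ⊕ Fin 1) ℝ)
    (e : (Fin 1 ⊕ Fin 1) →₀ ℕ) :
    HasDerivAt (fun s => (MvPolynomial.aeval (linForm (A s)) P).coeff e)
      ((∑ i, linForm A' i * MvPolynomial.pderiv i P).coeff e) 0 := by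
  classical
  have hlin (k : Fin 1 ⊕ Fin 1) (c : (Fin 1 ⊕ Fin 1) →₀ ℕ) :
      HasDerivAt (fun s => (linForm (A s) k).coeff c) ((linForm A' k).coeff c) 0 := by
    simp only [linForm, MvPolynomial.coeff_sum, MvPolynomial.coeff_C_mul]
    exact HasDerivAt.fun_sum fun j _ => (hd k j).mul_const _
  induction P using MvPolynomial.induction_on generalizing e with
  | C a => simpa [MvPolynomial.algebraMap_eq] using hasDerivAt_const (0 : ℝ) _
  | add P Q hP hQ =>
    simp only [map_add, mul_add, Finset.sum_add_distrib, MvPolynomial.coeff_add]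
    exact (hP e).fun_add (hQ e)
  | mul_X P k hP =>
    have h1 : ∑ i, linForm A' i * MvPolynomial.pderiv i (P * MvPolynomial.X k) =
        (∑ i, linForm A' i * MvPolynomial.pderiv i P) * MvPolynomial.X k + P * linForm A' k := by
      simp only [Derivation.leibniz, smul_eq_mul, mul_add, Finset.sum_add_distrib, Finset.sum_mul]
      rw [add_comm]
      congr 1
      · exact Finset.sum_congr rfl fun i _ => by ring
      · rw [Finset.sum_eq_single k]
        · simp; ring
        · intro i _ hi
          simp [MvPolynomial.pderiv_X, hi.symm]
        · simp
    simp only [map_mul, MvPolynomial.aeval_X]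
    rw [h1, MvPolynomial.coeff_add]
    simp only [MvPolynomial.coeff_mul]
    rw [← Finset.sum_add_distrib]
    refine HasDerivAt.fun_sum fun c _ => ?_
    have h2 := (hP c.1).fun_mul (hlin k c.2)
    simp only [h0, linForm_one, MvPolynomial.aeval_X_left_apply] at h2
    exact h2

/-- Invariance under a curve in the symplectic group implies infinitesimal invariance. -/
theorem lieDer_eq_zero_of_curve {m : ℕ} {σ : Cochain 1 m}
    (hσ : ∀ (a : Sp 1) (f : Fin m → ham0 1), σ (fun i => act a (f i)) = σ f)
    {A : ℝ → Mat} {A' : Mat} (hA : ∀ s, A s ∈ Matrix.symplecticGroup (Fin 1) ℝ) (h0 : A 0 = 1)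
    (hd : ∀ i j, HasDerivAt (fun s => A s i j) (A' i j) 0) {X : ham0 1}
    (hq : pderiv ℝ (Sum.inl 0) X.1 = linForm A' (Sum.inr 0))
    (hp : pderiv ℝ (Sum.inr 0) X.1 = -linForm A' (Sum.inl 0)) :
    lieDer m X σ.toAlternatingMap = 0 := by
  -- the Lie derivative is continuous, so that its vanishing can be checked on monomials
  let φ : ContinuousMultilinearMap ℝ (fun _ : Fin m => ham0 1) ℝ :=
    { (lieDer m X σ.toAlternatingMap).toMultilinearMap with
      cont := by
        change Continuous fun v => lieDer m X σ.toAlternatingMap v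
        simp only [lieDer_apply]
        refine (continuous_finsetSum _ fun i _ => ?_).neg
        have h : Continuous σ := σ.cont
        exact h.comp (continuous_id.update i
          (continuous_bracket.comp₂ continuous_const (continuous_apply i))) }
  suffices hφ : φ = 0 by
    ext v
    exact DFunLike.congr_fun hφ v
  refine eq_zero_of_monomials φ fun e he => ?_
  change lieDer m X σ.toAlternatingMap _ = 0
  rw [lieDer_apply, neg_eq_zero]
  let c : ℝ → Fin m → ham0 1 := fun s i => substHam (A s) (hamMonomial (e i))
  -- the difference quotients, extended to `s = 0` by the derivative `[X, ·]`
  let g : ℝ → Fin m → ham0 1 := fun s i => if s = 0 then ⁅X, hamMonomial (e i)⁆ else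
    s⁻¹ • (c s i - hamMonomial (e i))
  have hg0 : ∀ i, g 0 i = ⁅X, hamMonomial (e i)⁆ := fun i => if_pos rfl
  have key := sum_update_eq_zero σ (fun i => hamMonomial (e i)) g (fun i => ?_) fun s => ?_
  · simp only [hg0] at key
    exact key
  · rw [continuousAt_iff_punctured_nhds, hg0, tendsto_ham0_iff]
    intro b
    have h1 := hasDerivAt_coeff_aeval_linForm h0 hd (MvPolynomial.monomial (e i) (1 : ℝ)) b
    have h2 : coeff b (⁅X, hamMonomial (e i)⁆ : ham0 1).1 =
        (∑ j, linForm A' j * MvPolynomial.pderiv j (MvPolynomial.monomial (e i) (1 : ℝ))).coeff b := by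
      rw [bracket_val, poisson_eq, hq, hp, hamMonomial_val (he i), ← MvPolynomial.coe_monomial,
        pderiv_coe, pderiv_coe, ← MvPolynomial.coeff_coe, Fintype.sum_sum_type, Fin.sum_univ_one,
        Fin.sum_univ_one, MvPolynomial.coe_add, MvPolynomial.coe_mul, MvPolynomial.coe_mul]
      congr 1
      ring
    rw [h2]
    refine (hasDerivAt_iff_tendsto_slope_zero.1 h1).congr' ?_
    filter_upwards [self_mem_nhdsWithin] with s hs
    have h3 (t : ℝ) : coeff b (c t i).1 =
        (MvPolynomial.aeval (linForm (A t)) (MvPolynomial.monomial (e i) (1 : ℝ))).coeff b := by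
      rw [substHam_val, hamMonomial_val (he i), subst_linForm_monomial, MvPolynomial.coeff_coe]
    have h4 : hamMonomial (e i) = c 0 i := by
      change _ = substHam (A 0) _
      rw [h0, substHam_one]
    simp only [g, if_neg (show s ≠ 0 from hs), zero_add]
    rw [h4, ← h3, ← h3, SetLike.val_smul, coeff_smul, Submodule.coe_sub, map_sub, smul_eq_mul]
  · have h1 : ∀ i, hamMonomial (e i) + s • g s i = c s i := by
      intro i
      by_cases hs : s = 0
      · simp only [c, hs, h0, substHam_one, zero_smul, add_zero]
      · simp only [g, if_neg hs, smul_inv_smul₀ hs, add_sub_cancel]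
    simp only [h1]
    have h2 := hσ (⟨A s, hA s⟩⁻¹ : Sp 1) fun i => hamMonomial (e i)
    simpa only [act_eq_substHam, inv_inv] using h2

theorem hasDerivAt_mat2 {x y z w : ℝ → ℝ} {x' y' z' w' : ℝ} (hx : HasDerivAt x x' 0)
    (hy : HasDerivAt y y' 0) (hz : HasDerivAt z z' 0) (hw : HasDerivAt w w' 0)
    (i j : Fin 1 ⊕ Fin 1) :
    HasDerivAt (fun s => mat2 (x s) (y s) (z s) (w s) i j) (mat2 x' y' z' w' i j) 0 := by
  rcases i with i | i <;> rcases j with j | j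
  exacts [hx, hy, hz, hw]

theorem pderiv_monomial_expo (a b : ℕ) :
    pderiv ℝ (Sum.inl 0 : Fin 1 ⊕ Fin 1) (MvPowerSeries.monomial (expo a b) (1 : ℝ)) =
        MvPowerSeries.monomial (expo (a - 1) b) (a : ℝ) ∧
      pderiv ℝ (Sum.inr 0 : Fin 1 ⊕ Fin 1) (MvPowerSeries.monomial (expo a b) (1 : ℝ)) =
        MvPowerSeries.monomial (expo a (b - 1)) (b : ℝ) := by
  have h1 : expo a b - Finsupp.single (Sum.inl 0) 1 = expo (a - 1) b := by
    ext (i | i) <;> simp [Subsingleton.elim i 0]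
  have h2 : expo a b - Finsupp.single (Sum.inr 0) 1 = expo a (b - 1) := by
    ext (i | i) <;> simp [Subsingleton.elim i 0]
  constructor
  · rw [← MvPolynomial.coe_monomial, pderiv_coe, MvPolynomial.pderiv_monomial, h1, expo_inl,
      one_mul, MvPolynomial.coe_monomial]
  · rw [← MvPolynomial.coe_monomial, pderiv_coe, MvPolynomial.pderiv_monomial, h2, expo_inr,
      one_mul, MvPolynomial.coe_monomial]

theorem linForm_mat2 (x y z w : ℝ) :
    (linForm (mat2 x y z w) (Sum.inl 0) : MvPowerSeries (Fin 1 ⊕ Fin 1) ℝ) =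
        MvPowerSeries.monomial (expo 1 0) x + MvPowerSeries.monomial (expo 0 1) y ∧
      (linForm (mat2 x y z w) (Sum.inr 0) : MvPowerSeries (Fin 1 ⊕ Fin 1) ℝ) =
        MvPowerSeries.monomial (expo 1 0) z + MvPowerSeries.monomial (expo 0 1) w := by
  have h1 : Finsupp.single (Sum.inl 0) 1 = expo 1 0 := by
    ext (i | i) <;> simp [Subsingleton.elim i 0]
  have h2 : Finsupp.single (Sum.inr 0) 1 = expo 0 1 := by
    ext (i | i) <;> simp [Subsingleton.elim i 0]
  constructor <;>
  · simp only [linForm, Fintype.sum_sum_type, Fin.sum_univ_one, MvPolynomial.X,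
      MvPolynomial.C_mul_monomial, MvPolynomial.coe_add, MvPolynomial.coe_monomial, mul_one, h1, h2]
    rfl

/-- An invariant form is annihilated by the Lie derivatives along quadratic potentials. -/
theorem lieDer_eq_zero {m : ℕ} {σ : Cochain 1 m}
    (hσ : ∀ (a : Sp 1) (f : Fin m → ham0 1), σ (fun i => act a (f i)) = σ f) {X : ham0 1}
    (hX : X.1.IsHomogeneous 2) : lieDer m X σ.toAlternatingMap = 0 := by
  have h20 : (hamMonomial (expo 2 0)).1 = _ := hamMonomial_val (by simp)
  have h11 : (hamMonomial (expo 1 1)).1 = _ := hamMonomial_val (by simp)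
  have h02 : (hamMonomial (expo 0 2)).1 = _ := hamMonomial_val (by simp)
  -- `q²` and `p²` generate the two groups of shears, and `qp` generates the torus
  have hqq : lieDer m (hamMonomial (expo 2 0)) σ.toAlternatingMap = 0 := by
    refine lieDer_eq_zero_of_curve hσ (A := fun s => mat2 1 0 (2 * s) 1) (A' := mat2 0 0 2 0)
      (fun s => (mat2_mem _ _ _ _).2 (by ring)) (by simp [mat2_one]) ?_ ?_ ?_
    · exact hasDerivAt_mat2 (hasDerivAt_const _ _) (hasDerivAt_const _ _)
        (by simpa using (hasDerivAt_id (0 : ℝ)).const_mul 2) (hasDerivAt_const _ _)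
    · rw [h20, (pderiv_monomial_expo 2 0).1, (linForm_mat2 _ _ _ _).2]
      simp
    · rw [h20, (pderiv_monomial_expo 2 0).2, (linForm_mat2 _ _ _ _).1]
      simp
  have hpp : lieDer m (hamMonomial (expo 0 2)) σ.toAlternatingMap = 0 := by
    refine lieDer_eq_zero_of_curve hσ (A := fun s => mat2 1 (-2 * s) 0 1) (A' := mat2 0 (-2) 0 0)
      (fun s => (mat2_mem _ _ _ _).2 (by ring)) (by simp [mat2_one]) ?_ ?_ ?_
    · exact hasDerivAt_mat2 (hasDerivAt_const _ _)
        (by have h := (hasDerivAt_id (0 : ℝ)).const_mul (-2); rwa [mul_one] at h) (hasDerivAt_const _ _)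
        (hasDerivAt_const _ _)
    · rw [h02, (pderiv_monomial_expo 0 2).1, (linForm_mat2 _ _ _ _).2]
      simp
    · rw [h02, (pderiv_monomial_expo 0 2).2, (linForm_mat2 _ _ _ _).1]
      simp
  have hqp : lieDer m (hamMonomial (expo 1 1)) σ.toAlternatingMap = 0 := by
    refine lieDer_eq_zero_of_curve hσ (A := fun s => mat2 (Real.exp (-s)) 0 0 (Real.exp s))
      (A' := mat2 (-1) 0 0 1)
      (fun s => (mat2_mem _ _ _ _).2 (by rw [← Real.exp_add]; simp)) (by simp [mat2_one]) ?_ ?_ ?_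
    · exact hasDerivAt_mat2 (by simpa using (hasDerivAt_id (0 : ℝ)).neg.exp)
        (hasDerivAt_const _ _) (hasDerivAt_const _ _)
        (by simpa using (hasDerivAt_id (0 : ℝ)).exp)
    · rw [h11, (pderiv_monomial_expo 1 1).1, (linForm_mat2 _ _ _ _).2]
      simp
    · rw [h11, (pderiv_monomial_expo 1 1).2, (linForm_mat2 _ _ _ _).1]
      simp
  have hdec : X = coeff (expo 2 0) X.1 • hamMonomial (expo 2 0) +
      coeff (expo 1 1) X.1 • hamMonomial (expo 1 1) +
      coeff (expo 0 2) X.1 • hamMonomial (expo 0 2) := by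
    classical
    refine Subtype.ext (MvPowerSeries.ext fun c => ?_)
    simp only [Submodule.coe_add, SetLike.val_smul, h20, h11, h02, map_add, coeff_smul,
      coeff_monomial]
    by_cases hc : c.degree = 2
    · obtain ⟨a, b, rfl⟩ : ∃ a b, c = expo a b := ⟨_, _, (expo_eta c).symm⟩
      rw [degree_expo] at hc
      obtain ⟨rfl, rfl⟩ | ⟨rfl, rfl⟩ | ⟨rfl, rfl⟩ :
          a = 2 ∧ b = 0 ∨ a = 1 ∧ b = 1 ∨ a = 0 ∧ b = 2 := by omega
      all_goals simp [expo_inj]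
    · rw [isHomogeneous_iff.1 hX c hc]
      have : ∀ a b, a + b = 2 → c ≠ expo a b := by
        rintro a b hab rfl
        exact hc (by simpa using hab)
      simp [this]
  rw [hdec, map_add, map_add, map_smul, map_smul, map_smul, LinearMap.add_apply,
    LinearMap.add_apply, LinearMap.smul_apply, LinearMap.smul_apply, LinearMap.smul_apply,
    hqq, hqp, hpp]
  simp

/-- The Chevalley-Eilenberg differential preserves relative cochains. The contraction of `dσ` with
a quadratic `X` vanishes by Cartan's formula, as both `L_X σ` and `ι_X σ` do. -/
theorem cochainDiff_mem_relCochain {m w : ℕ} {σ : Cochain 1 m} (hσ : σ ∈ relCochain 1 m w) :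
    cochainDiff m σ ∈ relCochain 1 (m + 1) w := by
  obtain ⟨h1, h2, h3⟩ := hσ
  refine ⟨cochainDiff_mem_weightCochain h1, fun f hf => ?_, fun a f => cochainDiff_act a (h3 a) f⟩
  have hX : ∀ f : Fin (m + 1) → ham0 1, (f 0).1.IsHomogeneous 2 →
      ceDiff m σ.toAlternatingMap f = 0 := by
    intro f hf
    cases m with
    | zero => rw [ceDiff_zero]; rfl
    | succ m =>
      have h4 : interior (f 0) σ.toAlternatingMap = 0 :=
        AlternatingMap.ext fun v => h2 _ ⟨0, hf⟩
      have h5 : interior (f 0) (ceDiff (m + 1) σ.toAlternatingMap) = 0 := by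
        rw [interior_ceDiff, lieDer_eq_zero h3 hf, h4, map_zero, sub_zero]
      have h6 := DFunLike.congr_fun h5 (Matrix.vecTail f)
      rw [interior_apply] at h6
      exact (congrArg _ (Matrix.cons_head_tail f).symm).trans h6
  obtain ⟨i, hi⟩ := hf
  change ceDiff m σ.toAlternatingMap f = 0
  have h7 := (ceDiff m σ.toAlternatingMap).map_perm f (Equiv.swap 0 i)
  rw [hX _ (by rw [Function.comp_apply, Equiv.swap_apply_left]; exact hi)] at h7
  exact (smul_eq_zero_iff_eq _).1 h7.symm

end InfInvariance

/-! ### The Euler characteristic of the relative complex -/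

section Euler

theorem mem_coboundaries_iff {m w : ℕ} {τ : relCochain 1 (m + 1) w} :
    τ ∈ coboundaries 1 (m + 1) w ↔ ∃ σ ∈ relCochain 1 m w, cochainDiff m σ = τ.1 := by
  refine exists_congr fun σ => and_congr_right fun _ => ?_
  rw [← DFunLike.coe_injective.eq_iff, funext_iff]
  exact forall_congr' fun X => by rw [d_eq_cochainDiff]

theorem mem_cocycles_iff {m w : ℕ} {σ : relCochain 1 m w} :
    σ ∈ cocycles 1 m w ↔ cochainDiff m σ.1 = 0 := by
  have h : d 1 m σ.1 = cochainDiff m σ.1 := funext (d_eq_cochainDiff σ.1)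
  change d 1 m σ.1 = 0 ↔ _
  rw [h]
  exact DFunLike.coe_injective.eq_iff (b := (0 : Cochain 1 (m + 1)))

theorem coboundaries_le_cocycles (m w : ℕ) : coboundaries 1 m w ≤ cocycles 1 m w := by
  cases m with
  | zero => exact bot_le
  | succ m =>
    intro τ hτ
    obtain ⟨σ, _, h⟩ := mem_coboundaries_iff.1 hτ
    rw [mem_cocycles_iff, ← h, cochainDiff_cochainDiff]

/-- Rank-nullity for `d` on relative cochains, whose image consists of the coboundaries because `d`
preserves relative cochains. -/
theorem finrank_cocycles_add_finrank_coboundaries (m w : ℕ) :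
    Module.finrank ℝ (cocycles 1 m w) + Module.finrank ℝ (coboundaries 1 (m + 1) w) =
      Module.finrank ℝ (relCochain 1 m w) := by
  have := finiteDimensional_relCochain m w
  let j : relCochain 1 (m + 1) w →ₗ[ℝ] ((Fin (m + 1) → ham0 1) → ℝ) :=
    { toFun := fun τ => τ.1
      map_add' := fun _ _ => rfl
      map_smul' := fun _ _ => rfl }
  have hj : Function.Injective j := fun _ _ h =>
    Subtype.ext (DFunLike.coe_injective h)
  have h1 : LinearMap.range ((d 1 m).comp (relCochain 1 m w).subtype) =
      (coboundaries 1 (m + 1) w).map j := by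
    ext F
    constructor
    · rintro ⟨σ, rfl⟩
      exact ⟨⟨cochainDiff m σ.1, cochainDiff_mem_relCochain σ.2⟩,
        mem_coboundaries_iff.2 ⟨σ.1, σ.2, rfl⟩, funext fun X => (d_eq_cochainDiff σ.1 X).symm⟩
    · rintro ⟨τ, ⟨σ, hσ, h⟩, rfl⟩
      exact ⟨⟨σ, hσ⟩, funext h⟩
  have h2 := LinearMap.finrank_range_add_finrank_ker ((d 1 m).comp (relCochain 1 m w).subtype)
  rw [h1, ← (Submodule.equivMapOfInjective j hj _).finrank_eq, add_comm] at h2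
  exact h2

theorem coboundaries_eq_cocycles {m w : ℕ} (h : betti 1 m w = 0) :
    coboundaries 1 m w = cocycles 1 m w := by
  have := finiteDimensional_relCochain m w
  refine le_antisymm (coboundaries_le_cocycles m w) ?_
  have h1 := Module.finrank_zero_iff.1 h
  rw [Submodule.Quotient.subsingleton_iff] at h1
  exact Submodule.comap_subtype_eq_top.1 h1

/-- A cochain of degree `0` has weight `0`. -/
theorem relCochain_zero {w : ℕ} (hw : 0 < w) : relCochain 1 0 w = ⊥ := by
  refine (Submodule.eq_bot_iff _).2 fun σ hσ => ?_
  ext v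
  exact hσ.1 v (fun _ => 0) (fun i => i.elim0) (by simp; omega)

/-- The dimension of `C^m_w` is `b m + b (m + 1)`, where `b m` is the dimension of the coboundaries
of degree `m`. The alternating sum telescopes, and the boundary terms vanish since `C^0_w` and
`C^{w+1}_w` are zero for `w > 0`. In weight `0` the sum defining `χ` is empty. -/
theorem euler_eq_one {w : ℕ} (h : ∀ m, 1 ≤ m → betti 1 m w = 0) : euler 1 w = 1 := by
  rcases Nat.eq_zero_or_pos w with rfl | hw
  · simp [euler]
  set b : ℕ → ℤ := fun m => Module.finrank ℝ (coboundaries 1 m w) with hb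
  have h1 : ∀ m, 1 ≤ m → (Module.finrank ℝ (relCochain 1 m w) : ℤ) = b m + b (m + 1) := by
    intro m hm
    rw [← finrank_cocycles_add_finrank_coboundaries, ← coboundaries_eq_cocycles (h m hm)]
    push_cast
    rfl
  have h2 : ∀ n, ∑ m ∈ Finset.Icc 1 n, (-1 : ℤ) ^ m * (Module.finrank ℝ (relCochain 1 m w) : ℤ) =
      (-1) ^ n * b (n + 1) - b 1 := by
    intro n
    induction n with
    | zero => simp
    | succ n ih =>
      rw [Finset.sum_Icc_succ_top (by omega), ih, h1 _ (by omega)]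
      ring
  have h3 : b 1 = 0 := by
    have h := finrank_cocycles_add_finrank_coboundaries 0 w
    have h' : Module.finrank ℝ (relCochain 1 0 w) = 0 := by rw [relCochain_zero hw, finrank_bot]
    rw [h'] at h
    exact congrArg Nat.cast (add_eq_zero.1 h).2
  have h4 : b (w + 1) = 0 := by
    have h0 := h1 (w + 1) (by omega)
    have h' : Module.finrank ℝ (relCochain 1 (w + 1) w) = 0 := by
      rw [relCochain_eq_bot (Nat.lt_succ_self w), finrank_bot]
    rw [h', Nat.cast_zero] at h0
    have hp : ∀ n, 0 ≤ b n := fun n => Nat.cast_nonneg _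
    linarith [hp (w + 1), hp (w + 1 + 1)]
  rw [euler, h2, h3, h4]
  simp

end Euler

end FormalHam

theorem mainTheorem2 :
    -- the relative cochain spaces are finite-dimensional and vanish in degrees above the weight
    (∀ m w : ℕ, FiniteDimensional ℝ (FormalHam.relCochain 1 m w)) ∧
    (∀ m w : ℕ, w < m → FormalHam.relCochain 1 m w = ⊥) ∧
    -- their dimensions are multiplicities of the trivial representation of `Sp(2, ℝ)`
    (∀ m w : ℕ, Module.finrank ℝ (FormalHam.relCochain 1 m w) =
      ∑ k ∈ FormalHam.types m w, FormalHam.trivMult (FormalHam.typeRep 1 k)) ∧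
    -- the contribution of each type, the dimensions and the Euler characteristic are computable
    Computable (fun k : List ℕ => FormalHam.trivMult (FormalHam.typeRep 1 k.get)) ∧
    Computable (fun p : ℕ × ℕ => Module.finrank ℝ (FormalHam.relCochain 1 p.1 p.2)) ∧
    Computable (fun w : ℕ => FormalHam.euler 1 w) ∧
    -- the table of dimensions and Euler characteristics
    (∀ row ∈ FormalHam.table,
      (∀ m : ℕ, Module.finrank ℝ (FormalHam.relCochain 1 (m + 1) row.1) = row.2.1.getD m 0) ∧
      FormalHam.euler 1 row.1 = row.2.2) ∧
    -- an Euler characteristic different from `1` forces a nontrivial Betti number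
    (∀ w : ℕ, FormalHam.euler 1 w ≠ 1 → ∃ m : ℕ, 1 ≤ m ∧ FormalHam.betti 1 m w ≠ 0) := by
  refine ⟨FormalHam.finiteDimensional_relCochain, fun m w h => FormalHam.relCochain_eq_bot h,
    FormalHam.finrank_relCochain_eq_sum, FormalHam.computable_trivMult,
    FormalHam.primrec_finrank_relCochain.to_comp, FormalHam.computable_euler, fun row hrow =>
      ⟨FormalHam.finrank_of_mem_table row hrow, FormalHam.euler_of_mem_table row hrow⟩,
    fun w hw => ?_⟩
  by_contra! h
  exact hw (FormalHam.euler_eq_one h)
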